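/- Let $N\ge 1$, let $\Omega\subset\mathbb R^N$ be a bounded domain with Lipschitz boundary, and let $s\in(0,1)$, $2\le p<\infty$, $N>sp$. Put $$[u]_{s,p}^p=\int_{\mathbb R^N}\!\int_{\mathbb R^N}\frac{|u(x)-u(y)|^p}{|x-y|^{N+sp}}\,dy\,dx ,$$ let $W_0^{s,p}(\Omega)$ be the space of all $u\in L^p(\mathbb R^N)$ with $[u]_{s,p}<\infty$ and $u=0$ a.e. in $\mathbb R^N\setminus\Omega$, normed by $[\cdot]_{s,p}$, and let $X_0=W_0^{s,p}(\Omega)\setminus\{0\}$. Write $\|\cdot\|_q$ for the norm of $L^q(\Omega)$ and $$I(u)=[u]_{s,p}^p+\|u\|_p^p-\int_\Omega|u|^p\log|u|\,dx,\qquad E(u)=\tfrac1p I(u)+\tfrac1{p^2}\|u\|_p^p ,$$ $$d=\inf\{E(u):u\in X_0,\ I(u)=0\},\qquad \mathcal W=\{u\in X_0:\ E(u)<d,\ I(u)>0\},$$ $$K^{s,p}(u,v)=\int_{\mathbb R^N}\!\int_{\mathbb R^N}\frac{|u(x)-u(y)|^{p-2}(u(x)-u(y))}{|x-y|^{N+sp}}\,(v(x)-v(y))\,dy\,dx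 .$$ For every $\gamma>1$ there is a constant $C>0$, depending only on $N,s,p,\Omega,\gamma$, such that $$\int_\Omega|u|^p\log|u|\,dx\le\tfrac12[u]_{s,p}^p+C\,(\|u\|_p^p)^{\gamma}\qquad\text{for all }u\in W_0^{s,p}(\Omega).\tag{1}$$ Let $u_0\in\mathcal W$. Then the problem $$u_t+(-\Delta)^s_pu+|u|^{p-2}u=|u|^{p-2}u\log|u|\ \text{ in }\Omega\times(0,\infty),\qquad u=0\ \text{ in }(\mathbb R^N\setminus\Omega)\times(0,\infty),\qquad u(0)=u_0$$ has a global weak solution $u$, that is, $u\in L^\infty(0,\infty;W_0^{s,p}(\Omega))$, $u_t\in L^2(0,\infty;L^2(\Omega))$, $u(0)=u_0$ (for the representative of $u$ that is continuous from $[0,\infty)$ to $L^2(\Omega)$), and for a.e. $t>0$ and all $v\in W_0^{s,p}(\Omega)$ $$\int_\Omega u_tv\,dx+K^{s,p}(u,v)+\int_\Omega|u|^{p-2}uv\,dx=\int_\Omega|u|^{p-2}u\log|u|\,v\,dx ,$$ and it satisfies $u(t)\in W_0^{s,p}(\Omega)$ and $$\int_0^t\|u_\tau(\tau)\|_2^2\,d\tau+E(u(t))\le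 E(u_0)\qquad\text{for all }t\ge0 .$$ Moreover, let $\gamma>1$ and $C>0$ be any numbers for which (1) holds, and let $$R=\Big(\frac1C\Big)^{\frac1{p(\gamma-1)}},\qquad M=\frac{R^p}{p^2},\qquad \kappa=|\Omega|^{\frac{2-p}{2}}\Big(1-C\,\big(p^2E(u_0)\big)^{\gamma-1}\Big).$$ If $E(u_0)<M$, then $\kappa>0$, and this solution satisfies, if $p>2$, $$\|u(t)\|_2\le\|u_0\|_2\left(\frac{p}{2\big(1+\kappa(p-2)\|u_0\|_2^{p-2}t\big)}\right)^{\frac1{p-2}}\qquad\text{for all }t\ge0,$$ and, if $p=2$, the limit of this bound as $p\downarrow2$, namely $\|u(t)\|_2\le\|u_0\|_2\,e^{\frac12-\kappa t}$ for all $t\ge0$. -/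

import Mathlib

open MeasureTheory

noncomputable section

namespace FracLogHeat

/-- The space `ℝ^N` with its Euclidean norm and Lebesgue measure. -/
abbrev Rn (N : ℕ) : Type := EuclideanSpace ℝ (Fin N)

instance fact_one_le_ofReal (p : ℝ) [h : Fact (2 ≤ p)] : Fact ((1 : ENNReal) ≤ ENNReal.ofReal p) :=
  ⟨by
    have h2 : (2 : ℝ) ≤ p := h.out
    rw [← ENNReal.ofReal_one]
    exact ENNReal.ofReal_le_ofReal (by linarith)⟩

/-- Lipschitz boundary: near each boundary point, and after a rotation that sends the last
coordinate axis to the direction `e`, the set is the part above the graph of a Lipschitz function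
`g` of the component orthogonal to `e`. -/
def HasLipschitzBoundary {N : ℕ} (Ω : Set (Rn N)) : Prop :=
  ∀ x₀ ∈ frontier Ω, ∃ (r : ℝ) (e : Rn N) (g : Rn N → ℝ) (K : NNReal),
    0 < r ∧ ‖e‖ = 1 ∧ LipschitzWith K g ∧
      ∀ x ∈ Metric.ball x₀ r, (x ∈ Ω ↔ g (x - inner ℝ e x • e) < inner ℝ e x)

/-! ### The fractional Sobolev space with zero exterior values -/

/-- `|u(x) - u(y)|^p / |x - y|^(N + s p)`. -/
def gagliardoKernel {N : ℕ} (s p : ℝ) (u : Rn N → ℝ) (z : Rn N × Rn N) : ℝ :=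
  |u z.1 - u z.2| ^ p / ‖z.1 - z.2‖ ^ ((N : ℝ) + s * p)

/-- `[u]_{s,p}^p`, the `p`-th power of the Gagliardo seminorm. -/
def gagliardoPow {N : ℕ} (s p : ℝ) (u : Rn N → ℝ) : ℝ :=
  ∫ z : Rn N × Rn N, gagliardoKernel s p u z

/-- `u ∈ W₀^{s,p}(Ω)`: `u ∈ L^p`, `[u]_{s,p} < ∞` and `u = 0` a.e. outside `Ω`. -/
structure MemW0 {N : ℕ} (Ω : Set (Rn N)) (s p : ℝ) (u : Rn N → ℝ) : Prop where
  memLp : MemLp u (ENNReal.ofReal p) volume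
  finite_seminorm : Integrable (gagliardoKernel s p u) volume
  zero_outside : ∀ᵐ x ∂(volume : Measure (Rn N)), x ∉ Ω → u x = 0

/-- `u ∈ X₀ = W₀^{s,p}(Ω) \ {0}`. -/
def MemX0 {N : ℕ} (Ω : Set (Rn N)) (s p : ℝ) (u : Rn N → ℝ) : Prop :=
  MemW0 Ω s p u ∧ ¬ (u =ᵐ[volume] 0)

/-- The form `K^{s,p}(u,v)` of the fractional `p`-Laplacian. -/
def formK {N : ℕ} (s p : ℝ) (u v : Rn N → ℝ) : ℝ :=
  ∫ z : Rn N × Rn N,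
    |u z.1 - u z.2| ^ (p - 2) * (u z.1 - u z.2) / ‖z.1 - z.2‖ ^ ((N : ℝ) + s * p)
      * (v z.1 - v z.2)

/-! ### Energy, Nehari functional, potential well -/

/-- `∫_Ω |u|^p`. -/
def intPow {N : ℕ} (Ω : Set (Rn N)) (p : ℝ) (u : Rn N → ℝ) : ℝ :=
  ∫ x in Ω, |u x| ^ p

/-- `∫_Ω |u|^p log |u|` (the integrand is `0` where `u = 0`). -/
def intPowLog {N : ℕ} (Ω : Set (Rn N)) (p : ℝ) (u : Rn N → ℝ) : ℝ :=
  ∫ x in Ω, |u x| ^ p * Real.log |u x|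

/-- The energy `E(u)`. -/
def energy {N : ℕ} (Ω : Set (Rn N)) (s p : ℝ) (u : Rn N → ℝ) : ℝ :=
  1 / p * gagliardoPow s p u + 1 / p * intPow Ω p u - 1 / p * intPowLog Ω p u
    + 1 / p ^ 2 * intPow Ω p u

/-- The Nehari functional `I(u)`. -/
def nehari {N : ℕ} (Ω : Set (Rn N)) (s p : ℝ) (u : Rn N → ℝ) : ℝ :=
  gagliardoPow s p u + intPow Ω p u - intPowLog Ω p u

/-- The Nehari manifold. -/
def nehariManifold {N : ℕ} (Ω : Set (Rn N)) (s p : ℝ) : Set (Rn N → ℝ) :=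
  {u | MemX0 Ω s p u ∧ nehari Ω s p u = 0}

/-- The depth `d` of the potential well: the infimum of `E` over the Nehari manifold. -/
def wellDepth {N : ℕ} (Ω : Set (Rn N)) (s p : ℝ) : ℝ :=
  sInf (energy Ω s p '' nehariManifold Ω s p)

/-- The potential well. -/
def potentialWell {N : ℕ} (Ω : Set (Rn N)) (s p : ℝ) : Set (Rn N → ℝ) :=
  {u | MemX0 Ω s p u ∧ energy Ω s p u < wellDepth Ω s p ∧ 0 < nehari Ω s p u}

/-! ### Weak solutions -/

/-- The Hilbert space `L²(Ω)`. -/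
abbrev L2 {N : ℕ} (Ω : Set (Rn N)) : Type := Lp ℝ 2 ((volume : Measure (Rn N)).restrict Ω)

/-- Extension of `f ∈ L²(Ω)` by zero to `ℝ^N`. -/
def zeroExt {N : ℕ} (Ω : Set (Rn N)) (f : L2 Ω) : Rn N → ℝ :=
  Ω.indicator (f : Rn N → ℝ)

/-- `(u(x) - u(y)) / |x - y|^((N + s p) / p)`. The linear map `u ↦ gagliardoQuotient s p u` is an
isometry of `W₀^{s,p}(Ω)`, normed by `[·]_{s,p}`, into `L^p(ℝ^N × ℝ^N)`. -/
def gagliardoQuotient {N : ℕ} (s p : ℝ) (u : Rn N → ℝ) (z : Rn N × Rn N) : ℝ :=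
  (u z.1 - u z.2) / ‖z.1 - z.2‖ ^ (((N : ℝ) + s * p) / p)

/-- The time interval `(0,T)`, where `T = ⊤` gives `(0,∞)`. -/
def timeInterval (T : EReal) : Set ℝ := {t | 0 < t ∧ (t : EReal) < T}

/-- `u ∈ L^∞(0,T; W₀^{s,p}(Ω))` in the sense of Bochner; strong measurability into
`W₀^{s,p}(Ω)` and the essential supremum of the norm are read off in `L^p(ℝ^N × ℝ^N)` through the
isometry `gagliardoQuotient`. -/
def MemLinftyW0 {N : ℕ} (Ω : Set (Rn N)) (s p : ℝ) [Fact (2 ≤ p)] (T : EReal)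
    (u : ℝ → L2 Ω) : Prop :=
  ∃ q : ℝ → Lp ℝ (ENNReal.ofReal p) (volume : Measure (Rn N × Rn N)),
    MemLp q ⊤ (volume.restrict (timeInterval T)) ∧
      ∀ᵐ t ∂(volume.restrict (timeInterval T)),
        MemW0 Ω s p (zeroExt Ω (u t)) ∧
          (q t : Rn N × Rn N → ℝ) =ᵐ[volume] gagliardoQuotient s p (zeroExt Ω (u t))

/-- `u` is a weak solution in `Ω × (0,T)` of
`u_t + (-Δ)_p^s u + |u|^{p-2} u = |u|^{p-2} u log |u|`, `u = 0` outside `Ω`, `u(0) = u₀`, with time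
derivative `u_t = ut ∈ L²(0,T; L²(Ω))`. The function `u` is the representative that is continuous
from `[0,T)` to `L²(Ω)`. -/
structure IsWeakSolution {N : ℕ} (Ω : Set (Rn N)) (s p : ℝ) [Fact (2 ≤ p)] (u₀ : Rn N → ℝ)
    (T : EReal) (u ut : ℝ → L2 Ω) : Prop where
  memLinfty : MemLinftyW0 Ω s p T u
  deriv_memLp : MemLp ut 2 (volume.restrict (timeInterval T))
  deriv_eq : ∀ t ∈ timeInterval T, u t = u 0 + ∫ τ in (0 : ℝ)..t, ut τ
  equation : ∀ᵐ t ∂(volume.restrict (timeInterval T)), ∀ v : Rn N → ℝ, MemW0 Ω s p v →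
    (∫ x in Ω, ut t x * v x) + formK s p (zeroExt Ω (u t)) v
        + (∫ x in Ω, |u t x| ^ (p - 2) * u t x * v x)
      = ∫ x in Ω, |u t x| ^ (p - 2) * u t x * Real.log |u t x| * v x
  initial : (u 0 : Rn N → ℝ) =ᵐ[volume.restrict Ω] u₀

/-! ### The constants of the decay estimate -/

/-- `C` is an admissible constant `C(1/2)` for the exponent `γ`:
`∫_Ω |u|^p log |u| ≤ (1/2) [u]_{s,p}^p + C (‖u‖_p^p)^γ` on `W₀^{s,p}(Ω)`. -/
def IsLogConstant {N : ℕ} (Ω : Set (Rn N)) (s p γ C : ℝ) : Prop :=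
  0 < C ∧ ∀ u : Rn N → ℝ, MemW0 Ω s p u →
    intPowLog Ω p u ≤ 1 / 2 * gagliardoPow s p u + C * intPow Ω p u ^ γ

/-- `R = (1 / C)^(1 / (p (γ - 1)))`. -/
def radiusR (p γ C : ℝ) : ℝ := (1 / C) ^ (1 / (p * (γ - 1)))

/-- `M = R^p / p²`. -/
def boundM (p γ C : ℝ) : ℝ := radiusR p γ C ^ p / p ^ 2

/-- The decay rate `κ = |Ω|^((2 - p) / 2) (1 - C (p² E(u₀))^(γ - 1))`. -/
def kappa {N : ℕ} (Ω : Set (Rn N)) (s p γ C : ℝ) (u₀ : Rn N → ℝ) : ℝ :=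
  (volume : Measure (Rn N)).real Ω ^ ((2 - p) / 2)
    * (1 - C * (p ^ 2 * energy Ω s p u₀) ^ (γ - 1))

/-- `‖f‖_{L²(Ω)}` of a function. -/
def normL2 {N : ℕ} (Ω : Set (Rn N)) (f : Rn N → ℝ) : ℝ :=
  (eLpNorm f 2 ((volume : Measure (Rn N)).restrict Ω)).toReal

end FracLogHeat

end

/-! The equation is the L²-gradient flow of `energy`, and the potential well is a region this flow
cannot leave. The solution is obtained from an implicit time discretization that stays in the well.

The zeroth order term |r|^(p-2) r (1 - log|r|) is not monotone, but it equals `incPart - decPart`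
with both parts increasing, so the energy is a difference of convex functionals. One time step takes
the increasing part at the new time and the decreasing part at the old one: it minimizes a convex
functional plus ‖w - f‖²/(2τ) (`exists_step`). The tangent inequalities of the two convex pieces
then yield the discrete energy inequality.

The minimization runs over functions of mass ∫|w|^p ≤ p² d, and there I ≥ 0: if I(u) < 0, a multiple
cu with 0 < c < 1 lies on the Nehari manifold, where E is the mass divided by p², so that d is less
than mass(u)/p² (`nehari_nonneg`). As E = I/p + mass/p², the minimizer has mass at most p² E(u₀) <
p² d. The constraint is therefore inactive and the Euler equation holds.

The analysis rests on a Nash type inequality (`exists_integral_rpow_gainExp_le`), which controls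
∫|u|^q for some q > p by the mass and the seminorm. Combined with log y ≤ y - 1 it gives the
logarithmic inequality (`exists_isLogConstant`). It makes the lower order terms converge along
bounded a.e. convergent sequences (`tendsto_integral_of_ae_of_le_mul_add`). Together with averaging
over small balls it gives compactness of bounded sets in L²(Ω) (`isCompact_bddSet`).

As τ → 0 the discrete velocities converge weakly in L²(0,∞; L²(Ω)). Hence the discrete solutions
converge weakly at every time, and strongly by compactness. This suffices to pass to the limit in
the nonlinear form against a fixed test function, and Fatou's lemma preserves the energy inequality
(`exists_isFlow`).

For the decay, d/dt ‖u‖² = -2 I(u), while the logarithmic inequality, the mass bound and Hölder give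
I(u) ≥ κ ‖u‖^p. An ODE comparison finishes; the factors p/2 and e^(1/2) in the bounds are the slack
that makes the comparison strict. -/

open Filter Topology Set

noncomputable section

namespace FracLogHeat

/-! ### Scalar functions -/

/-- `|r|^(p-2) r (1 + log⁻|r|)`, the increasing part of the zeroth order term. -/
def incPart (p r : ℝ) : ℝ := |r| ^ (p - 2) * r * (1 + max 0 (-Real.log |r|))

/-- `|r|^(p-2) r log⁺|r|`, the decreasing part of the zeroth order term, with opposite sign. -/
def decPart (p r : ℝ) : ℝ := |r| ^ (p - 2) * r * max 0 (Real.log |r|)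

lemma incPart_sub_decPart (p r : ℝ) :
    incPart p r - decPart p r = |r| ^ (p - 2) * r - |r| ^ (p - 2) * r * Real.log |r| := by
  unfold incPart decPart
  rcases le_total 0 (Real.log |r|) with h | h
  · rw [max_eq_left (by linarith), max_eq_right h]; ring
  · rw [max_eq_right (by linarith), max_eq_left h]; ring

lemma abs_rpow_sub_two_mul_self {p r : ℝ} (hp : 2 ≤ p) (hr : 0 ≤ r) :
    |r| ^ (p - 2) * r = r ^ (p - 1) := by
  rw [abs_of_nonneg hr]
  rcases hr.eq_or_lt with rfl | h
  · rw [mul_zero, Real.zero_rpow (by linarith)]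
  · rw [← Real.rpow_add_one h.ne']; ring_nf

lemma abs_abs_rpow_sub_two_mul_self {p : ℝ} (hp : 2 ≤ p) (r : ℝ) :
    |(|r| ^ (p - 2) * r)| = |r| ^ (p - 1) := by
  rw [abs_mul, abs_of_nonneg (Real.rpow_nonneg (abs_nonneg r) _),
    ← abs_rpow_sub_two_mul_self hp (abs_nonneg r), abs_abs]

lemma abs_rpow_sub_two_mul_self_mul_self {p : ℝ} (hp : 2 ≤ p) (r : ℝ) :
    |r| ^ (p - 2) * r * r = |r| ^ p := by
  rcases eq_or_ne r 0 with rfl | h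
  · simp [Real.zero_rpow (show p ≠ 0 by linarith)]
  · have h' := abs_pos.2 h
    rw [mul_assoc, ← abs_mul_abs_self r, ← mul_assoc, ← Real.rpow_add_one h'.ne',
      ← Real.rpow_add_one h'.ne']
    ring_nf

lemma incPart_neg (p r : ℝ) : incPart p (-r) = -incPart p r := by
  unfold incPart; rw [abs_neg]; ring

lemma decPart_neg (p r : ℝ) : decPart p (-r) = -decPart p r := by
  unfold decPart; rw [abs_neg]; ring

lemma continuous_abs_rpow_sub_two_mul_self {p : ℝ} (hp : 2 ≤ p) :
    Continuous fun r : ℝ => |r| ^ (p - 2) * r :=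
  (continuous_abs.rpow_const fun _ => Or.inr (by linarith)).mul continuous_id

lemma continuous_abs_rpow_sub_two_mul_self_mul_log {p : ℝ} (hp : 2 ≤ p) :
    Continuous fun r : ℝ => |r| ^ (p - 2) * r * Real.log |r| := by
  have h : (fun r : ℝ => |r| ^ (p - 2) * r * Real.log |r|)
      = fun r : ℝ => |r| ^ (p - 2) * (r * Real.log r) := by
    ext r; rw [Real.log_abs]; ring
  rw [h]
  exact (continuous_abs.rpow_const fun _ => Or.inr (by linarith)).mul Real.continuous_mul_log

lemma continuous_abs_rpow_mul_log {p : ℝ} (hp : 2 ≤ p) :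
    Continuous fun r : ℝ => |r| ^ p * Real.log |r| := by
  have h : (fun r : ℝ => |r| ^ p * Real.log |r|)
      = fun r : ℝ => r * (|r| ^ (p - 2) * r * Real.log |r|) := by
    ext r; rw [← abs_rpow_sub_two_mul_self_mul_self hp]; ring
  rw [h]
  exact continuous_id.mul (continuous_abs_rpow_sub_two_mul_self_mul_log hp)

lemma decPart_of_nonneg {p r : ℝ} (hp : 2 ≤ p) (hr : 0 ≤ r) :
    decPart p r = r ^ (p - 1) * max 0 (Real.log r) := by
  unfold decPart
  rw [abs_rpow_sub_two_mul_self hp hr, abs_of_nonneg hr]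

lemma incPart_of_nonneg {p r : ℝ} (hp : 2 ≤ p) (hr : 0 ≤ r) :
    incPart p r = r ^ (p - 1) * (1 + max 0 (-Real.log r)) := by
  unfold incPart
  rw [abs_rpow_sub_two_mul_self hp hr, abs_of_nonneg hr]

lemma decPart_eq_log_max (p r : ℝ) :
    decPart p r = |r| ^ (p - 2) * r * Real.log (max 1 |r|) := by
  unfold decPart
  congr 1
  rcases le_total |r| 1 with h | h
  · rw [max_eq_left h, Real.log_one, max_eq_left (Real.log_nonpos (abs_nonneg r) h)]
  · rw [max_eq_right h, max_eq_right (Real.log_nonneg h)]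

lemma continuous_decPart {p : ℝ} (hp : 2 ≤ p) : Continuous (decPart p) := by
  have h : decPart p = fun r => |r| ^ (p - 2) * r * Real.log (max 1 |r|) :=
    funext (decPart_eq_log_max p)
  rw [h]
  refine (continuous_abs_rpow_sub_two_mul_self hp).mul (Continuous.log (by fun_prop) fun r => ?_)
  have : (1 : ℝ) ≤ max 1 |r| := le_max_left _ _
  linarith

lemma continuous_incPart {p : ℝ} (hp : 2 ≤ p) : Continuous (incPart p) := by
  have h : incPart p = fun r => decPart p r
      + (|r| ^ (p - 2) * r - |r| ^ (p - 2) * r * Real.log |r|) := by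
    ext r; rw [← incPart_sub_decPart]; ring
  rw [h]
  exact (continuous_decPart hp).add ((continuous_abs_rpow_sub_two_mul_self hp).sub
    (continuous_abs_rpow_sub_two_mul_self_mul_log hp))

lemma monotone_of_odd_of_monotoneOn {f : ℝ → ℝ} (hodd : ∀ r, f (-r) = -f r)
    (hmono : ∀ a b, 0 ≤ a → a ≤ b → f a ≤ f b) : Monotone f := by
  have h0 : f 0 = 0 := by have := hodd 0; simp at this; linarith
  intro a b hab
  rcases le_total 0 a with ha | ha
  · exact hmono a b ha hab
  rcases le_total 0 b with hb | hb
  · have h1 := hmono 0 (-a) le_rfl (by linarith)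
    have h2 := hmono 0 b le_rfl hb
    rw [hodd] at h1; linarith
  · have h1 := hmono (-b) (-a) (by linarith) (by linarith)
    rw [hodd, hodd] at h1; linarith

lemma monotone_decPart {p : ℝ} (hp : 2 ≤ p) : Monotone (decPart p) := by
  refine monotone_of_odd_of_monotoneOn (decPart_neg p) fun a b ha hab => ?_
  have hb := ha.trans hab
  rw [decPart_of_nonneg hp ha, decPart_of_nonneg hp hb]
  rcases ha.eq_or_lt with rfl | ha'
  · rw [Real.zero_rpow (by linarith), zero_mul]
    exact mul_nonneg (Real.rpow_nonneg hb _) (le_max_left _ _)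
  · have := Real.log_le_log ha' hab
    gcongr
    linarith

/-- On (0,1] the derivative of r (1 - log r) is -log r ≥ 0; the summand 1 in `incPart` is what makes
this work. The argument is run without derivatives, from log b - log a ≤ b/a - 1, after splitting
off the increasing factor r^(p-2). -/
lemma monotone_incPart {p : ℝ} (hp : 2 ≤ p) : Monotone (incPart p) := by
  refine monotone_of_odd_of_monotoneOn (incPart_neg p) fun a b ha hab => ?_
  have hb := ha.trans hab
  rw [incPart_of_nonneg hp ha, incPart_of_nonneg hp hb]
  rcases ha.eq_or_lt with rfl | ha'
  · rw [Real.zero_rpow (by linarith), zero_mul]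
    exact mul_nonneg (Real.rpow_nonneg hb _) (by positivity)
  have hb' := ha'.trans_le hab
  have hdec : ∀ r : ℝ, 0 < r →
      r ^ (p - 1) * (1 + max 0 (-Real.log r)) = r ^ (p - 2) * (r * (1 + max 0 (-Real.log r))) := by
    intro r hr
    rw [← mul_assoc, ← Real.rpow_add_one hr.ne']; ring_nf
  rw [hdec a ha', hdec b hb']
  have hlog : Real.log b - Real.log a ≤ b / a - 1 := by
    rw [← Real.log_div hb'.ne' ha'.ne']
    exact Real.log_le_sub_one_of_pos (by positivity)
  have hkey : a * (1 + max 0 (-Real.log a)) ≤ b * (1 + max 0 (-Real.log b)) := by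
    rcases le_total 0 (Real.log a) with h | h
    · rw [max_eq_left (by linarith)]
      have : (0 : ℝ) ≤ max 0 (-Real.log b) := le_max_left _ _
      nlinarith
    · rw [max_eq_right (by linarith)]
      rcases le_total 0 (Real.log b) with h' | h'
      · rw [max_eq_left (by linarith)]
        have : a * Real.log b - a * Real.log a ≤ b - a := by
          have := mul_le_mul_of_nonneg_left hlog ha
          rw [mul_sub, mul_sub, mul_div_cancel₀ _ ha'.ne'] at this; linarith
        nlinarith [mul_nonneg ha h']
      · rw [max_eq_right (by linarith)]
        have : a * Real.log b - a * Real.log a ≤ b - a := by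
          have := mul_le_mul_of_nonneg_left hlog ha
          rw [mul_sub, mul_sub, mul_div_cancel₀ _ ha'.ne'] at this; linarith
        nlinarith [mul_nonneg (sub_nonneg.2 hab) (neg_nonneg.2 h')]
  exact mul_le_mul (Real.rpow_le_rpow ha hab (by linarith)) hkey
    (mul_nonneg ha (by positivity)) (Real.rpow_nonneg hb _)

/-- The primitive of `incPart`. -/
def incPot (p r : ℝ) : ℝ := ∫ x in (0 : ℝ)..r, incPart p x

/-- The primitive of `decPart`. -/
def decPot (p r : ℝ) : ℝ := ∫ x in (0 : ℝ)..r, decPart p x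

/-- The primitive of an increasing function is convex; this is its tangent inequality with the
tangent at `b`. -/
lemma primitive_sub_le {f : ℝ → ℝ} (hf : Continuous f) (hm : Monotone f) (a b : ℝ) :
    (∫ x in (0 : ℝ)..b, f x) - (∫ x in (0 : ℝ)..a, f x) ≤ f b * (b - a) := by
  rw [intervalIntegral.integral_interval_sub_left (hf.intervalIntegrable _ _)
    (hf.intervalIntegrable _ _)]
  rcases le_total a b with h | h
  · have := intervalIntegral.integral_mono_on h (hf.intervalIntegrable a b)
      (continuous_const.intervalIntegrable (μ := volume) a b) fun x hx => hm hx.2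
    rw [intervalIntegral.integral_const, smul_eq_mul] at this; linarith
  · have := intervalIntegral.integral_mono_on h (continuous_const.intervalIntegrable (μ := volume) b a)
      (hf.intervalIntegrable b a) fun x hx => hm hx.1
    rw [intervalIntegral.integral_const, smul_eq_mul] at this
    rw [intervalIntegral.integral_symm]; linarith

lemma incPot_sub_le {p : ℝ} (hp : 2 ≤ p) (a b : ℝ) :
    incPot p b - incPot p a ≤ incPart p b * (b - a) :=
  primitive_sub_le (continuous_incPart hp) (monotone_incPart hp) a b

lemma decPot_sub_le {p : ℝ} (hp : 2 ≤ p) (a b : ℝ) :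
    decPot p b - decPot p a ≤ decPart p b * (b - a) :=
  primitive_sub_le (continuous_decPart hp) (monotone_decPart hp) a b

lemma continuous_incPot {p : ℝ} (hp : 2 ≤ p) : Continuous (incPot p) :=
  intervalIntegral.continuous_primitive
    (fun _ _ => (continuous_incPart hp).intervalIntegrable _ _) 0

lemma continuous_decPot {p : ℝ} (hp : 2 ≤ p) : Continuous (decPot p) :=
  intervalIntegral.continuous_primitive
    (fun _ _ => (continuous_decPart hp).intervalIntegrable _ _) 0

lemma incPart_zero (p : ℝ) : incPart p 0 = 0 := by simp [incPart]
lemma decPart_zero (p : ℝ) : decPart p 0 = 0 := by simp [decPart]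
lemma incPot_zero (p : ℝ) : incPot p 0 = 0 := by simp [incPot]
lemma decPot_zero (p : ℝ) : decPot p 0 = 0 := by simp [decPot]

lemma incPot_nonneg {p : ℝ} (hp : 2 ≤ p) (r : ℝ) : 0 ≤ incPot p r := by
  have := incPot_sub_le hp r 0
  rw [incPot_zero, incPart_zero] at this; linarith

lemma decPot_nonneg {p : ℝ} (hp : 2 ≤ p) (r : ℝ) : 0 ≤ decPot p r := by
  have := decPot_sub_le hp r 0
  rw [decPot_zero, decPart_zero] at this; linarith

lemma incPot_le {p : ℝ} (hp : 2 ≤ p) (r : ℝ) : incPot p r ≤ incPart p r * r := by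
  have := incPot_sub_le hp 0 r
  rw [incPot_zero] at this; linarith

lemma decPot_le {p : ℝ} (hp : 2 ≤ p) (r : ℝ) : decPot p r ≤ decPart p r * r := by
  have := decPot_sub_le hp 0 r
  rw [decPot_zero] at this; linarith

/-- Both sides vanish at 0 and have the same derivative elsewhere. The term |r|^p / p² compensates
for the extra |r|^(p-2) r / p produced when the logarithm in |r|^p log|r| / p is differentiated. -/
lemma incPot_sub_decPot {p : ℝ} (hp : 2 ≤ p) (r : ℝ) :
    incPot p r - decPot p r
      = 1 / p * |r| ^ p - 1 / p * (|r| ^ p * Real.log |r|) + 1 / p ^ 2 * |r| ^ p := by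
  have hp0 : p ≠ 0 := by linarith
  unfold incPot decPot
  rw [← intervalIntegral.integral_sub ((continuous_incPart hp).intervalIntegrable _ _)
    ((continuous_decPart hp).intervalIntegrable _ _)]
  have hc : Continuous fun r : ℝ =>
      1 / p * |r| ^ p - 1 / p * (|r| ^ p * Real.log |r|) + 1 / p ^ 2 * |r| ^ p := by
    have h1 : Continuous fun r : ℝ => |r| ^ p :=
      continuous_abs.rpow_const fun _ => Or.inr (by linarith)
    exact ((continuous_const.mul h1).sub
      (continuous_const.mul (continuous_abs_rpow_mul_log hp))).add (continuous_const.mul h1)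
  have := integral_eq_of_hasDerivAt_off_countable (a := 0) (b := r)
    (fun r : ℝ => 1 / p * |r| ^ p - 1 / p * (|r| ^ p * Real.log |r|) + 1 / p ^ 2 * |r| ^ p)
    (fun x => incPart p x - decPart p x) (countable_singleton (0 : ℝ)) hc.continuousOn ?_
    (((continuous_incPart hp).sub (continuous_decPart hp)).intervalIntegrable _ _)
  · rw [this]; simp [Real.zero_rpow hp0]
  · intro x hx
    have hx0 : x ≠ 0 := fun h => hx.2 (by simpa using h)
    have h1 := hasDerivAt_abs_rpow x (p := p) (by linarith)
    have h2 : HasDerivAt (fun r : ℝ => Real.log |r|) x⁻¹ x := by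
      simpa only [Real.log_abs] using Real.hasDerivAt_log hx0
    have h3 := ((h1.const_mul (1 / p)).sub ((h1.mul h2).const_mul (1 / p))).add
      (h1.const_mul (1 / p ^ 2))
    refine h3.congr_deriv ?_
    rw [incPart_sub_decPart, ← abs_rpow_sub_two_mul_self_mul_self hp x]
    field_simp
    ring

/-! ### Growth -/

/-- `log` is dominated by arbitrarily small powers, on both sides of `1`. -/
lemma exists_abs_rpow_mul_abs_log_le {a b : ℝ} (ha : 0 < a) (hab : a < b) :
    ∃ C, 0 ≤ C ∧ ∀ r : ℝ, |r| ^ a * |Real.log (|r|)| ≤ C * (1 + |r| ^ b) := by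
  -- The first summand serves |r| ≤ 1, the second |r| ≥ 1.
  refine ⟨1 / a + 1 / (b - a), by have := sub_pos.2 hab; positivity, fun r => ?_⟩
  have hba := sub_pos.2 hab
  rcases (abs_nonneg r).eq_or_lt with h | h
  · rw [← h, Real.zero_rpow ha.ne', Real.zero_rpow (by linarith)]; simp; positivity
  generalize |r| = t at h
  have hb0 := Real.rpow_nonneg h.le b
  rcases le_total t 1 with h1 | h1
  · have := Real.abs_log_mul_self_rpow_lt t a h h1 ha
    rw [abs_mul, abs_of_nonneg (Real.rpow_nonneg h.le a), mul_comm] at this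
    refine this.le.trans ?_
    have h3 : 0 ≤ 1 / (b - a) := by positivity
    have h4 : 0 ≤ 1 / a := by positivity
    nlinarith [mul_nonneg h3 hb0, mul_nonneg h4 hb0]
  · rw [abs_of_nonneg (Real.log_nonneg h1)]
    have h2 := Real.log_le_rpow_div h.le hba
    have h5 : t ^ a * Real.log t ≤ t ^ b / (b - a) := by
      calc t ^ a * Real.log t ≤ t ^ a * (t ^ (b - a) / (b - a)) := by gcongr
        _ = t ^ b / (b - a) := by
          rw [← mul_div_assoc, ← Real.rpow_add h]; ring_nf
    refine h5.trans ?_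
    have h3 : 0 ≤ 1 / (b - a) := by positivity
    have h4 : 0 ≤ 1 / a := by positivity
    rw [div_eq_mul_one_div]
    nlinarith [mul_nonneg h4 hb0]

lemma rpow_le_one_add_rpow {t a b : ℝ} (ht : 0 ≤ t) (ha : 0 ≤ a) (hab : a ≤ b) :
    t ^ a ≤ 1 + t ^ b := by
  rcases le_total t 1 with h | h
  · have := Real.rpow_le_one ht h ha
    have := Real.rpow_nonneg ht b
    linarith
  · have := Real.rpow_le_rpow_of_exponent_le h hab
    linarith

/-- Lower powers are absorbed by a small multiple of a higher power. -/
lemma exists_rpow_le_mul_rpow_add {a b ε : ℝ} (ha : 0 ≤ a) (hab : a < b) (hε : 0 < ε) :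
    ∃ C, 0 ≤ C ∧ ∀ t : ℝ, 0 ≤ t → t ^ a ≤ ε * t ^ b + C := by
  have hba := sub_pos.2 hab
  -- Beyond this threshold ε t^(b-a) ≥ 1, so no additive constant is needed there.
  set M := (1 / ε) ^ (1 / (b - a)) with hM
  have hM0 : 0 < M := by positivity
  refine ⟨M ^ a, by positivity, fun t ht => ?_⟩
  rcases le_total t M with h | h
  · have := Real.rpow_le_rpow ht h ha
    have := mul_nonneg hε.le (Real.rpow_nonneg ht b)
    linarith
  · have ht0 := hM0.trans_le h
    have h1 : 1 / ε ≤ t ^ (b - a) := by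
      calc 1 / ε = M ^ (b - a) := by
            rw [hM, ← Real.rpow_mul (by positivity), one_div_mul_cancel hba.ne', Real.rpow_one]
        _ ≤ t ^ (b - a) := Real.rpow_le_rpow hM0.le h hba.le
    have h2 : t ^ a ≤ ε * t ^ b := by
      calc t ^ a = ε * (1 / ε * t ^ a) := by field_simp
        _ ≤ ε * (t ^ (b - a) * t ^ a) := by gcongr
        _ = ε * t ^ b := by rw [← Real.rpow_add ht0]; ring_nf
    have : 0 ≤ M ^ a := by positivity
    linarith

/-- A Young type inequality without conjugate exponents. -/
lemma rpow_sub_one_mul_le {q ε a b : ℝ} (hq : 1 < q) (hε : 0 < ε) (ha : 0 ≤ a) (hb : 0 ≤ b) :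
    a ^ (q - 1) * b ≤ ε * a ^ q + (1 / ε) ^ (q - 1) * b ^ q := by
  have hmul : ∀ t : ℝ, 0 ≤ t → t ^ (q - 1) * t = t ^ q := by
    intro t ht
    rcases ht.eq_or_lt with rfl | h
    · rw [mul_zero, Real.zero_rpow (by linarith)]
    · rw [← Real.rpow_add_one h.ne']; ring_nf
  rcases le_total b (ε * a) with h | h
  · have h1 : a ^ (q - 1) * b ≤ ε * a ^ q := by
      calc a ^ (q - 1) * b ≤ a ^ (q - 1) * (ε * a) := by gcongr
        _ = ε * a ^ q := by rw [← hmul a ha]; ring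
    have : 0 ≤ (1 / ε) ^ (q - 1) * b ^ q := by positivity
    linarith
  · have h1 : a ≤ 1 / ε * b := by rw [one_div, inv_mul_eq_div, le_div_iff₀ hε]; linarith
    have h2 : a ^ (q - 1) * b ≤ (1 / ε) ^ (q - 1) * b ^ q := by
      calc a ^ (q - 1) * b ≤ (1 / ε * b) ^ (q - 1) * b := by
            gcongr
        _ = (1 / ε) ^ (q - 1) * b ^ q := by
            rw [Real.mul_rpow (by positivity) hb, mul_assoc, hmul b hb]
    have : 0 ≤ ε * a ^ q := by positivity
    linarith

lemma exists_abs_incPart_le {p q : ℝ} (hp : 2 ≤ p) (hpq : p < q) :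
    ∃ C, 0 ≤ C ∧ ∀ r, |incPart p r| ≤ C * (1 + |r| ^ (q - 1)) := by
  obtain ⟨C, hC0, hC⟩ := exists_abs_rpow_mul_abs_log_le (a := p - 1) (b := q - 1)
    (by linarith) (by linarith)
  refine ⟨1 + C, by linarith, fun r => ?_⟩
  unfold incPart
  rw [abs_mul, abs_abs_rpow_sub_two_mul_self hp,
    abs_of_nonneg (by positivity : (0 : ℝ) ≤ 1 + max 0 (-Real.log |r|))]
  have h1 : max 0 (-Real.log |r|) ≤ |Real.log (|r|)| := max_le (abs_nonneg _) (neg_le_abs _)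
  have h2 := rpow_le_one_add_rpow (abs_nonneg r) (a := p - 1) (b := q - 1)
    (by linarith) (by linarith)
  have h3 := Real.rpow_nonneg (abs_nonneg r) (p - 1)
  nlinarith [hC r, mul_le_mul_of_nonneg_left h1 h3]

lemma exists_abs_decPart_le {p q : ℝ} (hp : 2 ≤ p) (hpq : p < q) :
    ∃ C, 0 ≤ C ∧ ∀ r, |decPart p r| ≤ C * (1 + |r| ^ (q - 1)) := by
  obtain ⟨C, hC0, hC⟩ := exists_abs_rpow_mul_abs_log_le (a := p - 1) (b := q - 1)
    (by linarith) (by linarith)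
  refine ⟨C, hC0, fun r => ?_⟩
  unfold decPart
  rw [abs_mul, abs_abs_rpow_sub_two_mul_self hp,
    abs_of_nonneg (by positivity : (0 : ℝ) ≤ max 0 (Real.log |r|))]
  have h1 : max 0 (Real.log |r|) ≤ |Real.log (|r|)| := max_le (abs_nonneg _) (le_abs_self _)
  have h3 := Real.rpow_nonneg (abs_nonneg r) (p - 1)
  exact (mul_le_mul_of_nonneg_left h1 h3).trans (hC r)

/-- The tangent inequality for `r ↦ |r|^p / p`. -/
lemma abs_rpow_div_sub_le {p : ℝ} (hp : 2 ≤ p) (a b : ℝ) :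
    1 / p * |b| ^ p - 1 / p * |a| ^ p ≤ |b| ^ (p - 2) * b * (b - a) := by
  have hpc : p.HolderConjugate (p / (p - 1)) := Real.HolderConjugate.conjExponent (by linarith)
  have hy := Real.young_inequality_of_nonneg (abs_nonneg a)
    (Real.rpow_nonneg (abs_nonneg b) (p - 1)) hpc
  have h1 : (|b| ^ (p - 1)) ^ (p / (p - 1)) = |b| ^ p := by
    rw [← Real.rpow_mul (abs_nonneg b), mul_div_cancel₀ _ (by linarith)]
  rw [h1] at hy
  have h2 : |b| ^ (p - 2) * b * a ≤ |a| * |b| ^ (p - 1) := by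
    rw [← abs_abs_rpow_sub_two_mul_self hp b, mul_comm |a|, ← abs_mul]
    exact le_abs_self _
  rw [mul_sub, abs_rpow_sub_two_mul_self_mul_self hp]
  have h3 : |b| ^ p / (p / (p - 1)) = |b| ^ p - 1 / p * |b| ^ p := by
    have : p ≠ 0 := by linarith
    have : p - 1 ≠ 0 := by linarith
    field_simp
  rw [h3] at hy
  have h4 : |a| ^ p / p = 1 / p * |a| ^ p := by ring
  linarith

/-! ### Convergence of integrals -/

section Generic

variable {α : Type*} {m : MeasurableSpace α} {μ : Measure α}

lemma integrable_abs_rpow_iff {f : α → ℝ} {r : ℝ} (hr : 0 < r)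
    (hf : AEStronglyMeasurable f μ) :
    Integrable (fun x => |f x| ^ r) μ ↔ MemLp f (ENNReal.ofReal r) μ := by
  have := integrable_norm_rpow_iff hf (p := ENNReal.ofReal r) (by simpa using hr) (by simp)
  rw [ENNReal.toReal_ofReal hr.le] at this
  exact this

lemma integrable_abs_rpow {f : α → ℝ} {r : ℝ} (hr : 0 < r)
    (hf : MemLp f (ENNReal.ofReal r) μ) : Integrable (fun x => |f x| ^ r) μ :=
  (integrable_abs_rpow_iff hr hf.1).2 hf

lemma eLpNorm_eq_ofReal_integral_abs_rpow {f : α → ℝ} {r : ℝ} (hr : 0 < r)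
    (hf : MemLp f (ENNReal.ofReal r) μ) :
    eLpNorm f (ENNReal.ofReal r) μ = ENNReal.ofReal ((∫ x, |f x| ^ r ∂μ) ^ r⁻¹) := by
  have := hf.eLpNorm_eq_integral_rpow_norm (by simpa using hr) (by simp)
  rw [ENNReal.toReal_ofReal hr.le] at this
  exact this

lemma integral_abs_rpow_nonneg (f : α → ℝ) (r : ℝ) : 0 ≤ ∫ x, |f x| ^ r ∂μ :=
  integral_nonneg fun _ => Real.rpow_nonneg (abs_nonneg _) _

/-- Fatou's lemma for powers. -/
lemma integral_abs_rpow_le_of_tendsto_ae {f : ℕ → α → ℝ} {g : α → ℝ} {r : ℝ} (hr : 0 < r)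
    {c : ℕ → ℝ} {c' : ℝ} (hf : ∀ n, MemLp (f n) (ENNReal.ofReal r) μ)
    (hlim : ∀ᵐ x ∂μ, Tendsto (fun n => f n x) atTop (𝓝 (g x)))
    (hc : ∀ n, ∫ x, |f n x| ^ r ∂μ ≤ c n) (hc' : Tendsto c atTop (𝓝 c')) :
    MemLp g (ENNReal.ofReal r) μ ∧ ∫ x, |g x| ^ r ∂μ ≤ c' := by
  have hc0 : ∀ n, 0 ≤ c n := fun n => (integral_abs_rpow_nonneg _ _).trans (hc n)
  have hc'0 : 0 ≤ c' := ge_of_tendsto' hc' hc0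
  have hle : eLpNorm g (ENNReal.ofReal r) μ ≤ ENNReal.ofReal (c' ^ r⁻¹) := by
    refine (Lp.eLpNorm_lim_le_liminf_eLpNorm (fun n => (hf n).1) g hlim).trans ?_
    have ht : Tendsto (fun n => ENNReal.ofReal (c n ^ r⁻¹)) atTop
        (𝓝 (ENNReal.ofReal (c' ^ r⁻¹))) :=
      ENNReal.tendsto_ofReal (hc'.rpow_const (Or.inr (by positivity)))
    rw [← ht.liminf_eq]
    refine liminf_le_liminf (Eventually.of_forall fun n => ?_)
    rw [eLpNorm_eq_ofReal_integral_abs_rpow hr (hf n)]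
    exact ENNReal.ofReal_le_ofReal
      (Real.rpow_le_rpow (integral_abs_rpow_nonneg _ _) (hc n) (by positivity))
  have hg : MemLp g (ENNReal.ofReal r) μ :=
    ⟨aestronglyMeasurable_of_tendsto_ae _ (fun n => (hf n).1) hlim,
      hle.trans_lt ENNReal.ofReal_lt_top⟩
  refine ⟨hg, ?_⟩
  rw [eLpNorm_eq_ofReal_integral_abs_rpow hr hg,
    ENNReal.ofReal_le_ofReal_iff (by positivity)] at hle
  exact (Real.rpow_le_rpow_iff (integral_abs_rpow_nonneg _ _) hc'0 (by positivity)).1 hle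

/-- A Vitali type convergence theorem: domination up to a small multiple of a bounded sequence. -/
lemma tendsto_integral_of_ae_of_le_mul_add {f H : ℕ → α → ℝ} {g : α → ℝ} {B : ℝ}
    (hf : ∀ n, AEStronglyMeasurable (f n) μ)
    (hlim : ∀ᵐ x ∂μ, Tendsto (fun n => f n x) atTop (𝓝 (g x)))
    (hH : ∀ n, Integrable (H n) μ) (hH0 : ∀ n x, 0 ≤ H n x) (hB : ∀ n, ∫ x, H n x ∂μ ≤ B)
    (hdom : ∀ ε > 0, ∃ Φ : α → ℝ, Integrable Φ μ ∧ ∀ n, ∀ᵐ x ∂μ, |f n x| ≤ ε * H n x + Φ x) :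
    (∀ n, Integrable (f n) μ) ∧ Integrable g μ ∧
      Tendsto (fun n => ∫ x, f n x ∂μ) atTop (𝓝 (∫ x, g x ∂μ)) := by
  have hB0 : 0 ≤ B := (integral_nonneg (hH0 0)).trans (hB 0)
  obtain ⟨Φ₁, hΦ₁, hd₁⟩ := hdom 1 one_pos
  have hfi : ∀ n, Integrable (f n) μ := fun n =>
    Integrable.mono' (((hH n).const_mul 1).add hΦ₁) (hf n) (hd₁ n)
  -- Fatou with exponent 1: the integrals of |f n| are bounded by B + ∫ Φ₁.
  have hgi : Integrable g μ := by
    have h1 := integral_abs_rpow_le_of_tendsto_ae (μ := μ) (f := f) (g := g) (r := 1) one_pos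
      (c := fun _ => 1 * B + ∫ x, Φ₁ x ∂μ) (c' := 1 * B + ∫ x, Φ₁ x ∂μ)
      (fun n => by simpa [memLp_one_iff_integrable] using hfi n) hlim
      (fun n => by
        simp only [Real.rpow_one]
        refine (integral_mono_ae (hfi n).abs (((hH n).const_mul 1).add hΦ₁) (hd₁ n)).trans ?_
        simp only [Pi.add_apply]
        rw [integral_add ((hH n).const_mul 1) hΦ₁, integral_const_mul]
        have := hB n
        linarith) tendsto_const_nhds
    simpa [memLp_one_iff_integrable] using h1.1
  refine ⟨hfi, hgi, ?_⟩
  rw [Metric.tendsto_atTop']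
  intro ε hε
  set η := ε / (2 * (B + 1)) with hη
  have hη0 : 0 < η := by positivity
  obtain ⟨Φ, hΦ, hd⟩ := hdom η hη0
  -- The part of |f n - g| exceeding η H n is dominated by |Φ| + |g| and tends to 0 a.e., so
  -- dominated convergence applies to it. What remains costs at most η B.
  have hT : Tendsto (fun n => ∫ x, max 0 (|f n x - g x| - η * H n x) ∂μ) atTop
      (𝓝 (∫ _, (0 : ℝ) ∂μ)) := by
    refine tendsto_integral_of_dominated_convergence (fun x => |Φ x| + |g x|) ?_
      (hΦ.abs.add hgi.abs) ?_ ?_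
    · intro n
      exact aestronglyMeasurable_const.sup
        (((hf n).sub hgi.1).norm.sub ((hH n).1.const_mul η))
    · intro n
      filter_upwards [hd n] with x hx
      rw [Real.norm_of_nonneg (le_max_left _ _)]
      refine max_le (by positivity) ?_
      have := abs_sub (f n x) (g x)
      have := le_abs_self (Φ x)
      linarith
    · filter_upwards [hlim] with x hx
      have h0 : Tendsto (fun n => |f n x - g x|) atTop (𝓝 0) := by
        simpa using (hx.sub_const (g x)).abs
      refine squeeze_zero (fun n => le_max_left _ _) (fun n => max_le (abs_nonneg _) ?_) h0
      have := mul_nonneg hη0.le (hH0 n x)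
      linarith
  rw [integral_zero, Metric.tendsto_atTop'] at hT
  obtain ⟨n₀, hn₀⟩ := hT (ε / 2) (by positivity)
  refine ⟨n₀, fun n hn => ?_⟩
  have h1 := hn₀ n hn
  rw [Real.dist_eq, sub_zero] at h1
  have h1' := (le_abs_self _).trans_lt h1
  rw [Real.dist_eq, ← integral_sub (hfi n) hgi]
  have hmaxi : Integrable (fun x => max 0 (|f n x - g x| - η * H n x)) μ :=
    (integrable_zero _ _ _).sup (((hfi n).sub hgi).abs.sub ((hH n).const_mul η))
  calc |∫ x, (f n x - g x) ∂μ| ≤ ∫ x, |f n x - g x| ∂μ := abs_integral_le_integral_abs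
    _ ≤ ∫ x, (max 0 (|f n x - g x| - η * H n x) + η * H n x) ∂μ := by
        refine integral_mono ((hfi n).sub hgi).abs (hmaxi.add ((hH n).const_mul η)) fun x => ?_
        have := le_max_right 0 (|f n x - g x| - η * H n x)
        simp only
        linarith
    _ = (∫ x, max 0 (|f n x - g x| - η * H n x) ∂μ) + η * ∫ x, H n x ∂μ := by
        rw [integral_add hmaxi ((hH n).const_mul η), integral_const_mul]
    _ < ε / 2 + η * (B + 1) := by
        have : η * ∫ x, H n x ∂μ ≤ η * (B + 1) :=
          mul_le_mul_of_nonneg_left ((hB n).trans (by linarith)) hη0.le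
        linarith
    _ = ε := by rw [hη]; field_simp; ring

lemma abs_add_rpow_le {r : ℝ} (hr : 0 ≤ r) (a b : ℝ) :
    |a + b| ^ r ≤ 2 ^ r * (|a| ^ r + |b| ^ r) := by
  have h : |a + b| ≤ 2 * max |a| |b| := by
    have := abs_add_le a b
    have := le_max_left |a| |b|
    have := le_max_right |a| |b|
    linarith
  have h1 : max |a| |b| ^ r ≤ |a| ^ r + |b| ^ r := by
    have ha := Real.rpow_nonneg (abs_nonneg a) r
    have hb := Real.rpow_nonneg (abs_nonneg b) r
    rcases max_choice |a| |b| with h' | h' <;> rw [h'] <;> linarith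
  calc |a + b| ^ r ≤ (2 * max |a| |b|) ^ r := Real.rpow_le_rpow (abs_nonneg _) h hr
    _ = 2 ^ r * max |a| |b| ^ r := Real.mul_rpow (by norm_num) (by positivity)
    _ ≤ _ := by gcongr

lemma integral_abs_add_rpow_le {f g : α → ℝ} {r : ℝ} (hr : 0 < r)
    (hf : MemLp f (ENNReal.ofReal r) μ) (hg : MemLp g (ENNReal.ofReal r) μ)
    (hfg : MemLp (fun x => f x + g x) (ENNReal.ofReal r) μ) :
    ∫ x, |f x + g x| ^ r ∂μ ≤ 2 ^ r * ((∫ x, |f x| ^ r ∂μ) + ∫ x, |g x| ^ r ∂μ) := by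
  rw [← integral_add (integrable_abs_rpow hr hf) (integrable_abs_rpow hr hg),
    ← integral_const_mul]
  exact integral_mono (integrable_abs_rpow hr hfg)
    (((integrable_abs_rpow hr hf).add (integrable_abs_rpow hr hg)).const_mul _)
    fun x => abs_add_rpow_le hr.le _ _

end Generic

/-! ### The space `W₀^{s,p}(Ω)` -/

section Space

variable {N : ℕ} {Ω : Set (Rn N)} {s p : ℝ} {u v : Rn N → ℝ}

lemma gagliardoKernel_eq (hp : 0 < p) (u : Rn N → ℝ) (z : Rn N × Rn N) :
    gagliardoKernel s p u z = |gagliardoQuotient s p u z| ^ p := by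
  unfold gagliardoKernel gagliardoQuotient
  rw [abs_div, Real.div_rpow (abs_nonneg _) (abs_nonneg _),
    abs_of_nonneg (Real.rpow_nonneg (norm_nonneg _) _), ← Real.rpow_mul (norm_nonneg _),
    div_mul_cancel₀ _ hp.ne']

lemma gagliardoPow_eq (hp : 0 < p) (u : Rn N → ℝ) :
    gagliardoPow s p u = ∫ z, |gagliardoQuotient s p u z| ^ p := by
  unfold gagliardoPow
  simp_rw [gagliardoKernel_eq hp]

/-- The kernel weight is the p-th power of the weight in the quotient, distributed over factors of
degree p - 2, 1 and 1. On the diagonal both integrands vanish. -/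
lemma formK_eq (hp : 2 ≤ p) (u v : Rn N → ℝ) :
    formK s p u v = ∫ z, |gagliardoQuotient s p u z| ^ (p - 2) * gagliardoQuotient s p u z
      * gagliardoQuotient s p v z := by
  unfold formK
  congr 1
  ext z
  unfold gagliardoQuotient
  rcases (norm_nonneg (z.1 - z.2)).eq_or_lt with h | h
  · have : z.1 = z.2 := sub_eq_zero.1 (norm_eq_zero.1 h.symm)
    simp [this]
  · set κ := ‖z.1 - z.2‖ ^ (((N : ℝ) + s * p) / p) with hκ
    have hκ0 : 0 < κ := by positivity
    have h1 : ‖z.1 - z.2‖ ^ ((N : ℝ) + s * p) = κ ^ (p - 2) * κ * κ := by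
      rw [mul_assoc, ← pow_two, ← Real.rpow_natCast κ 2, ← Real.rpow_add hκ0, hκ,
        ← Real.rpow_mul h.le]
      congr 1
      push_cast
      rw [sub_add_cancel, div_mul_cancel₀ _ (by linarith)]
    rw [h1, abs_div, abs_of_pos hκ0, Real.div_rpow (abs_nonneg _) hκ0.le]
    have : κ ^ (p - 2) ≠ 0 := (Real.rpow_pos_of_pos hκ0 _).ne'
    field_simp

lemma gagliardoQuotient_add (u v : Rn N → ℝ) (z : Rn N × Rn N) :
    gagliardoQuotient s p (fun x => u x + v x) z
      = gagliardoQuotient s p u z + gagliardoQuotient s p v z := by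
  unfold gagliardoQuotient; ring

lemma gagliardoQuotient_const_mul (c : ℝ) (u : Rn N → ℝ) (z : Rn N × Rn N) :
    gagliardoQuotient s p (fun x => c * u x) z = c * gagliardoQuotient s p u z := by
  unfold gagliardoQuotient; ring

lemma ae_prod_of_ae {P : Rn N → Rn N → Prop} {A B : Rn N → Prop} (hA : ∀ᵐ x, A x)
    (hB : ∀ᵐ x, B x) (h : ∀ x y, A x → B y → P x y) :
    ∀ᵐ z : Rn N × Rn N, P z.1 z.2 := by
  have h1 : ∀ᵐ z : Rn N × Rn N, A z.1 :=
    (Measure.quasiMeasurePreserving_fst (μ := volume) (ν := volume)).ae hA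
  have h2 : ∀ᵐ z : Rn N × Rn N, B z.2 :=
    (Measure.quasiMeasurePreserving_snd (μ := volume) (ν := volume)).ae hB
  filter_upwards [h1, h2] with z hz1 hz2 using h _ _ hz1 hz2

lemma gagliardoQuotient_congr_ae (h : u =ᵐ[volume] v) :
    gagliardoQuotient s p u =ᵐ[volume] gagliardoQuotient s p v :=
  ae_prod_of_ae (P := fun x y => gagliardoQuotient s p u (x, y) = gagliardoQuotient s p v (x, y))
    h h fun x y hx hy => by unfold gagliardoQuotient; simp only [hx, hy]

lemma aestronglyMeasurable_gagliardoQuotient (hu : AEStronglyMeasurable u volume) :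
    AEStronglyMeasurable (gagliardoQuotient s p u) volume := by
  have h1 : AEStronglyMeasurable (fun z : Rn N × Rn N => u z.1) volume :=
    hu.comp_quasiMeasurePreserving Measure.quasiMeasurePreserving_fst
  have h2 : AEStronglyMeasurable (fun z : Rn N × Rn N => u z.2) volume :=
    hu.comp_quasiMeasurePreserving Measure.quasiMeasurePreserving_snd
  refine ((h1.sub h2).aemeasurable.div ?_).aestronglyMeasurable
  exact Measurable.aemeasurable (by fun_prop)

lemma memW0_iff (hp : 0 < p) : MemW0 Ω s p u ↔ MemLp u (ENNReal.ofReal p) volume ∧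
    MemLp (gagliardoQuotient s p u) (ENNReal.ofReal p) volume ∧
      ∀ᵐ x ∂(volume : Measure (Rn N)), x ∉ Ω → u x = 0 := by
  have hK : gagliardoKernel s p u = fun z => |gagliardoQuotient s p u z| ^ p :=
    funext (gagliardoKernel_eq hp u)
  constructor
  · rintro ⟨h1, h2, h3⟩
    rw [hK, integrable_abs_rpow_iff hp (aestronglyMeasurable_gagliardoQuotient h1.1)] at h2
    exact ⟨h1, h2, h3⟩
  · rintro ⟨h1, h2, h3⟩
    exact ⟨h1, by rw [hK]; exact integrable_abs_rpow hp h2, h3⟩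

lemma MemW0.memLp_quotient (hp : 0 < p) (h : MemW0 Ω s p u) :
    MemLp (gagliardoQuotient s p u) (ENNReal.ofReal p) volume := ((memW0_iff hp).1 h).2.1

lemma MemW0.congr_ae (hp : 0 < p) (h : MemW0 Ω s p u) (huv : u =ᵐ[volume] v) :
    MemW0 Ω s p v := by
  obtain ⟨h1, h2, h3⟩ := (memW0_iff hp).1 h
  refine (memW0_iff hp).2 ⟨h1.ae_eq huv, h2.ae_eq (gagliardoQuotient_congr_ae huv), ?_⟩
  filter_upwards [h3, huv] with x hx hxv hxΩ
  rw [← hxv, hx hxΩ]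

lemma MemW0.add (hp : 0 < p) (hu : MemW0 Ω s p u) (hv : MemW0 Ω s p v) :
    MemW0 Ω s p fun x => u x + v x := by
  obtain ⟨h1, h2, h3⟩ := (memW0_iff hp).1 hu
  obtain ⟨h1', h2', h3'⟩ := (memW0_iff hp).1 hv
  refine (memW0_iff hp).2 ⟨h1.add h1', ?_, ?_⟩
  · rw [show gagliardoQuotient s p (fun x => u x + v x) = _ from
      funext (gagliardoQuotient_add u v)]
    exact h2.add h2'
  · filter_upwards [h3, h3'] with x hx hx' hxΩ
    rw [hx hxΩ, hx' hxΩ, add_zero]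

lemma MemW0.const_mul (hp : 0 < p) (hu : MemW0 Ω s p u) (c : ℝ) :
    MemW0 Ω s p fun x => c * u x := by
  obtain ⟨h1, h2, h3⟩ := (memW0_iff hp).1 hu
  refine (memW0_iff hp).2 ⟨h1.const_mul c, ?_, ?_⟩
  · rw [show gagliardoQuotient s p (fun x => c * u x) = _ from
      funext (gagliardoQuotient_const_mul c u)]
    exact h2.const_mul c
  · filter_upwards [h3] with x hx hxΩ
    rw [hx hxΩ, mul_zero]

lemma MemW0.sub (hp : 0 < p) (hu : MemW0 Ω s p u) (hv : MemW0 Ω s p v) :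
    MemW0 Ω s p fun x => u x - v x :=
  (hu.add hp (hv.const_mul hp (-1))).congr_ae hp (Eventually.of_forall fun x => by ring)

lemma gagliardoPow_congr_ae (hp : 0 < p) (h : u =ᵐ[volume] v) :
    gagliardoPow s p u = gagliardoPow s p v := by
  rw [gagliardoPow_eq hp, gagliardoPow_eq hp]
  refine integral_congr_ae ?_
  filter_upwards [gagliardoQuotient_congr_ae h] with z hz
  rw [hz]

lemma formK_congr_ae (hp : 2 ≤ p) {u' v' : Rn N → ℝ} (h : u =ᵐ[volume] u')
    (h' : v =ᵐ[volume] v') : formK s p u v = formK s p u' v' := by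
  rw [formK_eq hp, formK_eq hp]
  refine integral_congr_ae ?_
  filter_upwards [gagliardoQuotient_congr_ae h, gagliardoQuotient_congr_ae h'] with z hz hz'
  rw [hz, hz']

lemma intPow_congr_ae (h : u =ᵐ[volume.restrict Ω] v) : intPow Ω p u = intPow Ω p v :=
  integral_congr_ae (h.mono fun x hx => by simp only [hx])

lemma intPowLog_congr_ae (h : u =ᵐ[volume.restrict Ω] v) :
    intPowLog Ω p u = intPowLog Ω p v :=
  integral_congr_ae (h.mono fun x hx => by simp only [hx])

lemma energy_congr_ae (hp : 0 < p) (h : u =ᵐ[volume] v) :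
    energy Ω s p u = energy Ω s p v := by
  unfold energy
  rw [gagliardoPow_congr_ae hp h, intPow_congr_ae (ae_restrict_of_ae h),
    intPowLog_congr_ae (ae_restrict_of_ae h)]

lemma gagliardoPow_nonneg (hp : 0 < p) (u : Rn N → ℝ) : 0 ≤ gagliardoPow s p u := by
  rw [gagliardoPow_eq hp]; exact integral_abs_rpow_nonneg _ _

lemma intPow_nonneg (u : Rn N → ℝ) : 0 ≤ intPow Ω p u := integral_abs_rpow_nonneg _ _

lemma energy_eq_nehari (u : Rn N → ℝ) :
    energy Ω s p u = 1 / p * nehari Ω s p u + 1 / p ^ 2 * intPow Ω p u := by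
  unfold energy nehari; ring

lemma gagliardoPow_add_le (hp : 0 < p) (hu : MemW0 Ω s p u) (hv : MemW0 Ω s p v) :
    gagliardoPow s p (fun x => u x + v x)
      ≤ 2 ^ p * (gagliardoPow s p u + gagliardoPow s p v) := by
  have := integral_abs_add_rpow_le hp (hu.memLp_quotient hp) (hv.memLp_quotient hp)
    ((hu.memLp_quotient hp).add (hv.memLp_quotient hp))
  rw [gagliardoPow_eq hp, gagliardoPow_eq hp, gagliardoPow_eq hp]
  simp_rw [gagliardoQuotient_add]
  exact this

lemma gagliardoPow_const_mul (hp : 0 < p) (c : ℝ) (u : Rn N → ℝ) :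
    gagliardoPow s p (fun x => c * u x) = |c| ^ p * gagliardoPow s p u := by
  rw [gagliardoPow_eq hp, gagliardoPow_eq hp, ← integral_const_mul]
  simp_rw [gagliardoQuotient_const_mul, abs_mul, Real.mul_rpow (abs_nonneg _) (abs_nonneg _)]

lemma intPow_const_mul (c : ℝ) (u : Rn N → ℝ) :
    intPow Ω p (fun x => c * u x) = |c| ^ p * intPow Ω p u := by
  unfold intPow
  rw [← integral_const_mul]
  simp_rw [abs_mul, Real.mul_rpow (abs_nonneg _) (abs_nonneg _)]

lemma intPow_add_le (hp : 0 < p) (hu : MemW0 Ω s p u) (hv : MemW0 Ω s p v) :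
    intPow Ω p (fun x => u x + v x) ≤ 2 ^ p * (intPow Ω p u + intPow Ω p v) :=
  integral_abs_add_rpow_le hp (hu.memLp.restrict Ω) (hv.memLp.restrict Ω)
    ((hu.memLp.add hv.memLp).restrict Ω)

/-- Functions of `W₀` are determined by their values in `Ω`. -/
lemma MemW0.integral_eq (hΩ : MeasurableSet Ω) (hu : MemW0 Ω s p u) {f : Rn N → ℝ → ℝ}
    (hf : ∀ x, f x 0 = 0) : ∫ x in Ω, f x (u x) = ∫ x, f x (u x) := by
  rw [← integral_indicator hΩ]
  refine integral_congr_ae ?_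
  filter_upwards [hu.zero_outside] with x hx
  by_cases h : x ∈ Ω
  · rw [indicator_of_mem h]
  · rw [indicator_of_notMem h, hx h, hf]

lemma MemW0.intPow_eq (hΩ : MeasurableSet Ω) (hp : 0 < p) (hu : MemW0 Ω s p u) :
    intPow Ω p u = ∫ x, |u x| ^ p :=
  hu.integral_eq hΩ (f := fun _ r => |r| ^ p) fun _ => by simp [Real.zero_rpow hp.ne']

end Space

/-! ### A Nash type inequality and the logarithmic inequality -/

section Nash

variable {N : ℕ} {Ω : Set (Rn N)} {s p : ℝ} {u v : Rn N → ℝ}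

/-- The exponent of integrability gained from the seminorm. -/
def gainExp (N : ℕ) (s p : ℝ) : ℝ := p + s * p ^ 2 / N

lemma lt_gainExp (hs : 0 < s) (hp : 2 ≤ p) (hN : 0 < N) : p < gainExp N s p := by
  have : (0 : ℝ) < N := by exact_mod_cast hN
  have : 0 < s * p ^ 2 / N := by positivity
  unfold gainExp; linarith

lemma volume_ball_pos_real (N : ℕ) : 0 < (volume : Measure (Rn N)).real (Metric.ball 0 1) :=
  ENNReal.toReal_pos (Metric.measure_ball_pos _ _ one_pos).ne' measure_ball_lt_top.ne

/-- The pointwise inequality behind the Nash type inequality. -/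
lemma abs_rpow_gainExp_le (hs : 0 < s) (hp : 2 ≤ p) (hN : 0 < N)
    (hu : Integrable (fun y => |u y| ^ p) volume) (hP : 0 < ∫ y, |u y| ^ p) (x : Rn N)
    (hx : Integrable (fun y => gagliardoKernel s p u (x, y)) volume) :
    |u x| ^ gainExp N s p
      ≤ (((2 : ℝ) ^ (p + 1)) / (volume : Measure (Rn N)).real (Metric.ball 0 1)) ^ (1 + s * p / N)
        * (∫ y, |u y| ^ p) ^ (s * p / N) * ∫ y, gagliardoKernel s p u (x, y) := by
  set P := ∫ y, |u y| ^ p with hPdef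
  set ω := (volume : Measure (Rn N)).real (Metric.ball 0 1) with hω
  have hω0 : 0 < ω := volume_ball_pos_real N
  have hN' : (0 : ℝ) < N := by exact_mod_cast hN
  have hk0 : ∀ y, 0 ≤ gagliardoKernel s p u (x, y) := fun y => by
    unfold gagliardoKernel; positivity
  have hq := lt_gainExp hs hp hN
  rcases (abs_nonneg (u x)).eq_or_lt with h | ha
  · rw [← h, Real.zero_rpow (by linarith)]
    have : 0 ≤ ∫ y, gagliardoKernel s p u (x, y) := integral_nonneg hk0
    positivity
  set a := |u x| with hadef
  set e := (N : ℝ) + s * p with he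
  have he0 : 0 < e := by positivity
  set b := (2 : ℝ) ^ (p + 1) / ω with hb
  have hb0 : 0 < b := by positivity
  -- The radius is chosen so that |B(x,r)| · 2^(-p) |u(x)|^p = 2P. Since |u(y)|^p integrates to at
  -- most P over the ball, the lower bound `hpt` for the kernel still integrates to at least r^(-e)
  -- P.
  set r := (b * P / a ^ p) ^ (1 / (N : ℝ)) with hr
  have hr0 : 0 < r := by positivity
  have hrN : r ^ N = b * P / a ^ p := by
    rw [← Real.rpow_natCast, hr, ← Real.rpow_mul (by positivity), one_div_mul_cancel hN'.ne',
      Real.rpow_one]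
  have hball : (volume : Measure (Rn N)).real (Metric.ball x r) = r ^ N * ω := by
    rw [measureReal_def, Measure.addHaar_ball_of_pos _ _ hr0, finrank_euclideanSpace_fin,
      ENNReal.toReal_mul, ENNReal.toReal_ofReal (by positivity)]
    rfl
  have hpt : ∀ y ∈ Metric.ball x r,
      (r ^ e)⁻¹ * ((2 ^ p)⁻¹ * a ^ p - |u y| ^ p) ≤ gagliardoKernel s p u (x, y) := by
    intro y hy
    have h1 : (2 ^ p)⁻¹ * a ^ p - |u y| ^ p ≤ |u x - u y| ^ p := by
      have := abs_add_rpow_le (r := p) (by linarith) (u x - u y) (u y)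
      rw [sub_add_cancel] at this
      have h2 : (2 ^ p)⁻¹ * a ^ p ≤ |u x - u y| ^ p + |u y| ^ p := by
        rw [inv_mul_le_iff₀ (by positivity)]; exact this
      linarith
    have h0 : 0 ≤ |u x - u y| ^ p := by positivity
    calc (r ^ e)⁻¹ * ((2 ^ p)⁻¹ * a ^ p - |u y| ^ p) ≤ (r ^ e)⁻¹ * |u x - u y| ^ p := by gcongr
      _ ≤ gagliardoKernel s p u (x, y) := by
        unfold gagliardoKernel
        rcases (norm_nonneg (x - y)).eq_or_lt with h | h
        · have : x = y := sub_eq_zero.1 (norm_eq_zero.1 h.symm)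
          simp [this, Real.zero_rpow (show p ≠ 0 by linarith)]
        · simp only
          rw [inv_mul_eq_div]
          have : ‖x - y‖ ≤ r := by
            rw [← dist_eq_norm, dist_comm]; exact (Metric.mem_ball.1 hy).le
          gcongr
  have hint : (r ^ e)⁻¹ * P ≤ ∫ y, gagliardoKernel s p u (x, y) := by
    have h1 : ∫ y in Metric.ball x r, (r ^ e)⁻¹ * ((2 ^ p)⁻¹ * a ^ p - |u y| ^ p)
        ≤ ∫ y, gagliardoKernel s p u (x, y) := by
      refine le_trans (setIntegral_mono_on ?_ hx.integrableOn measurableSet_ball hpt)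
        (setIntegral_le_integral hx (Eventually.of_forall hk0))
      exact ((integrableOn_const measure_ball_lt_top.ne).sub hu.integrableOn).const_mul _
    refine le_trans ?_ h1
    have hci : IntegrableOn (fun _ : Rn N => (2 ^ p)⁻¹ * a ^ p) (Metric.ball x r) volume :=
      integrableOn_const measure_ball_lt_top.ne
    rw [integral_const_mul, integral_sub hci hu.integrableOn, setIntegral_const, hball, smul_eq_mul, hrN]
    have h2 : ∫ y in Metric.ball x r, |u y| ^ p ≤ P :=
      setIntegral_le_integral hu (Eventually.of_forall fun y => by positivity)
    have h3 : b * P / a ^ p * ω * ((2 ^ p)⁻¹ * a ^ p) = 2 * P := by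
      have : a ^ p ≠ 0 := (Real.rpow_pos_of_pos ha p).ne'
      rw [hb, Real.rpow_add_one (by norm_num)]
      field_simp
    rw [h3]
    gcongr
    linarith
  have hre : r ^ e = (b * P / a ^ p) ^ (1 + s * p / N) := by
    rw [hr, ← Real.rpow_mul (by positivity), he]
    congr 1
    field_simp
  set D := ∫ y, gagliardoKernel s p u (x, y) with hD
  have h4 : P ≤ r ^ e * D := by
    rwa [inv_mul_le_iff₀ (by positivity)] at hint
  have h5 : a ^ gainExp N s p = (a ^ p) ^ (1 + s * p / N) := by
    rw [← Real.rpow_mul ha.le, gainExp]; congr 1; ring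
  have h6 : r ^ e * (a ^ p) ^ (1 + s * p / N)
      = b ^ (1 + s * p / N) * P ^ (s * p / N) * P := by
    rw [hre, ← Real.mul_rpow (by positivity) (by positivity),
      div_mul_cancel₀ _ (Real.rpow_pos_of_pos ha p).ne', Real.mul_rpow hb0.le hP.le,
      Real.rpow_add hP, Real.rpow_one]
    ring
  have h7 : a ^ gainExp N s p * P ≤ (b ^ (1 + s * p / N) * P ^ (s * p / N) * D) * P := by
    calc a ^ gainExp N s p * P ≤ a ^ gainExp N s p * (r ^ e * D) := by gcongr
      _ = (r ^ e * (a ^ p) ^ (1 + s * p / N)) * D := by rw [h5]; ring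
      _ = _ := by rw [h6]; ring
  exact le_of_mul_le_mul_right h7 hP

/-- A Nash type inequality for the Gagliardo seminorm. -/
lemma exists_integral_rpow_gainExp_le (hs : 0 < s) (hp : 2 ≤ p) (hN : 0 < N) :
    ∃ C, 0 < C ∧ ∀ (Ω : Set (Rn N)) (u : Rn N → ℝ), MemW0 Ω s p u →
      Integrable (fun x => |u x| ^ gainExp N s p) volume ∧
        ∫ x, |u x| ^ gainExp N s p
          ≤ C * (∫ x, |u x| ^ p) ^ (s * p / N) * gagliardoPow s p u := by
  have hp0 : 0 < p := by linarith
  have hq := lt_gainExp hs hp hN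
  refine ⟨(((2 : ℝ) ^ (p + 1)) / (volume : Measure (Rn N)).real (Metric.ball 0 1))
    ^ (1 + s * p / N), by have := volume_ball_pos_real N; positivity, fun Ω u hu => ?_⟩
  have hui := integrable_abs_rpow hp0 hu.memLp
  -- The pointwise inequality needs positive mass; a function of mass zero vanishes a.e.
  rcases (integral_abs_rpow_nonneg (μ := volume) u p).eq_or_lt with h0 | hP
  · have hu0 : ∀ᵐ x, |u x| ^ gainExp N s p = 0 := by
      have := (integral_eq_zero_iff_of_nonneg (fun x => by positivity) hui).1 h0.symm
      filter_upwards [this] with x hx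
      have h1 : |u x| = 0 := ((Real.rpow_eq_zero (abs_nonneg _) hp0.ne').1 hx)
      rw [h1, Real.zero_rpow (by linarith)]
    constructor
    · exact (integrable_zero _ _ _).congr (hu0.mono fun x hx => hx.symm)
    · rw [integral_congr_ae hu0, integral_zero]
      have := gagliardoPow_nonneg (s := s) hp0 u
      have := volume_ball_pos_real N
      have := integral_abs_rpow_nonneg (μ := volume) u p
      positivity
  have hk : Integrable (gagliardoKernel s p u) ((volume : Measure (Rn N)).prod volume) :=
    hu.finite_seminorm
  have hae := hk.prod_right_ae
  have hD := hk.integral_prod_left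
  set c := (((2 : ℝ) ^ (p + 1)) / (volume : Measure (Rn N)).real (Metric.ball 0 1))
    ^ (1 + s * p / N) * (∫ y, |u y| ^ p) ^ (s * p / N)
  have hle : ∀ᵐ x, |u x| ^ gainExp N s p ≤ c * ∫ y, gagliardoKernel s p u (x, y) := by
    filter_upwards [hae] with x hx using abs_rpow_gainExp_le hs hp hN hui hP x hx
  have hqi : Integrable (fun x => |u x| ^ gainExp N s p) volume := by
    refine Integrable.mono' (hD.const_mul c) ?_ ?_
    · exact (hu.memLp.1.norm.aemeasurable.pow_const _).aestronglyMeasurable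
    · filter_upwards [hle] with x hx
      rwa [Real.norm_of_nonneg (by positivity)]
  refine ⟨hqi, (integral_mono_ae hqi (hD.const_mul c) hle).trans_eq ?_⟩
  rw [integral_const_mul]
  congr 1
  exact (integral_prod _ hk).symm

/-- The free scale K trades the coefficient of x against the additive constant. It is used twice,
with two different choices, in `exists_isLogConstant`. -/
lemma log_le_mul_sub {x K : ℝ} (hx : 0 < x) (hK : 0 < K) :
    Real.log x ≤ K * x - 1 - Real.log K := by
  have := Real.log_le_sub_one_of_pos (mul_pos hK hx)
  rw [Real.log_mul hK.ne' hx.ne'] at this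
  linarith

/-- Superpositions of subcritical growth are integrable over `Ω`. -/
lemma MemW0.integrableOn_comp (hs : 0 < s) (hp : 2 ≤ p) (hN : 0 < N) (hΩ : volume Ω ≠ ⊤)
    (hu : MemW0 Ω s p u) {F : ℝ → ℝ} (hF : Continuous F) {C : ℝ}
    (hC : ∀ r, |F r| ≤ C * (1 + |r| ^ gainExp N s p)) :
    IntegrableOn (fun x => F (u x)) Ω volume := by
  obtain ⟨_, _, h⟩ := exists_integral_rpow_gainExp_le hs hp hN
  have hq := (h Ω u hu).1
  refine Integrable.mono' (((integrableOn_const hΩ (C := (1 : ℝ))).add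
    hq.integrableOn).const_mul C) ?_ (Eventually.of_forall fun x => hC (u x))
  exact (hF.comp_aestronglyMeasurable hu.memLp.1).restrict

lemma exists_abs_rpow_mul_log_le (hs : 0 < s) (hp : 2 ≤ p) (hN : 0 < N) :
    ∃ C, 0 ≤ C ∧ ∀ r : ℝ, |(|r| ^ p * Real.log |r|)| ≤ C * (1 + |r| ^ gainExp N s p) := by
  obtain ⟨C, h0, hC⟩ := exists_abs_rpow_mul_abs_log_le (a := p) (by linarith)
    (lt_gainExp hs hp hN)
  refine ⟨C, h0, fun r => ?_⟩
  rw [abs_mul, abs_of_nonneg (Real.rpow_nonneg (abs_nonneg r) p)]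
  exact hC r

lemma MemW0.integrableOn_rpow_mul_log (hs : 0 < s) (hp : 2 ≤ p) (hN : 0 < N)
    (hΩ : volume Ω ≠ ⊤) (hu : MemW0 Ω s p u) :
    IntegrableOn (fun x => |u x| ^ p * Real.log |u x|) Ω volume := by
  obtain ⟨C, -, hC⟩ := exists_abs_rpow_mul_log_le hs hp hN
  exact hu.integrableOn_comp hs hp hN hΩ (continuous_abs_rpow_mul_log hp) hC

lemma MemW0.integrableOn_rpow (hp : 0 < p) (hu : MemW0 Ω s p u) :
    IntegrableOn (fun x => |u x| ^ p) Ω volume := (integrable_abs_rpow hp hu.memLp).integrableOn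

lemma MemW0.intPowLog_eq_zero (hp : 0 < p) (hu : MemW0 Ω s p u) (h0 : intPow Ω p u = 0) :
    intPowLog Ω p u = 0 := by
  have h1 := (integral_eq_zero_iff_of_nonneg (fun x => by positivity)
    (hu.integrableOn_rpow hp)).1 h0
  unfold intPowLog
  rw [integral_congr_ae (g := fun _ => (0 : ℝ)), integral_zero]
  filter_upwards [h1] with x hx
  simp only [Pi.zero_apply] at hx
  rw [hx, zero_mul]

/-- The logarithmic inequality with an arbitrary exponent. -/
theorem exists_isLogConstant (hs : 0 < s) (hp : 2 ≤ p) (hN : 0 < N) (hΩm : MeasurableSet Ω)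
    (hΩ : volume Ω ≠ ⊤) {γ : ℝ} (hγ : 1 < γ) : ∃ C, IsLogConstant Ω s p γ C := by
  have hp0 : 0 < p := by linarith
  have hN' : (0 : ℝ) < N := by exact_mod_cast hN
  obtain ⟨C₁, hC₁, hnash⟩ := exists_integral_rpow_gainExp_le hs hp hN
  set δ := s * p ^ 2 / N with hδ
  have hδ0 : 0 < δ := by positivity
  -- This makes K / δ = 1 / (2 C₁), so that the Nash constant cancels and the coefficient 1/2 of the
  -- seminorm is left.
  set K := δ / (2 * C₁) with hK
  have hK0 : 0 < K := by positivity
  set c := (-1 - Real.log K) / δ with hc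
  have hγ' : 0 < γ - 1 := by linarith
  -- With this scale log L = p (γ - 1) c, which absorbs the additive constant c when log P is
  -- compared with P^(γ-1).
  set L := Real.exp (p * (γ - 1) * c) with hL
  refine ⟨L / (p * (γ - 1)), by positivity, fun u hu => ?_⟩
  obtain ⟨hqi, hq⟩ := hnash Ω u hu
  have hPi := hu.integrableOn_rpow hp0
  have hPe := hu.intPow_eq hΩm hp0
  rw [← hPe] at hq
  have hG0 := gagliardoPow_nonneg (s := s) hp0 u
  rcases (intPow_nonneg (Ω := Ω) (p := p) u).eq_or_lt with h0 | hP
  · rw [hu.intPowLog_eq_zero hp0 h0.symm, ← h0, Real.zero_rpow (by linarith)]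
    linarith
  set P := intPow Ω p u with hPdef
  have hpt : ∀ x, |u x| ^ p * Real.log |u x|
      ≤ (Real.log P / p + c) * |u x| ^ p
        + 1 / (2 * C₁) * P ^ (-(s * p / N)) * |u x| ^ gainExp N s p := by
    intro x
    rcases (abs_nonneg (u x)).eq_or_lt with h | h
    · rw [← h, Real.zero_rpow hp0.ne', Real.zero_rpow]
      · simp
      · have := lt_gainExp hs hp hN; linarith
    generalize |u x| = t at h
    -- The power of P is the inverse of the mass factor in the Nash inequality, so P drops out of
    -- the seminorm term; its price is the summand (log P) / p.
    have h1 := log_le_mul_sub (x := t ^ δ * P ^ (-(s * p / N))) (by positivity) hK0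
    rw [Real.log_mul (by positivity) (by positivity), Real.log_rpow h, Real.log_rpow hP] at h1
    have h2 : Real.log t ≤ Real.log P / p + c + K / δ * (t ^ δ * P ^ (-(s * p / N))) := by
      have h3 : s * p / N = δ / p := by rw [hδ]; field_simp
      have h4 : δ * Real.log t ≤ δ * (Real.log P / p + c + K / δ * (t ^ δ * P ^ (-(s * p / N)))) := by
        rw [h3] at h1 ⊢
        calc δ * Real.log t ≤ K * (t ^ δ * P ^ (-(δ / p))) - 1 - Real.log K
              + δ / p * Real.log P := by linarith
          _ = _ := by rw [hc]; field_simp; ring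
      exact le_of_mul_le_mul_left h4 hδ0
    have h5 : K / δ = 1 / (2 * C₁) := by rw [hK]; field_simp
    rw [h5] at h2
    have h6 : t ^ gainExp N s p = t ^ p * t ^ δ := by rw [gainExp, Real.rpow_add h]
    have h7 := mul_le_mul_of_nonneg_left h2 (Real.rpow_nonneg h.le p)
    rw [h6]
    calc _ ≤ _ := h7
      _ = _ := by ring
  have hint : intPowLog Ω p u ≤ (Real.log P / p + c) * P
      + 1 / (2 * C₁) * P ^ (-(s * p / N)) * ∫ x, |u x| ^ gainExp N s p := by
    have h1 := setIntegral_mono (hu.integrableOn_rpow_mul_log hs hp hN hΩ)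
      ((hPi.const_mul (Real.log P / p + c)).add
        (hqi.integrableOn.const_mul (1 / (2 * C₁) * P ^ (-(s * p / N))))) hpt
    simp only [Pi.add_apply] at h1
    rw [integral_add (hPi.const_mul _) (hqi.integrableOn.const_mul _), integral_const_mul,
      integral_const_mul] at h1
    refine h1.trans ?_
    have h2 : ∫ x in Ω, |u x| ^ gainExp N s p ≤ ∫ x, |u x| ^ gainExp N s p :=
      setIntegral_le_integral hqi (Eventually.of_forall fun x => by positivity)
    have h3 : 0 ≤ 1 / (2 * C₁) * P ^ (-(s * p / N)) := by positivity
    have := mul_le_mul_of_nonneg_left h2 h3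
    exact add_le_add le_rfl this
  have hA : 1 / (2 * C₁) * P ^ (-(s * p / N)) * ∫ x, |u x| ^ gainExp N s p
      ≤ 1 / 2 * gagliardoPow s p u := by
    have h3 : 0 ≤ 1 / (2 * C₁) * P ^ (-(s * p / N)) := by positivity
    refine (mul_le_mul_of_nonneg_left hq h3).trans_eq ?_
    rw [Real.rpow_neg hP.le]
    have : P ^ (s * p / N) ≠ 0 := (Real.rpow_pos_of_pos hP _).ne'
    field_simp
  have hB : (Real.log P / p + c) * P ≤ L / (p * (γ - 1)) * P ^ γ := by
    have h1 := log_le_mul_sub (x := P ^ (γ - 1)) (K := L) (by positivity) (by positivity)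
    rw [Real.log_rpow hP, hL, Real.log_exp, ← hL] at h1
    have h2 : Real.log P / p + c ≤ L / (p * (γ - 1)) * P ^ (γ - 1) := by
      have h3 : (p * (γ - 1)) * (Real.log P / p + c)
          ≤ (p * (γ - 1)) * (L / (p * (γ - 1)) * P ^ (γ - 1)) := by
        calc (p * (γ - 1)) * (Real.log P / p + c)
            = (γ - 1) * Real.log P + p * (γ - 1) * c := by field_simp
          _ ≤ L * P ^ (γ - 1) := by linarith
          _ = _ := by field_simp
      exact le_of_mul_le_mul_left h3 (by positivity)
    calc (Real.log P / p + c) * P ≤ L / (p * (γ - 1)) * P ^ (γ - 1) * P := by gcongr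
      _ = _ := by rw [mul_assoc, ← Real.rpow_add_one hP.ne', sub_add_cancel]
  linarith

end Nash

/-! ### Continuity of the functionals on bounded sets -/

/-- The standing assumptions on the domain and the exponents. -/
structure Admissible {N : ℕ} (Ω : Set (Rn N)) (s p : ℝ) : Prop where
  pos_s : 0 < s
  two_le : 2 ≤ p
  pos_dim : 0 < N
  measurableSet : MeasurableSet Ω
  finite : (volume : Measure (Rn N)) Ω ≠ ⊤

/-- Bounded subsets of `W₀^{s,p}(Ω)`. -/
structure BddW {N : ℕ} (Ω : Set (Rn N)) (s p B : ℝ) (u : Rn N → ℝ) : Prop where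
  mem : MemW0 Ω s p u
  gagliardo_le : gagliardoPow s p u ≤ B
  pow_le : intPow Ω p u ≤ B

section Functionals

variable {N : ℕ} {Ω : Set (Rn N)} {s p B : ℝ} {u v : Rn N → ℝ}

namespace Admissible

variable (h : Admissible Ω s p)
include h

lemma pos : 0 < p := by have := h.two_le; linarith

lemma lt_gainExp : p < gainExp N s p := FracLogHeat.lt_gainExp h.pos_s h.two_le h.pos_dim

lemma integrable_gainExp (hu : MemW0 Ω s p u) :
    Integrable (fun x => |u x| ^ gainExp N s p) volume := by
  obtain ⟨C, -, hC⟩ := exists_integral_rpow_gainExp_le h.pos_s h.two_le h.pos_dim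
  exact (hC Ω u hu).1

/-- The Nash type inequality, with the mass bounded. -/
lemma exists_integral_gainExp_le_gagliardoPow (B : ℝ) :
    ∃ C, 0 ≤ C ∧ ∀ u, MemW0 Ω s p u → intPow Ω p u ≤ B →
      ∫ x in Ω, |u x| ^ gainExp N s p ≤ C * gagliardoPow s p u := by
  obtain ⟨C, hC0, hC⟩ := exists_integral_rpow_gainExp_le h.pos_s h.two_le h.pos_dim
  have hs := h.pos_s
  have hp := h.pos
  refine ⟨C * |B| ^ (s * p / N), by positivity, fun u hu huB => ?_⟩
  obtain ⟨h1, h2⟩ := hC Ω u hu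
  rw [← hu.intPow_eq h.measurableSet h.pos] at h2
  have h3 : ∫ x in Ω, |u x| ^ gainExp N s p ≤ ∫ x, |u x| ^ gainExp N s p :=
    setIntegral_le_integral h1 (Eventually.of_forall fun x => by positivity)
  refine h3.trans (h2.trans ?_)
  have h4 : intPow Ω p u ^ (s * p / N) ≤ |B| ^ (s * p / N) :=
    Real.rpow_le_rpow (intPow_nonneg u) (huB.trans (le_abs_self B)) (by positivity)
  have h5 := gagliardoPow_nonneg (s := s) h.pos u
  gcongr

lemma exists_integral_gainExp_le (B : ℝ) :
    ∃ C, ∀ u, BddW Ω s p B u → ∫ x in Ω, |u x| ^ gainExp N s p ≤ C := by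
  obtain ⟨C, hC0, hC⟩ := h.exists_integral_gainExp_le_gagliardoPow B
  exact ⟨C * B, fun u hu => (hC u hu.mem hu.pow_le).trans
    (mul_le_mul_of_nonneg_left hu.gagliardo_le hC0)⟩

/-- Superposition operators of subcritical growth are continuous along bounded sequences. -/
lemma tendsto_integral_comp {F : ℝ → ℝ} (hF : Continuous F)
    (hgrowth : ∀ ε > 0, ∃ C, ∀ r, |F r| ≤ ε * |r| ^ gainExp N s p + C)
    {w : ℕ → Rn N → ℝ} (hw : ∀ n, BddW Ω s p B (w n))
    (hlim : ∀ᵐ x, Tendsto (fun n => w n x) atTop (𝓝 (u x))) :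
    Tendsto (fun n => ∫ x in Ω, F (w n x)) atTop (𝓝 (∫ x in Ω, F (u x))) := by
  obtain ⟨C, hC⟩ := h.exists_integral_gainExp_le B
  refine (tendsto_integral_of_ae_of_le_mul_add (B := C)
    (H := fun n x => |w n x| ^ gainExp N s p) ?_ ?_ ?_ ?_ ?_ ?_).2.2
  · exact fun n => (hF.comp_aestronglyMeasurable (hw n).mem.memLp.1).restrict
  · exact ae_restrict_of_ae (hlim.mono fun x hx => (hF.tendsto _).comp hx)
  · exact fun n => (h.integrable_gainExp (hw n).mem).integrableOn
  · exact fun n x => by positivity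
  · exact fun n => hC _ (hw n)
  · intro ε hε
    obtain ⟨c, hc⟩ := hgrowth ε hε
    exact ⟨fun _ => c, integrableOn_const h.finite, fun n => Eventually.of_forall fun x => hc _⟩

lemma abs_le_one_add_gainExp (r : ℝ) : |r| ≤ 1 + |r| ^ gainExp N s p := by
  have := rpow_le_one_add_rpow (abs_nonneg r) (a := 1) zero_le_one
    (show (1 : ℝ) ≤ gainExp N s p by have := h.lt_gainExp; have := h.two_le; linarith)
  rwa [Real.rpow_one] at this

/-- Young's inequality with the small coefficient on the power of `a`. In the convergence theorem
`a` is the varying function, and the terms in `b`, the fixed test function, form the integrable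
majorant. -/
lemma exists_comp_mul_le {C : ℝ} (hC : 0 ≤ C) {ε : ℝ} (hε : 0 < ε) {f : ℝ → ℝ}
    (hf : ∀ r, |f r| ≤ C * (1 + |r| ^ (gainExp N s p - 1))) :
    ∃ c, 0 ≤ c ∧ ∀ a b, |f a * b| ≤ ε * |a| ^ gainExp N s p + c * (1 + |b| ^ gainExp N s p) := by
  have hq : 1 < gainExp N s p := by have := h.lt_gainExp; have := h.two_le; linarith
  set η := ε / (C + 1)
  have hη : 0 < η := by positivity
  refine ⟨C + C * (1 / η) ^ (gainExp N s p - 1), by positivity, fun a b => ?_⟩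
  have h1 := rpow_sub_one_mul_le hq hη (abs_nonneg a) (abs_nonneg b)
  have h2 := h.abs_le_one_add_gainExp b
  have h3 : C * η ≤ ε := by
    calc C * η ≤ (C + 1) * η := by nlinarith
      _ = ε := by simp only [η]; field_simp
  have h4 : 0 ≤ |a| ^ gainExp N s p := by positivity
  have h5 : 0 ≤ C * (1 / η) ^ (gainExp N s p - 1) := by positivity
  rw [abs_mul]
  calc |f a| * |b| ≤ C * (1 + |a| ^ (gainExp N s p - 1)) * |b| := by gcongr; exact hf a
    _ = C * |b| + C * (|a| ^ (gainExp N s p - 1) * |b|) := by ring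
    _ ≤ C * (1 + |b| ^ gainExp N s p) + C * (η * |a| ^ gainExp N s p
          + (1 / η) ^ (gainExp N s p - 1) * |b| ^ gainExp N s p) := by gcongr
    _ ≤ _ := by nlinarith [mul_le_mul_of_nonneg_right h3 h4]

lemma integrableOn_comp_mul {f : ℝ → ℝ} (hfc : Continuous f) {C : ℝ} (hC : 0 ≤ C)
    (hf : ∀ r, |f r| ≤ C * (1 + |r| ^ (gainExp N s p - 1))) (hu : MemW0 Ω s p u)
    (hv : MemW0 Ω s p v) : IntegrableOn (fun x => f (u x) * v x) Ω volume := by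
  obtain ⟨c, -, hc⟩ := h.exists_comp_mul_le hC one_pos hf
  refine Integrable.mono' (((h.integrable_gainExp hu).integrableOn.const_mul 1).add
    (((integrableOn_const h.finite (C := (1 : ℝ))).add
      (h.integrable_gainExp hv).integrableOn).const_mul c))
    ((hfc.comp_aestronglyMeasurable hu.memLp.1).mul hv.memLp.1).restrict
    (Eventually.of_forall fun x => hc _ _)

lemma tendsto_integral_comp_mul {f : ℝ → ℝ} (hfc : Continuous f) {C : ℝ} (hC : 0 ≤ C)
    (hf : ∀ r, |f r| ≤ C * (1 + |r| ^ (gainExp N s p - 1)))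
    {w : ℕ → Rn N → ℝ} (hw : ∀ n, BddW Ω s p B (w n)) (hv : MemW0 Ω s p v)
    (hlim : ∀ᵐ x, Tendsto (fun n => w n x) atTop (𝓝 (u x))) :
    Tendsto (fun n => ∫ x in Ω, f (w n x) * v x) atTop (𝓝 (∫ x in Ω, f (u x) * v x)) := by
  obtain ⟨K, hK⟩ := h.exists_integral_gainExp_le B
  refine (tendsto_integral_of_ae_of_le_mul_add (B := K)
    (H := fun n x => |w n x| ^ gainExp N s p) ?_ ?_ ?_ ?_ ?_ ?_).2.2
  · exact fun n => ((hfc.comp_aestronglyMeasurable (hw n).mem.memLp.1).mul hv.memLp.1).restrict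
  · exact ae_restrict_of_ae (hlim.mono fun x hx =>
      ((hfc.tendsto _).comp hx).mul_const _)
  · exact fun n => (h.integrable_gainExp (hw n).mem).integrableOn
  · exact fun n x => by positivity
  · exact fun n => hK _ (hw n)
  · intro ε hε
    obtain ⟨c, -, hc⟩ := h.exists_comp_mul_le hC hε hf
    exact ⟨_, ((integrableOn_const h.finite (C := (1 : ℝ))).add
      (h.integrable_gainExp hv).integrableOn).const_mul c,
      fun n => Eventually.of_forall fun x => hc _ _⟩

omit h in
lemma subcritical_of_lt {a C : ℝ} (ha : 0 ≤ a) (haq : a < gainExp N s p) (hC : 0 ≤ C)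
    {F : ℝ → ℝ} (hF : ∀ r, |F r| ≤ C * (1 + |r| ^ a)) :
    ∀ ε > 0, ∃ C, ∀ r, |F r| ≤ ε * |r| ^ gainExp N s p + C := by
  intro ε hε
  obtain ⟨c, hc0, hc⟩ := exists_rpow_le_mul_rpow_add (ε := ε / (C + 1)) ha haq (by positivity)
  refine ⟨C * (1 + c), fun r => (hF r).trans ?_⟩
  have h1 := hc |r| (abs_nonneg r)
  have h2 : C * (ε / (C + 1)) ≤ ε := by
    rw [mul_div_assoc', div_le_iff₀ (by positivity)]; nlinarith
  have h3 : 0 ≤ |r| ^ gainExp N s p := by positivity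
  nlinarith [mul_le_mul_of_nonneg_right h2 h3, mul_le_mul_of_nonneg_left h1 hC]

lemma subcritical_rpow : ∀ ε > 0, ∃ C, ∀ r : ℝ,
    |(|r| ^ p)| ≤ ε * |r| ^ gainExp N s p + C :=
  subcritical_of_lt h.pos.le h.lt_gainExp zero_le_one fun r => by
    rw [abs_of_nonneg (by positivity)]; linarith [Real.rpow_nonneg (abs_nonneg r) p]

lemma subcritical_rpow_mul_log : ∀ ε > 0, ∃ C, ∀ r : ℝ,
    |(|r| ^ p * Real.log (|r|))| ≤ ε * |r| ^ gainExp N s p + C := by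
  have h1 := h.lt_gainExp
  have h2 := h.pos
  obtain ⟨C, h0, hC⟩ := exists_abs_rpow_mul_abs_log_le (a := p) (b := (p + gainExp N s p) / 2)
    h.pos (by linarith)
  refine subcritical_of_lt (a := (p + gainExp N s p) / 2) (by linarith) (by linarith) h0
    fun r => ?_
  rw [abs_mul, abs_of_nonneg (Real.rpow_nonneg (abs_nonneg r) p)]
  exact hC r

lemma subcritical_of_le_mul_self {F f : ℝ → ℝ} (hF0 : ∀ r, 0 ≤ F r) (hF : ∀ r, F r ≤ f r * r)
    (hf : ∀ q, p < q → ∃ C, 0 ≤ C ∧ ∀ r, |f r| ≤ C * (1 + |r| ^ (q - 1))) :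
    ∀ ε > 0, ∃ C, ∀ r, |F r| ≤ ε * |r| ^ gainExp N s p + C := by
  have h1 := h.lt_gainExp
  have h2 := h.two_le
  -- The midpoint leaves room on both sides: it is above p, so the logarithm is absorbed, and still
  -- below the exponent gained.
  set b := (p + gainExp N s p) / 2 with hb
  obtain ⟨C, h0, hC⟩ := hf b (by linarith)
  refine subcritical_of_lt (a := b) (C := 2 * C) (by linarith) (by linarith) (by linarith)
    fun r => ?_
  rw [abs_of_nonneg (hF0 r)]
  have h3 : |f r| * |r| ≤ C * (1 + |r| ^ (b - 1)) * |r| :=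
    mul_le_mul_of_nonneg_right (hC r) (abs_nonneg r)
  have h4 : |r| ^ (b - 1) * |r| = |r| ^ b := by
    rcases (abs_nonneg r).eq_or_lt with h | h
    · rw [← h, mul_zero, Real.zero_rpow (by linarith)]
    · rw [← Real.rpow_add_one h.ne']; ring_nf
  have h5 := rpow_le_one_add_rpow (abs_nonneg r) (a := 1) (b := b) zero_le_one (by linarith)
  rw [Real.rpow_one] at h5
  have h6 : f r * r ≤ |f r| * |r| := by rw [← abs_mul]; exact le_abs_self _
  calc F r ≤ C * (1 + |r| ^ (b - 1)) * |r| := (hF r).trans (h6.trans h3)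
    _ = C * (|r| + |r| ^ b) := by rw [← h4]; ring
    _ ≤ C * (1 + |r| ^ b + |r| ^ b) := by gcongr
    _ ≤ 2 * C * (1 + |r| ^ b) := by
        have : 0 ≤ C := h0
        nlinarith

lemma subcritical_incPot : ∀ ε > 0, ∃ C, ∀ r : ℝ,
    |incPot p r| ≤ ε * |r| ^ gainExp N s p + C :=
  h.subcritical_of_le_mul_self (incPot_nonneg h.two_le) (incPot_le h.two_le)
    fun _ hq => exists_abs_incPart_le h.two_le hq

lemma subcritical_decPot : ∀ ε > 0, ∃ C, ∀ r : ℝ,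
    |decPot p r| ≤ ε * |r| ^ gainExp N s p + C :=
  h.subcritical_of_le_mul_self (decPot_nonneg h.two_le) (decPot_le h.two_le)
    fun _ hq => exists_abs_decPart_le h.two_le hq

lemma integrableOn_of_subcritical {F : ℝ → ℝ} (hF : Continuous F)
    (hgrowth : ∀ ε > 0, ∃ C, ∀ r, |F r| ≤ ε * |r| ^ gainExp N s p + C) (hu : MemW0 Ω s p u) :
    IntegrableOn (fun x => F (u x)) Ω volume := by
  obtain ⟨c, hc⟩ := hgrowth 1 one_pos
  exact Integrable.mono' (((h.integrable_gainExp hu).integrableOn.const_mul 1).add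
    (integrableOn_const h.finite (C := c)))
    (hF.comp_aestronglyMeasurable hu.memLp.1).restrict (Eventually.of_forall fun x => hc _)

lemma tendsto_intPow {w : ℕ → Rn N → ℝ} (hw : ∀ n, BddW Ω s p B (w n))
    (hlim : ∀ᵐ x, Tendsto (fun n => w n x) atTop (𝓝 (u x))) :
    Tendsto (fun n => intPow Ω p (w n)) atTop (𝓝 (intPow Ω p u)) :=
  h.tendsto_integral_comp (continuous_abs.rpow_const fun _ => Or.inr h.pos.le)
    h.subcritical_rpow hw hlim

lemma tendsto_intPowLog {w : ℕ → Rn N → ℝ} (hw : ∀ n, BddW Ω s p B (w n))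
    (hlim : ∀ᵐ x, Tendsto (fun n => w n x) atTop (𝓝 (u x))) :
    Tendsto (fun n => intPowLog Ω p (w n)) atTop (𝓝 (intPowLog Ω p u)) :=
  h.tendsto_integral_comp (continuous_abs_rpow_mul_log h.two_le)
    h.subcritical_rpow_mul_log hw hlim

omit h in
lemma tendsto_gagliardoQuotient {w : ℕ → Rn N → ℝ}
    (hlim : ∀ᵐ x, Tendsto (fun n => w n x) atTop (𝓝 (u x))) :
    ∀ᵐ z, Tendsto (fun n => gagliardoQuotient s p (w n) z) atTop
      (𝓝 (gagliardoQuotient s p u z)) :=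
  ae_prod_of_ae (P := fun x y => Tendsto (fun n => gagliardoQuotient s p (w n) (x, y)) atTop
      (𝓝 (gagliardoQuotient s p u (x, y)))) hlim hlim fun _ _ hx hy =>
    (hx.sub hy).div_const _

lemma abs_quotient_form_le {ε : ℝ} (hε : 0 < ε) (a b : ℝ) :
    |(|a| ^ (p - 2) * a * b)| ≤ ε * |a| ^ p + (1 / ε) ^ (p - 1) * |b| ^ p := by
  rw [abs_mul, abs_abs_rpow_sub_two_mul_self h.two_le]
  exact rpow_sub_one_mul_le (by have := h.two_le; linarith) hε (abs_nonneg a) (abs_nonneg b)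

lemma integrable_formK (hu : MemW0 Ω s p u) (hv : MemW0 Ω s p v) :
    Integrable (fun z => |gagliardoQuotient s p u z| ^ (p - 2) * gagliardoQuotient s p u z
      * gagliardoQuotient s p v z) volume := by
  refine Integrable.mono' (((integrable_abs_rpow h.pos (hu.memLp_quotient h.pos)).const_mul 1).add
    ((integrable_abs_rpow h.pos (hv.memLp_quotient h.pos)).const_mul ((1 / 1) ^ (p - 1))))
    (((continuous_abs_rpow_sub_two_mul_self h.two_le).comp_aestronglyMeasurable
      (hu.memLp_quotient h.pos).1).mul (hv.memLp_quotient h.pos).1)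
    (Eventually.of_forall fun z => h.abs_quotient_form_le one_pos _ _)

/-- No monotonicity argument is needed: the functions converge a.e., and Young's inequality
dominates the integrand by ε times a sequence bounded in L¹ plus a fixed integrable function. -/
lemma tendsto_formK {w : ℕ → Rn N → ℝ} (hw : ∀ n, BddW Ω s p B (w n)) (hv : MemW0 Ω s p v)
    (hlim : ∀ᵐ x, Tendsto (fun n => w n x) atTop (𝓝 (u x))) :
    Tendsto (fun n => formK s p (w n) v) atTop (𝓝 (formK s p u v)) := by
  simp_rw [formK_eq h.two_le]
  have hc := continuous_abs_rpow_sub_two_mul_self h.two_le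
  refine (tendsto_integral_of_ae_of_le_mul_add (B := B)
    (H := fun n z => |gagliardoQuotient s p (w n) z| ^ p) ?_ ?_ ?_ ?_ ?_ ?_).2.2
  · exact fun n => (h.integrable_formK (hw n).mem hv).1
  · exact (tendsto_gagliardoQuotient hlim).mono fun x hx =>
      ((hc.tendsto _).comp hx).mul_const _
  · exact fun n => integrable_abs_rpow h.pos ((hw n).mem.memLp_quotient h.pos)
  · exact fun n x => by positivity
  · exact fun n => by rw [← gagliardoPow_eq h.pos]; exact (hw n).gagliardo_le
  · intro ε hε
    exact ⟨_, (integrable_abs_rpow h.pos (hv.memLp_quotient h.pos)).const_mul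
      ((1 / ε) ^ (p - 1)), fun n => Eventually.of_forall fun x => h.abs_quotient_form_le hε _ _⟩

/-- Bounded sets are closed under a.e. convergence, and the seminorm is lower semicontinuous. -/
lemma bddW_of_tendsto_ae {w : ℕ → Rn N → ℝ} (hw : ∀ n, BddW Ω s p B (w n))
    (hlim : ∀ᵐ x, Tendsto (fun n => w n x) atTop (𝓝 (u x))) : BddW Ω s p B u := by
  obtain ⟨h1, -⟩ := integral_abs_rpow_le_of_tendsto_ae h.pos (fun n => (hw n).mem.memLp) hlim
    (fun n => by rw [← (hw n).mem.intPow_eq h.measurableSet h.pos]; exact (hw n).pow_le)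
    tendsto_const_nhds
  obtain ⟨h2, h2'⟩ := integral_abs_rpow_le_of_tendsto_ae h.pos
    (fun n => (hw n).mem.memLp_quotient h.pos) (tendsto_gagliardoQuotient hlim)
    (fun n => by rw [← gagliardoPow_eq h.pos]; exact (hw n).gagliardo_le) tendsto_const_nhds
  have hu : MemW0 Ω s p u := by
    refine (memW0_iff h.pos).2 ⟨h1, h2, ?_⟩
    filter_upwards [hlim, ae_all_iff.2 fun n => (hw n).mem.zero_outside] with x hx hx0 hxΩ
    refine tendsto_nhds_unique hx ?_
    simp only [hx0 _ hxΩ, tendsto_const_nhds]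
  refine ⟨hu, by rw [gagliardoPow_eq h.pos]; exact h2', ?_⟩
  exact le_of_tendsto' (h.tendsto_intPow hw hlim) fun n => (hw n).pow_le

lemma gagliardoPow_le_of_tendsto_ae {w : ℕ → Rn N → ℝ} (hw : ∀ n, MemW0 Ω s p (w n))
    (hlim : ∀ᵐ x, Tendsto (fun n => w n x) atTop (𝓝 (u x))) {c : ℕ → ℝ} {c' : ℝ}
    (hc : ∀ n, gagliardoPow s p (w n) ≤ c n) (hc' : Tendsto c atTop (𝓝 c')) :
    gagliardoPow s p u ≤ c' := by
  rw [gagliardoPow_eq h.pos]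
  exact (integral_abs_rpow_le_of_tendsto_ae h.pos
    (fun n => (hw n).memLp_quotient h.pos) (tendsto_gagliardoQuotient hlim)
    (fun n => by rw [← gagliardoPow_eq h.pos]; exact hc n) hc').2

end Admissible

end Functionals

/-! ### Bounded sets in `L²(Ω)` -/

section Hilbert

variable {N : ℕ} {Ω : Set (Rn N)} {s p B : ℝ}

/-- The bounded subset of `W₀^{s,p}(Ω)`, as a subset of `L²(Ω)`. -/
def bddSet (Ω : Set (Rn N)) (s p B : ℝ) : Set (L2 Ω) := {f | BddW Ω s p B (zeroExt Ω f)}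

lemma zeroExt_ae_restrict (hΩ : MeasurableSet Ω) (f : L2 Ω) :
    zeroExt Ω f =ᵐ[volume.restrict Ω] f :=
  indicator_ae_eq_restrict hΩ

lemma ae_of_ae_restrict (hΩ : MeasurableSet Ω) {P : Rn N → Prop}
    (hP : ∀ᵐ x ∂(volume.restrict Ω), P x) (hP' : ∀ x ∉ Ω, P x) : ∀ᵐ x, P x := by
  filter_upwards [(ae_restrict_iff' hΩ).1 hP] with x hx
  by_cases h : x ∈ Ω
  · exact hx h
  · exact hP' x h

lemma zeroExt_of_notMem (f : L2 Ω) {x : Rn N} (hx : x ∉ Ω) : zeroExt Ω f x = 0 :=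
  indicator_of_notMem hx _

lemma zeroExt_of_mem (f : L2 Ω) {x : Rn N} (hx : x ∈ Ω) : zeroExt Ω f x = f x :=
  indicator_of_mem hx _

lemma zeroExt_add (hΩ : MeasurableSet Ω) (f g : L2 Ω) :
    zeroExt Ω (f + g) =ᵐ[volume] fun x => zeroExt Ω f x + zeroExt Ω g x := by
  refine ae_of_ae_restrict hΩ ?_ fun x hx => by simp only [zeroExt_of_notMem _ hx, add_zero]
  filter_upwards [zeroExt_ae_restrict hΩ f, zeroExt_ae_restrict hΩ g,
    zeroExt_ae_restrict hΩ (f + g), Lp.coeFn_add f g] with x h1 h2 h3 h4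
  rw [h3, h4, h1, h2, Pi.add_apply]

lemma zeroExt_smul (hΩ : MeasurableSet Ω) (c : ℝ) (f : L2 Ω) :
    zeroExt Ω (c • f) =ᵐ[volume] fun x => c * zeroExt Ω f x := by
  refine ae_of_ae_restrict hΩ ?_ fun x hx => by simp only [zeroExt_of_notMem _ hx, mul_zero]
  filter_upwards [zeroExt_ae_restrict hΩ f,
    zeroExt_ae_restrict hΩ (c • f), Lp.coeFn_smul c f] with x h1 h3 h4
  rw [h3, h4, h1, Pi.smul_apply, smul_eq_mul]

lemma zeroExt_sub (hΩ : MeasurableSet Ω) (f g : L2 Ω) :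
    zeroExt Ω (f - g) =ᵐ[volume] fun x => zeroExt Ω f x - zeroExt Ω g x := by
  refine ae_of_ae_restrict hΩ ?_ fun x hx => by simp only [zeroExt_of_notMem _ hx, sub_zero]
  filter_upwards [zeroExt_ae_restrict hΩ f, zeroExt_ae_restrict hΩ g,
    zeroExt_ae_restrict hΩ (f - g), Lp.coeFn_sub f g] with x h1 h2 h3 h4
  rw [h3, h4, h1, h2, Pi.sub_apply]

lemma MemW0.memLp_two (h : Admissible Ω s p) {u : Rn N → ℝ} (hu : MemW0 Ω s p u) :
    MemLp u 2 (volume.restrict Ω) := by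
  have : IsFiniteMeasure ((volume : Measure (Rn N)).restrict Ω) :=
    ⟨by rw [Measure.restrict_apply_univ]; exact h.finite.lt_top⟩
  refine (hu.memLp.restrict Ω).mono_exponent ?_
  rw [show (2 : ENNReal) = ENNReal.ofReal 2 by simp]
  exact ENNReal.ofReal_le_ofReal h.two_le

/-- Elements of `W₀` are zero extensions of elements of `L²(Ω)`. -/
lemma MemW0.exists_zeroExt (h : Admissible Ω s p) {u : Rn N → ℝ} (hu : MemW0 Ω s p u) :
    ∃ f : L2 Ω, zeroExt Ω f =ᵐ[volume] u := by
  refine ⟨(hu.memLp_two h).toLp u, ?_⟩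
  have h1 := (ae_restrict_iff' h.measurableSet).1 (hu.memLp_two h).coeFn_toLp
  filter_upwards [h1, hu.zero_outside] with x hx hx0
  by_cases hxΩ : x ∈ Ω
  · rw [zeroExt_of_mem _ hxΩ, hx hxΩ]
  · rw [zeroExt_of_notMem _ hxΩ, hx0 hxΩ]

lemma exists_subseq_zeroExt_ae (hΩ : MeasurableSet Ω) {v : ℕ → L2 Ω} {v' : L2 Ω}
    (hv : Tendsto v atTop (𝓝 v')) : ∃ ms : ℕ → ℕ, StrictMono ms ∧
      ∀ᵐ x, Tendsto (fun k => zeroExt Ω (v (ms k)) x) atTop (𝓝 (zeroExt Ω v' x)) := by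
  obtain ⟨ms, hms, h⟩ := (tendstoInMeasure_of_tendsto_Lp hv).exists_seq_tendsto_ae
  refine ⟨ms, hms, ?_⟩
  filter_upwards [(ae_restrict_iff' hΩ).1 h] with x hx
  by_cases hxΩ : x ∈ Ω
  · simp only [zeroExt_of_mem _ hxΩ]; exact hx hxΩ
  · simp only [zeroExt_of_notMem _ hxΩ]; exact tendsto_const_nhds

/-- Continuity along a.e. convergent bounded sequences gives continuity in `L²(Ω)`. -/
lemma continuousOn_bddSet_of_ae (h : Admissible Ω s p) {Ψ : (Rn N → ℝ) → ℝ}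
    (hΨ : ∀ (w : ℕ → Rn N → ℝ) (w' : Rn N → ℝ), (∀ n, BddW Ω s p B (w n)) → BddW Ω s p B w' →
      (∀ᵐ x, Tendsto (fun n => w n x) atTop (𝓝 (w' x))) →
      Tendsto (fun n => Ψ (w n)) atTop (𝓝 (Ψ w'))) :
    ContinuousOn (fun f => Ψ (zeroExt Ω f)) (bddSet Ω s p B) := by
  intro v hv
  refine tendsto_of_seq_tendsto fun x hx => tendsto_of_subseq_tendsto fun ns hns => ?_
  have hy := hx.comp hns
  -- The sequence is in the bounded set only eventually; shifting it by `k₀` puts every term there.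
  obtain ⟨k₀, hk₀⟩ := eventually_atTop.1 (hy.eventually self_mem_nhdsWithin)
  have hy' : Tendsto (fun k => x (ns (k + k₀))) atTop (𝓝 v) :=
    (tendsto_nhds_of_tendsto_nhdsWithin hy).comp (tendsto_add_atTop_nat k₀)
  obtain ⟨ms, hms, hae⟩ := exists_subseq_zeroExt_ae h.measurableSet hy'
  exact ⟨fun k => ms k + k₀, hΨ _ _ (fun n => hk₀ _ (Nat.le_add_left _ _)) hv hae⟩

lemma continuousOn_intPow (h : Admissible Ω s p) :
    ContinuousOn (fun f => intPow Ω p (zeroExt Ω f)) (bddSet Ω s p B) :=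
  continuousOn_bddSet_of_ae h fun _ _ hw _ hlim => h.tendsto_intPow hw hlim

lemma continuousOn_intPowLog (h : Admissible Ω s p) :
    ContinuousOn (fun f => intPowLog Ω p (zeroExt Ω f)) (bddSet Ω s p B) :=
  continuousOn_bddSet_of_ae h fun _ _ hw _ hlim => h.tendsto_intPowLog hw hlim

lemma continuousOn_formK (h : Admissible Ω s p) {v : Rn N → ℝ} (hv : MemW0 Ω s p v) :
    ContinuousOn (fun f => formK s p (zeroExt Ω f) v) (bddSet Ω s p B) :=
  continuousOn_bddSet_of_ae h (Ψ := fun u => formK s p u v)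
    fun _ _ hw _ hlim => h.tendsto_formK hw hv hlim

lemma continuousOn_integral_comp_mul (h : Admissible Ω s p) {v : Rn N → ℝ}
    (hv : MemW0 Ω s p v) {f : ℝ → ℝ} (hfc : Continuous f) {C : ℝ} (hC : 0 ≤ C)
    (hf : ∀ r, |f r| ≤ C * (1 + |r| ^ (gainExp N s p - 1))) :
    ContinuousOn (fun g : L2 Ω => ∫ x in Ω, f (zeroExt Ω g x) * v x) (bddSet Ω s p B) :=
  continuousOn_bddSet_of_ae h (Ψ := fun u => ∫ x in Ω, f (u x) * v x)
    fun _ _ hw _ hlim => h.tendsto_integral_comp_mul hfc hC hf hw hv hlim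

lemma continuousOn_integral_incPot (h : Admissible Ω s p) :
    ContinuousOn (fun g : L2 Ω => ∫ x in Ω, incPot p (zeroExt Ω g x)) (bddSet Ω s p B) :=
  continuousOn_bddSet_of_ae h (Ψ := fun u => ∫ x in Ω, incPot p (u x))
    fun _ _ hw _ hlim => h.tendsto_integral_comp (continuous_incPot h.two_le)
      h.subcritical_incPot hw hlim

lemma isClosed_bddSet (h : Admissible Ω s p) : IsClosed (bddSet Ω s p B) := by
  refine IsSeqClosed.isClosed fun v v' hv hlim => ?_
  obtain ⟨ms, -, hae⟩ := exists_subseq_zeroExt_ae h.measurableSet hlim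
  exact h.bddW_of_tendsto_ae (fun n => hv (ms n)) hae

/-- The top order term is not continuous in L²(Ω). A violating sequence would have an a.e.
convergent subsequence and contradict Fatou's lemma. -/
lemma lowerSemicontinuousOn_gagliardoPow (h : Admissible Ω s p) :
    LowerSemicontinuousOn (fun f => gagliardoPow s p (zeroExt Ω f)) (bddSet Ω s p B) := by
  intro v hv y hy
  by_contra hcon
  have hfreq : ∃ᶠ f in 𝓝[bddSet Ω s p B] v,
      gagliardoPow s p (zeroExt Ω f) ≤ y ∧ f ∈ bddSet Ω s p B := by
    refine Frequently.and_eventually ?_ self_mem_nhdsWithin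
    rw [not_eventually] at hcon
    exact hcon.mono fun f hf => not_lt.1 hf
  obtain ⟨w, hw, hwy⟩ := exists_seq_forall_of_frequently hfreq
  obtain ⟨ms, -, hae⟩ := exists_subseq_zeroExt_ae h.measurableSet
    (tendsto_nhds_of_tendsto_nhdsWithin hw)
  have := h.gagliardoPow_le_of_tendsto_ae (fun n => (hwy (ms n)).2.mem) hae
    (fun n => (hwy (ms n)).1) tendsto_const_nhds
  exact absurd hy (not_lt.2 this)

end Hilbert

/-! ### Weak sequential compactness and the compact embedding into `L²(Ω)` -/

/-- Sequential Banach-Alaoglu for a separable space, carried over by the Riesz isometry. -/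
lemma exists_subseq_tendsto_inner {E : Type*} [NormedAddCommGroup E] [InnerProductSpace ℝ E]
    [CompleteSpace E] [TopologicalSpace.SeparableSpace E] {x : ℕ → E} {C : ℝ}
    (hx : ∀ n, ‖x n‖ ≤ C) : ∃ (a : E) (φ : ℕ → ℕ), StrictMono φ ∧
      ∀ y, Tendsto (fun n => inner ℝ (x (φ n)) y) atTop (𝓝 (inner ℝ a y)) := by
  obtain ⟨a, -, φ, hφ, hlim⟩ := WeakDual.isSeqCompact_closedBall ℝ E 0 C
    (x := fun n => StrongDual.toWeakDual (InnerProductSpace.toDual ℝ E (x n))) (by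
      intro n
      simp only [mem_preimage, mem_closedBall_zero_iff, StrongDual.toStrongDual_toWeakDual,
        LinearIsometryEquiv.norm_map]
      exact hx n)
  refine ⟨(InnerProductSpace.toDual ℝ E).symm (WeakDual.toStrongDual a), φ, hφ, fun y => ?_⟩
  have h := ((WeakDual.eval_continuous (𝕜 := ℝ) y).tendsto a).comp hlim
  have h1 : inner ℝ ((InnerProductSpace.toDual ℝ E).symm (WeakDual.toStrongDual a)) y = a y := by
    rw [← InnerProductSpace.toDual_apply_apply (𝕜 := ℝ), LinearIsometryEquiv.apply_symm_apply]
    rfl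
  rw [h1]
  refine h.congr fun n => ?_
  exact InnerProductSpace.toDual_apply_apply (𝕜 := ℝ)

/-- Lets instance search find that the L² spaces are separable. -/
instance fact_two_ne_top : Fact ((2 : ENNReal) ≠ ⊤) := ⟨by simp⟩

section Rellich

variable {N : ℕ} {Ω : Set (Rn N)} {s p B : ℝ} {u : Rn N → ℝ}

lemma inner_eq_integral (hΩ : MeasurableSet Ω) (f g : L2 Ω) :
    inner ℝ f g = ∫ x in Ω, zeroExt Ω f x * zeroExt Ω g x := by
  rw [L2.inner_def]
  refine integral_congr_ae ?_
  filter_upwards [zeroExt_ae_restrict hΩ f, zeroExt_ae_restrict hΩ g] with x hf hg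
  rw [hf, hg]
  simp [mul_comm]

lemma norm_sq_eq_integral (hΩ : MeasurableSet Ω) (f : L2 Ω) :
    ‖f‖ ^ 2 = ∫ x in Ω, zeroExt Ω f x ^ 2 := by
  rw [← real_inner_self_eq_norm_sq, inner_eq_integral hΩ]
  simp_rw [pow_two]

lemma integrableOn_zeroExt_sq (hΩ : MeasurableSet Ω) (f : L2 Ω) :
    IntegrableOn (fun x => zeroExt Ω f x ^ 2) Ω volume := by
  have h := (Lp.memLp f).integrable_sq
  exact h.congr ((zeroExt_ae_restrict hΩ f).mono fun x hx => by simp only [hx])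

lemma stronglyMeasurable_zeroExt (hΩ : MeasurableSet Ω) (f : L2 Ω) :
    StronglyMeasurable (zeroExt Ω f) :=
  (Lp.stronglyMeasurable f).indicator hΩ

lemma Admissible.integrableOn_abs (h : Admissible Ω s p) (hu : MemW0 Ω s p u) :
    IntegrableOn (fun x => |u x|) Ω volume :=
  Integrable.mono' ((integrableOn_const h.finite (C := (1 : ℝ))).add
    (hu.integrableOn_rpow h.pos)) hu.memLp.1.norm.restrict (Eventually.of_forall fun x => by
      have := rpow_le_one_add_rpow (abs_nonneg (u x)) (a := 1) (b := p) zero_le_one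
        (by have := h.two_le; linarith)
      rw [Real.rpow_one] at this
      simpa using this)

lemma Admissible.integrableOn_fun_const (h : Admissible Ω s p) (c : ℝ) :
    IntegrableOn (fun _ : Rn N => c) Ω volume := integrableOn_const h.finite

lemma Admissible.integral_one_add (h : Admissible Ω s p) {f : Rn N → ℝ}
    (hf : IntegrableOn f Ω volume) : ∫ x in Ω, (1 + f x) = volume.real Ω + ∫ x in Ω, f x := by
  rw [integral_add (h.integrableOn_fun_const 1) hf, setIntegral_const, smul_eq_mul, mul_one]

lemma Admissible.integrable_abs (h : Admissible Ω s p) (hu : MemW0 Ω s p u) :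
    Integrable (fun y => |u y|) volume := by
  have h1 : (fun y => |u y|) =ᵐ[volume] Ω.indicator fun y => |u y| := by
    filter_upwards [hu.zero_outside] with y hy
    by_cases hyΩ : y ∈ Ω
    · rw [indicator_of_mem hyΩ]
    · rw [indicator_of_notMem hyΩ, hy hyΩ, abs_zero]
  exact ((integrable_indicator_iff h.measurableSet).2 (h.integrableOn_abs hu)).congr h1.symm

lemma Admissible.abs_setIntegral_le (h : Admissible Ω s p) (hu : MemW0 Ω s p u)
    (S : Set (Rn N)) : |∫ y in S, u y| ≤ ∫ y in Ω, |u y| := by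
  calc |∫ y in S, u y| ≤ ∫ y in S, |u y| := abs_integral_le_integral_abs
    _ ≤ ∫ y, |u y| :=
      setIntegral_le_integral (h.integrable_abs hu) (Eventually.of_forall fun y => abs_nonneg _)
    _ = ∫ y in Ω, |u y| :=
      (hu.integral_eq h.measurableSet (f := fun _ r => |r|) fun _ => abs_zero).symm

lemma stronglyMeasurable_setIntegral_ball (hu : StronglyMeasurable u) (ρ : ℝ) :
    StronglyMeasurable fun x : Rn N => ∫ y in Metric.ball x ρ, u y := by
  have h1 : (fun x : Rn N => ∫ y in Metric.ball x ρ, u y)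
      = fun x => ∫ y, (Metric.ball x ρ).indicator u y :=
    funext fun x => (integral_indicator measurableSet_ball).symm
  rw [h1]
  refine StronglyMeasurable.integral_prod_right ?_
  have h2 : Function.uncurry (fun x : Rn N => (Metric.ball x ρ).indicator u)
      = {z : Rn N × Rn N | dist z.2 z.1 < ρ}.indicator fun z => u z.2 := by
    ext ⟨x, y⟩
    by_cases hy : dist y x < ρ
    · simp [Function.uncurry, indicator, hy]
    · simp [Function.uncurry, indicator, hy]
  rw [h2]
  exact (hu.comp_measurable measurable_snd).indicator
    (measurableSet_lt (by fun_prop) measurable_const)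

lemma Admissible.integral_abs_le (h : Admissible Ω s p) (hu : MemW0 Ω s p u) :
    ∫ x in Ω, |u x| ≤ volume.real Ω + intPow Ω p u := by
  have h1 : ∫ x in Ω, |u x| ≤ ∫ x in Ω, (1 + |u x| ^ p) := by
    refine integral_mono (h.integrableOn_abs hu) ((h.integrableOn_fun_const 1).add
      (hu.integrableOn_rpow h.pos)) fun x => ?_
    have := rpow_le_one_add_rpow (abs_nonneg (u x)) (a := 1) (b := p) zero_le_one
        (by have := h.two_le; linarith)
    rwa [Real.rpow_one] at this
  rwa [h.integral_one_add (hu.integrableOn_rpow h.pos)] at h1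

/-- Split at t = η. This replaces the first power by the p-th one at the cost of a small additive
error, with no use of Hölder. -/
lemma le_add_rpow_mul {η t p : ℝ} (hη : 0 < η) (hp : 1 ≤ p) (ht : 0 ≤ t) :
    t ≤ η + η ^ (1 - p) * t ^ p := by
  rcases le_total t η with h | h
  · have : 0 ≤ η ^ (1 - p) * t ^ p := by positivity
    linarith
  · have ht0 := hη.trans_le h
    have h1 : t ^ (1 - p) ≤ η ^ (1 - p) :=
      Real.rpow_le_rpow_of_nonpos hη h (by linarith)
    have h2 : t = t ^ (1 - p) * t ^ p := by
      rw [← Real.rpow_add ht0]; simp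
    calc t = t ^ (1 - p) * t ^ p := h2
      _ ≤ η ^ (1 - p) * t ^ p := by gcongr
      _ ≤ _ := by linarith

/-- A function of `W₀` is close in `L¹` to its averages over small balls. -/
lemma Admissible.integral_abs_le_average (h : Admissible Ω s p) (hu : MemW0 Ω s p u)
    (hm : StronglyMeasurable u) {η ρ : ℝ} (hη : 0 < η) (hρ : 0 < ρ) :
    ∫ x in Ω, |u x| ≤ η * volume.real Ω
      + η ^ (1 - p) * ρ ^ (s * p) / (volume : Measure (Rn N)).real (Metric.ball 0 1)
        * gagliardoPow s p u
      + (ρ ^ N * (volume : Measure (Rn N)).real (Metric.ball 0 1))⁻¹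
        * ∫ x in Ω, |∫ y in Metric.ball x ρ, u y| := by
  set ω := (volume : Measure (Rn N)).real (Metric.ball 0 1) with hω
  have hω0 : 0 < ω := volume_ball_pos_real N
  have hp := h.two_le
  have hp0 := h.pos
  have hui : IntegrableOn (fun x => |u x|) Ω volume := h.integrableOn_abs hu
  have hball : ∀ x : Rn N, (volume : Measure (Rn N)).real (Metric.ball x ρ) = ρ ^ N * ω := by
    intro x
    rw [measureReal_def, Measure.addHaar_ball_of_pos _ _ hρ, finrank_euclideanSpace_fin,
      ENNReal.toReal_mul, ENNReal.toReal_ofReal (by positivity)]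
    rfl
  have huloc : ∀ x : Rn N, IntegrableOn u (Metric.ball x ρ) volume := by
    intro x
    have : IsFiniteMeasure ((volume : Measure (Rn N)).restrict (Metric.ball x ρ)) :=
      ⟨by rw [Measure.restrict_apply_univ]; exact measure_ball_lt_top⟩
    exact (hu.memLp.restrict _).integrable (by
      rw [← ENNReal.ofReal_one]; exact ENNReal.ofReal_le_ofReal (by linarith))
  have hk : Integrable (gagliardoKernel s p u) ((volume : Measure (Rn N)).prod volume) :=
    hu.finite_seminorm
  have hD := hk.integral_prod_left
  -- The first factor comes from `le_add_rpow_mul`, the second bounds |x - y|^(N+sp) on the ball of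
  -- radius ρ.
  set c := η ^ (1 - p) * ρ ^ ((N : ℝ) + s * p) with hc
  have hc0 : 0 ≤ c := by positivity
  have hpt : ∀ᵐ x, |u x| ≤ η + (ρ ^ N * ω)⁻¹ * c * (∫ y, gagliardoKernel s p u (x, y))
      + (ρ ^ N * ω)⁻¹ * |∫ y in Metric.ball x ρ, u y| := by
    filter_upwards [hk.prod_right_ae] with x hx
    have hk0 : ∀ y, 0 ≤ gagliardoKernel s p u (x, y) := fun y => by
      unfold gagliardoKernel; positivity
    have hci : IntegrableOn (fun _ : Rn N => u x) (Metric.ball x ρ) volume :=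
      integrableOn_const measure_ball_lt_top.ne
    have hci' : IntegrableOn (fun _ : Rn N => η) (Metric.ball x ρ) volume :=
      integrableOn_const measure_ball_lt_top.ne
    have h1 : (ρ ^ N * ω) * u x
        = (∫ y in Metric.ball x ρ, (u x - u y)) + ∫ y in Metric.ball x ρ, u y := by
      rw [integral_sub hci (huloc x), setIntegral_const, hball, smul_eq_mul, sub_add_cancel]
    have h2 : |∫ y in Metric.ball x ρ, (u x - u y)|
        ≤ η * (ρ ^ N * ω) + c * ∫ y, gagliardoKernel s p u (x, y) := by
      calc |∫ y in Metric.ball x ρ, (u x - u y)| ≤ ∫ y in Metric.ball x ρ, |u x - u y| :=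
            abs_integral_le_integral_abs
        _ ≤ ∫ y in Metric.ball x ρ, (η + c * gagliardoKernel s p u (x, y)) := by
            refine setIntegral_mono_on (hci.sub (huloc x)).abs
              (hci'.add (hx.integrableOn.const_mul c)) measurableSet_ball fun y hy => ?_
            refine (le_add_rpow_mul hη (show 1 ≤ p by linarith) (abs_nonneg _)).trans ?_
            rw [hc, mul_assoc]
            gcongr
            unfold gagliardoKernel
            rcases (norm_nonneg (x - y)).eq_or_lt with h | h
            · have : x = y := sub_eq_zero.1 (norm_eq_zero.1 h.symm)
              simp [this, Real.zero_rpow hp0.ne']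
            · simp only
              rw [mul_div_assoc', le_div_iff₀ (by positivity), mul_comm]
              have : ‖x - y‖ ≤ ρ := by
                rw [← dist_eq_norm, dist_comm]; exact (Metric.mem_ball.1 hy).le
              have hs := h.le
              have := h.le
              have hs' : 0 ≤ s := by have := ‹Admissible Ω s p›.pos_s; linarith
              gcongr
        _ = η * (ρ ^ N * ω) + c * ∫ y in Metric.ball x ρ, gagliardoKernel s p u (x, y) := by
            rw [integral_add hci' (hx.integrableOn.const_mul c), setIntegral_const, hball,
              integral_const_mul, smul_eq_mul, mul_comm]
        _ ≤ _ := by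
            have := setIntegral_le_integral (s := Metric.ball x ρ) hx (Eventually.of_forall hk0)
            gcongr
    have hR : 0 < ρ ^ N * ω := by positivity
    have h3 : (ρ ^ N * ω) * |u x| ≤ η * (ρ ^ N * ω) + c * (∫ y, gagliardoKernel s p u (x, y))
        + |∫ y in Metric.ball x ρ, u y| := by
      calc (ρ ^ N * ω) * |u x| = |(ρ ^ N * ω) * u x| := by rw [abs_mul, abs_of_pos hR]
        _ ≤ _ := by rw [h1]; exact (abs_add_le _ _).trans (add_le_add h2 le_rfl)
    have h4 := mul_le_mul_of_nonneg_left h3 (inv_nonneg.2 hR.le)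
    rw [inv_mul_cancel_left₀ hR.ne'] at h4
    refine h4.trans_eq ?_
    field_simp
  have hTi : IntegrableOn (fun x => |∫ y in Metric.ball x ρ, u y|) Ω volume := by
    refine Integrable.mono' (h.integrableOn_fun_const (∫ y in Ω, |u y|))
      (stronglyMeasurable_setIntegral_ball hm ρ).norm.aestronglyMeasurable.restrict
      (Eventually.of_forall fun x => ?_)
    rw [Real.norm_eq_abs, abs_abs]
    exact h.abs_setIntegral_le hu _
  have hcη : IntegrableOn (fun _ : Rn N => η) Ω volume := integrableOn_const h.finite
  have hci1 := hD.integrableOn.const_mul ((ρ ^ N * ω)⁻¹ * c) (μ := volume.restrict Ω)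
  have hci2 := hTi.const_mul (ρ ^ N * ω)⁻¹
  have hci3 : IntegrableOn (fun x => η + (ρ ^ N * ω)⁻¹ * c
      * ∫ y, gagliardoKernel s p u (x, y)) Ω volume := hcη.add hci1
  refine (integral_mono_ae hui (hci3.add hci2) (ae_restrict_of_ae hpt)).trans ?_
  simp only [Pi.add_apply]
  rw [integral_add hci3 hci2, integral_add hcη hci1, setIntegral_const, integral_const_mul,
    integral_const_mul, smul_eq_mul, mul_comm (volume.real Ω)]
  have h5 : ∫ x in Ω, ∫ y, gagliardoKernel s p u (x, y) ≤ gagliardoPow s p u := by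
    refine (setIntegral_le_integral hD (Eventually.of_forall fun x => integral_nonneg fun y => ?_))
      |>.trans_eq (integral_prod _ hk).symm
    unfold gagliardoKernel; positivity
  have h6 : (ρ ^ N * ω)⁻¹ * c = η ^ (1 - p) * ρ ^ (s * p) / ω := by
    rw [hc, Real.rpow_add hρ, Real.rpow_natCast]
    field_simp
  rw [h6]
  gcongr

/-- Interpolation of L² between L¹ and the higher integrability space: the hypothesis at t = |u x|
is multiplied by |u x|. -/
lemma Admissible.integral_sq_le (h : Admissible Ω s p) (hu : MemW0 Ω s p u) {ε c : ℝ}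
    (hc : ∀ t : ℝ, 0 ≤ t → t ^ (1 : ℝ) ≤ ε * t ^ (gainExp N s p - 1) + c) :
    ∫ x in Ω, u x ^ 2 ≤ ε * (∫ x in Ω, |u x| ^ gainExp N s p) + c * ∫ x in Ω, |u x| := by
  have hi := (h.integrable_gainExp hu).integrableOn (s := Ω)
  rw [← integral_const_mul, ← integral_const_mul,
    ← integral_add (hi.const_mul _) ((h.integrableOn_abs hu).const_mul _)]
  refine integral_mono (hu.memLp_two h).integrable_sq
    ((hi.const_mul _).add ((h.integrableOn_abs hu).const_mul _)) fun x => ?_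
  have h1 := mul_le_mul_of_nonneg_left (hc |u x| (abs_nonneg _)) (abs_nonneg (u x))
  rw [Real.rpow_one, abs_mul_abs_self] at h1
  have h2 : |u x| * |u x| ^ (gainExp N s p - 1) = |u x| ^ gainExp N s p := by
    have := h.lt_gainExp
    have := h.two_le
    rcases (abs_nonneg (u x)).eq_or_lt with h | h
    · rw [← h, zero_mul, Real.zero_rpow (by linarith)]
    · rw [mul_comm, ← Real.rpow_add_one h.ne']; ring_nf
  rw [← h2]
  nlinarith

lemma Admissible.norm_sq_le (h : Admissible Ω s p) {f : L2 Ω} (hf : f ∈ bddSet Ω s p B) :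
    ‖f‖ ^ 2 ≤ volume.real Ω + B := by
  rw [norm_sq_eq_integral h.measurableSet]
  have h1 : ∫ x in Ω, zeroExt Ω f x ^ 2 ≤ ∫ x in Ω, (1 + |zeroExt Ω f x| ^ p) := by
    refine integral_mono (integrableOn_zeroExt_sq h.measurableSet f)
      ((h.integrableOn_fun_const 1).add (hf.mem.integrableOn_rpow h.pos)) fun x => ?_
    have := rpow_le_one_add_rpow (abs_nonneg (zeroExt Ω f x)) (a := 2) (b := p) zero_le_two
      h.two_le
    rwa [Real.rpow_two, sq_abs] at this
  rw [h.integral_one_add (hf.mem.integrableOn_rpow h.pos)] at h1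
  have h2 := hf.pow_le
  unfold intPow at h2
  linarith

lemma BddW.sub_of_mem (h : Admissible Ω s p) {f g : L2 Ω} (hf : f ∈ bddSet Ω s p B)
    (hg : g ∈ bddSet Ω s p B) : BddW Ω s p (2 ^ p * (2 * B)) (zeroExt Ω (f - g)) := by
  have hae : zeroExt Ω (f - g) =ᵐ[volume] fun x => zeroExt Ω f x + -1 * zeroExt Ω g x :=
    (zeroExt_sub h.measurableSet f g).trans (Eventually.of_forall fun x => by ring)
  have hg' := hg.mem.const_mul h.pos (-1)
  refine ⟨(hf.mem.add h.pos hg').congr_ae h.pos hae.symm, ?_, ?_⟩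
  · rw [gagliardoPow_congr_ae h.pos hae]
    refine (gagliardoPow_add_le h.pos hf.mem hg').trans ?_
    rw [gagliardoPow_const_mul h.pos]
    have := hf.gagliardo_le
    have := hg.gagliardo_le
    simp only [abs_neg, abs_one, Real.one_rpow, one_mul]
    gcongr
    linarith
  · rw [intPow_congr_ae (ae_restrict_of_ae hae)]
    refine (intPow_add_le h.pos hf.mem hg').trans ?_
    rw [intPow_const_mul]
    have := hf.pow_le
    have := hg.pow_le
    simp only [abs_neg, abs_one, Real.one_rpow, one_mul]
    gcongr
    linarith

/-- Integration over a ball is pairing with an indicator in L²(Ω), so weak convergence makes the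
ball integrals converge at every x, and they are uniformly bounded. Indexing by pairs prepares the
Cauchy criterion. -/
lemma tendsto_integral_average (h : Admissible Ω s p) {v : ℕ → L2 Ω}
    (hv : ∀ n, v n ∈ bddSet Ω s p B) {a : L2 Ω}
    (hlim : ∀ y, Tendsto (fun n => inner ℝ (v n) y) atTop (𝓝 (inner ℝ a y))) (ρ : ℝ) :
    Tendsto (fun n : ℕ × ℕ => ∫ x in Ω, |∫ y in Metric.ball x ρ, zeroExt Ω (v n.1 - v n.2) y|)
      atTop (𝓝 0) := by
  have hfin : IsFiniteMeasure ((volume : Measure (Rn N)).restrict Ω) :=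
    ⟨by rw [Measure.restrict_apply_univ]; exact h.finite.lt_top⟩
  have hrep : ∀ (x : Rn N) (g : L2 Ω), ∫ y in Metric.ball x ρ, zeroExt Ω g y
      = inner ℝ g (indicatorConstLp 2 (measurableSet_ball (x := x) (ε := ρ))
          (measure_ne_top _ _) (1 : ℝ)) := by
    intro x g
    rw [real_inner_comm, L2.inner_indicatorConstLp_one, zeroExt,
      setIntegral_indicator h.measurableSet, Measure.restrict_restrict measurableSet_ball]
  have h0 : (0 : ℝ) = ∫ _x in Ω, (0 : ℝ) := by simp
  rw [h0]
  refine tendsto_integral_filter_of_dominated_convergence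
    (fun _ => volume.real Ω + 2 ^ p * (2 * B)) ?_ ?_ (integrableOn_const h.finite) ?_
  · refine Eventually.of_forall fun n => ?_
    exact (stronglyMeasurable_setIntegral_ball
      (stronglyMeasurable_zeroExt h.measurableSet _) ρ).norm.aestronglyMeasurable
  · refine Eventually.of_forall fun n => Eventually.of_forall fun x => ?_
    have hW := BddW.sub_of_mem h (hv n.1) (hv n.2)
    rw [Real.norm_eq_abs, abs_abs]
    refine (h.abs_setIntegral_le hW.mem _).trans ((h.integral_abs_le hW.mem).trans ?_)
    have := hW.pow_le
    linarith
  · refine Eventually.of_forall fun x => ?_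
    simp_rw [hrep, inner_sub_left]
    rw [← prod_atTop_atTop_eq]
    have h1 := (hlim (indicatorConstLp 2 (measurableSet_ball (x := x) (ε := ρ))
          (measure_ne_top _ _) (1 : ℝ)))
    have h2 := ((h1.comp tendsto_fst).sub (h1.comp tendsto_snd)).abs
    simpa using h2

/-- A fractional Rellich theorem: bounded subsets of `W₀` are compact in `L²(Ω)`. -/
theorem isCompact_bddSet (h : Admissible Ω s p) : IsCompact (bddSet Ω s p B) := by
  refine IsSeqCompact.isCompact fun v hv => ?_
  have hbd : ∀ n, ‖v n‖ ≤ √(volume.real Ω + B) := fun n =>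
    Real.le_sqrt_of_sq_le (h.norm_sq_le (hv n))
  obtain ⟨a, φ, hφ, hlim⟩ := exists_subseq_tendsto_inner hbd
  suffices hC : CauchySeq (v ∘ φ) by
    obtain ⟨b, hb⟩ := cauchySeq_tendsto_of_complete hC
    exact ⟨b, (isClosed_bddSet h).mem_of_tendsto hb (Eventually.of_forall fun n => hv _),
      φ, hφ, hb⟩
  set w : ℕ → L2 Ω := v ∘ φ with hwdef
  have hw : ∀ n, w n ∈ bddSet Ω s p B := fun n => hv _
  set B' := 2 ^ p * (2 * B) with hB'
  have hsub : ∀ n m, BddW Ω s p B' (zeroExt Ω (w n - w m)) := fun n m =>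
    BddW.sub_of_mem h (hw n) (hw m)
  have hB'0 : 0 ≤ B' := (intPow_nonneg _).trans (hsub 0 0).pow_le
  obtain ⟨K, hK⟩ := h.exists_integral_gainExp_le B'
  have hω0 := volume_ball_pos_real N
  set ω := (volume : Measure (Rn N)).real (Metric.ball 0 1)
  have hp := h.two_le
  have hsp : 0 < s * p := mul_pos h.pos_s h.pos
  -- Of the three terms of `integral_abs_le_average`, the first is small by the choice of η, the
  -- second by then choosing ρ, and the third by weak convergence with both fixed.
  have hL1 : Tendsto (fun n : ℕ × ℕ => ∫ x in Ω, |zeroExt Ω (w n.1 - w n.2) x|) atTop (𝓝 0) := by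
    rw [Metric.tendsto_nhds]
    intro ε hε
    set η := ε / (4 * (volume.real Ω + 1)) with hη
    have hη0 : 0 < η := by positivity
    have hlimρ : Tendsto (fun ρ : ℝ => η ^ (1 - p) * ρ ^ (s * p) / ω * B') (𝓝[>] 0) (𝓝 0) := by
      have h1 : Tendsto (fun ρ : ℝ => ρ ^ (s * p)) (𝓝[>] 0) (𝓝 (0 ^ (s * p))) :=
        ((Real.continuous_rpow_const hsp.le).tendsto 0).mono_left nhdsWithin_le_nhds
      rw [Real.zero_rpow hsp.ne'] at h1
      simpa using ((h1.const_mul (η ^ (1 - p))).div_const ω).mul_const B'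
    obtain ⟨ρ, hρ1, hρ⟩ := ((hlimρ.eventually (gt_mem_nhds (show (0 : ℝ) < ε / 4 by positivity))).and
      self_mem_nhdsWithin).exists
    have hρ0 : 0 < ρ := hρ
    have hT := (tendsto_integral_average h hw hlim ρ).const_mul (ρ ^ N * ω)⁻¹
    rw [mul_zero] at hT
    filter_upwards [hT.eventually (gt_mem_nhds (show (0 : ℝ) < ε / 4 by positivity))] with n hn
    have hW := hsub n.1 n.2
    rw [Real.dist_eq, sub_zero, abs_of_nonneg (integral_nonneg fun x => abs_nonneg _)]
    refine (h.integral_abs_le_average hW.mem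
      (stronglyMeasurable_zeroExt h.measurableSet _) hη0 hρ0).trans_lt ?_
    have h1 : η * volume.real Ω ≤ ε / 4 := by
      have : 0 ≤ (volume : Measure (Rn N)).real Ω := measureReal_nonneg
      rw [hη, div_mul_eq_mul_div, div_le_div_iff₀ (by positivity) (by positivity)]
      nlinarith
    have h2 : η ^ (1 - p) * ρ ^ (s * p) / ω * gagliardoPow s p (zeroExt Ω (w n.1 - w n.2))
        ≤ η ^ (1 - p) * ρ ^ (s * p) / ω * B' := by
      have := hW.gagliardo_le
      gcongr
    linarith
  -- The L¹ smallness is upgraded by interpolation with the uniform bound in the higher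
  -- integrability space.
  have hL2 : Tendsto (fun n : ℕ × ℕ => ‖w n.1 - w n.2‖ ^ 2) atTop (𝓝 0) := by
    rw [Metric.tendsto_nhds]
    intro ε hε
    have hK' : K ≤ |K| := le_abs_self K
    have hη0 : 0 < ε / (2 * (|K| + 1)) := by positivity
    obtain ⟨c, hc0, hc⟩ := exists_rpow_le_mul_rpow_add (a := 1) (b := gainExp N s p - 1)
      zero_le_one (by have := h.lt_gainExp; linarith) hη0
    have h1 := hL1.const_mul c
    rw [mul_zero] at h1
    filter_upwards [h1.eventually (gt_mem_nhds (show (0 : ℝ) < ε / 2 by positivity))] with n hn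
    have hW := hsub n.1 n.2
    rw [Real.dist_eq, sub_zero, abs_of_nonneg (by positivity), norm_sq_eq_integral h.measurableSet]
    refine (h.integral_sq_le hW.mem hc).trans_lt ?_
    have h2 : ε / (2 * (|K| + 1)) * (∫ x in Ω, |zeroExt Ω (w n.1 - w n.2) x| ^ gainExp N s p)
        ≤ ε / 2 := by
      calc _ ≤ ε / (2 * (|K| + 1)) * (|K| + 1) := by
            gcongr
            have := hK _ hW
            linarith
        _ = ε / 2 := by field_simp
    linarith
  rw [cauchySeq_iff_tendsto_dist_atTop_0]
  have := hL2.sqrt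
  simp only [Real.sqrt_sq (norm_nonneg _), Real.sqrt_zero] at this
  simpa only [dist_eq_norm] using this

end Rellich

/-! ### The potential well -/

section Well

variable {N : ℕ} {Ω : Set (Rn N)} {s p B : ℝ} {u v : Rn N → ℝ}

lemma intPowLog_const_mul (h : Admissible Ω s p) (hu : MemW0 Ω s p u) {c : ℝ} (hc : 0 < c) :
    intPowLog Ω p (fun x => c * u x)
      = c ^ p * (intPowLog Ω p u + Real.log c * intPow Ω p u) := by
  unfold intPowLog intPow
  have h1 := hu.integrableOn_rpow_mul_log h.pos_s h.two_le h.pos_dim h.finite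
  have h2 := hu.integrableOn_rpow h.pos
  rw [← integral_const_mul, ← integral_add h1 (h2.const_mul _), ← integral_const_mul]
  congr 1
  ext x
  rw [abs_mul, abs_of_pos hc, Real.mul_rpow hc.le (abs_nonneg _)]
  rcases (abs_nonneg (u x)).eq_or_lt with h0 | h0
  · rw [← h0, Real.zero_rpow h.pos.ne']; ring
  · rw [Real.log_mul hc.ne' h0.ne']; ring

/-- The infimum is over a set bounded below by 0, because on the Nehari manifold the energy is the
mass divided by p². -/
lemma wellDepth_le_energy (h : Admissible Ω s p) (hu : u ∈ nehariManifold Ω s p) :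
    wellDepth Ω s p ≤ energy Ω s p u := by
  refine csInf_le ⟨0, ?_⟩ (mem_image_of_mem _ hu)
  rintro _ ⟨w, hw, rfl⟩
  rw [energy_eq_nehari, hw.2]
  have := intPow_nonneg (Ω := Ω) (p := p) w
  have := h.pos
  positivity

/-- Below the threshold `p² d` for the mass, the Nehari functional is nonnegative. -/
lemma nehari_nonneg (h : Admissible Ω s p) (hu : MemW0 Ω s p u)
    (hle : intPow Ω p u ≤ p ^ 2 * wellDepth Ω s p) : 0 ≤ nehari Ω s p u := by
  by_contra! hneg
  have hp := h.pos
  have hP : 0 < intPow Ω p u := by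
    refine (intPow_nonneg u).lt_of_ne' fun h0 => ?_
    unfold nehari at hneg
    rw [h0, hu.intPowLog_eq_zero hp h0] at hneg
    have := gagliardoPow_nonneg (s := s) hp u
    linarith
  -- Since I(cu) = c^p (I(u) - log c · mass(u)), this c puts cu on the Nehari manifold, and I(u) < 0
  -- gives c < 1. Then p² d ≤ c^p mass(u) < mass(u) ≤ p² d, a contradiction.
  set c := Real.exp (nehari Ω s p u / intPow Ω p u) with hc
  have hc0 : 0 < c := Real.exp_pos _
  have hc1 : c < 1 := by rw [hc, Real.exp_lt_one_iff]; exact div_neg_of_neg_of_pos hneg hP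
  have hlog : Real.log c * intPow Ω p u = nehari Ω s p u := by
    rw [hc, Real.log_exp, div_mul_cancel₀ _ hP.ne']
  have hpow : intPow Ω p (fun x => c * u x) = c ^ p * intPow Ω p u := by
    rw [intPow_const_mul, abs_of_pos hc0]
  have hneh : nehari Ω s p (fun x => c * u x) = 0 := by
    rw [nehari, hpow, gagliardoPow_const_mul hp, intPowLog_const_mul h hu hc0, hlog,
      abs_of_pos hc0, nehari]
    ring
  have hmem : (fun x => c * u x) ∈ nehariManifold Ω s p := by
    refine ⟨⟨hu.const_mul hp c, fun h0 => ?_⟩, hneh⟩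
    have h1 : intPow Ω p (fun x => c * u x) = 0 := by
      rw [intPow_congr_ae (ae_restrict_of_ae h0)]
      simp [intPow, Real.zero_rpow hp.ne']
    rw [hpow] at h1
    have : 0 < c ^ p * intPow Ω p u := by positivity
    linarith
  have h1 := wellDepth_le_energy h hmem
  rw [energy_eq_nehari, hneh, hpow, mul_zero, zero_add] at h1
  have h2 : c ^ p < 1 := Real.rpow_lt_one hc0.le hc1 hp
  have h3 : c ^ p * intPow Ω p u < intPow Ω p u := by nlinarith
  have h4 : p ^ 2 * wellDepth Ω s p ≤ c ^ p * intPow Ω p u := by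
    calc p ^ 2 * wellDepth Ω s p ≤ p ^ 2 * (1 / p ^ 2 * (c ^ p * intPow Ω p u)) := by gcongr
      _ = _ := by field_simp
  linarith

lemma intPow_le_of_nehari_nonneg (hp : 0 < p) (hI : 0 ≤ nehari Ω s p u) :
    intPow Ω p u ≤ p ^ 2 * energy Ω s p u := by
  rw [energy_eq_nehari]
  have h1 : p ^ 2 * (1 / p * nehari Ω s p u + 1 / p ^ 2 * intPow Ω p u)
      = p * nehari Ω s p u + intPow Ω p u := by field_simp
  rw [h1]
  have := mul_nonneg hp.le hI
  linarith

/-- The closed part of the potential well below the energy level `e`. -/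
structure InWell (Ω : Set (Rn N)) (s p e : ℝ) (u : Rn N → ℝ) : Prop where
  mem : MemW0 Ω s p u
  intPow_le : intPow Ω p u ≤ p ^ 2 * wellDepth Ω s p
  energy_le : energy Ω s p u ≤ e

namespace InWell

variable {e : ℝ}

lemma intPow_le_energy (h : Admissible Ω s p) (hu : InWell Ω s p e u) :
    intPow Ω p u ≤ p ^ 2 * energy Ω s p u :=
  intPow_le_of_nehari_nonneg h.pos (nehari_nonneg h hu.mem hu.intPow_le)

lemma intPow_le_level (h : Admissible Ω s p) (hu : InWell Ω s p e u) :
    intPow Ω p u ≤ p ^ 2 * e :=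
  (hu.intPow_le_energy h).trans (mul_le_mul_of_nonneg_left hu.energy_le (by positivity))

lemma energy_nonneg (h : Admissible Ω s p) (hu : InWell Ω s p e u) :
    0 ≤ energy Ω s p u := by
  have h1 := hu.intPow_le_energy h
  have h2 := intPow_nonneg (Ω := Ω) (p := p) u
  have h3 : 0 < p ^ 2 := by have := h.pos; positivity
  by_contra! h4
  nlinarith

/-- The mass is at most p² e. The logarithmic inequality, with the arbitrary choice γ = 2, then
absorbs the logarithmic term into half the seminorm and a constant, and the energy level bounds the
rest. -/
lemma exists_bddW (h : Admissible Ω s p) (e : ℝ) :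
    ∃ B, ∀ u, InWell Ω s p e u → BddW Ω s p B u := by
  obtain ⟨C, hC0, hC⟩ := exists_isLogConstant (Ω := Ω) h.pos_s h.two_le h.pos_dim
    h.measurableSet h.finite one_lt_two
  refine ⟨max (2 * (p * e + C * (p ^ 2 * e) ^ (2 : ℝ))) (p ^ 2 * e), fun u hu =>
    ⟨hu.mem, le_max_of_le_left ?_, le_max_of_le_right (hu.intPow_le_level h)⟩⟩
  have h1 := hC u hu.mem
  have h2 := hu.energy_le
  have h3 := intPow_nonneg (Ω := Ω) (p := p) u
  have h4 : intPow Ω p u ^ (2 : ℝ) ≤ (p ^ 2 * e) ^ (2 : ℝ) :=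
    Real.rpow_le_rpow h3 (hu.intPow_le_level h) zero_le_two
  have h5 := mul_le_mul_of_nonneg_left h4 hC0.le
  have hp := h.pos
  have h6 : p * energy Ω s p u = gagliardoPow s p u + intPow Ω p u - intPowLog Ω p u
      + 1 / p * intPow Ω p u := by
    unfold energy; field_simp
  have h7 := mul_le_mul_of_nonneg_left h2 hp.le
  have h8 : 0 ≤ 1 / p * intPow Ω p u := by positivity
  linarith

end InWell

end Well

/-! ### One step of the time discretization -/

section Step

variable {N : ℕ} {Ω : Set (Rn N)} {s p B : ℝ} {u v w : Rn N → ℝ}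

/-- The weak form of the spatial operator with the increasing terms evaluated at `v` and the
decreasing term evaluated at `u`. -/
def splitForm (Ω : Set (Rn N)) (s p : ℝ) (v u φ : Rn N → ℝ) : ℝ :=
  formK s p v φ + (∫ x in Ω, incPart p (v x) * φ x) - ∫ x in Ω, decPart p (u x) * φ x

lemma formK_const_mul (u φ : Rn N → ℝ) (c : ℝ) :
    formK s p u (fun x => c * φ x) = c * formK s p u φ := by
  unfold formK
  rw [← integral_const_mul]
  congr 1
  ext z
  ring

lemma splitForm_const_mul (v u φ : Rn N → ℝ) (c : ℝ) :
    splitForm Ω s p v u (fun x => c * φ x) = c * splitForm Ω s p v u φ := by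
  unfold splitForm
  rw [formK_const_mul]
  simp_rw [mul_left_comm _ c, integral_const_mul]
  ring

lemma splitForm_congr_ae (hp : 2 ≤ p) {v' u' φ φ' : Rn N → ℝ} (hv : v =ᵐ[volume] v')
    (hu : u =ᵐ[volume] u') (hφ : φ =ᵐ[volume] φ') :
    splitForm Ω s p v u φ = splitForm Ω s p v' u' φ' := by
  unfold splitForm
  rw [formK_congr_ae hp hv hφ]
  congr 1
  · congr 1
    refine integral_congr_ae (ae_restrict_of_ae ?_)
    filter_upwards [hv, hφ] with x h1 h2
    rw [h1, h2]
  · refine integral_congr_ae (ae_restrict_of_ae ?_)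
    filter_upwards [hu, hφ] with x h1 h2
    rw [h1, h2]

namespace Admissible

variable (h : Admissible Ω s p)
include h

lemma integrableOn_incPart_mul (hu : MemW0 Ω s p u) (hv : MemW0 Ω s p v) :
    IntegrableOn (fun x => incPart p (u x) * v x) Ω volume := by
  obtain ⟨C, h0, hC⟩ := exists_abs_incPart_le h.two_le h.lt_gainExp
  exact h.integrableOn_comp_mul (continuous_incPart h.two_le) h0 hC hu hv

lemma integrableOn_decPart_mul (hu : MemW0 Ω s p u) (hv : MemW0 Ω s p v) :
    IntegrableOn (fun x => decPart p (u x) * v x) Ω volume := by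
  obtain ⟨C, h0, hC⟩ := exists_abs_decPart_le h.two_le h.lt_gainExp
  exact h.integrableOn_comp_mul (continuous_decPart h.two_le) h0 hC hu hv

lemma integrableOn_incPot (hu : MemW0 Ω s p u) :
    IntegrableOn (fun x => incPot p (u x)) Ω volume :=
  h.integrableOn_of_subcritical (continuous_incPot h.two_le) h.subcritical_incPot hu

lemma integrableOn_decPot (hu : MemW0 Ω s p u) :
    IntegrableOn (fun x => decPot p (u x)) Ω volume :=
  h.integrableOn_of_subcritical (continuous_decPot h.two_le) h.subcritical_decPot hu

lemma energy_eq (hu : MemW0 Ω s p u) : energy Ω s p u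
    = 1 / p * gagliardoPow s p u + (∫ x in Ω, incPot p (u x)) - ∫ x in Ω, decPot p (u x) := by
  rw [add_sub_assoc, ← integral_sub (h.integrableOn_incPot hu) (h.integrableOn_decPot hu)]
  simp_rw [incPot_sub_decPot h.two_le]
  have h1 := hu.integrableOn_rpow h.pos
  have h2 := hu.integrableOn_rpow_mul_log h.pos_s h.two_le h.pos_dim h.finite
  have h3 : IntegrableOn (fun x => 1 / p * |u x| ^ p - 1 / p * (|u x| ^ p * Real.log |u x|))
      Ω volume := (h1.const_mul _).sub (h2.const_mul _)
  rw [integral_add h3 (h1.const_mul _), integral_sub (h1.const_mul _) (h2.const_mul _)]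
  simp_rw [integral_const_mul]
  unfold energy intPow intPowLog
  ring

lemma gagliardoPow_sub_le (hu : MemW0 Ω s p u) (hv : MemW0 Ω s p v) :
    1 / p * gagliardoPow s p v - 1 / p * gagliardoPow s p u
      ≤ formK s p v fun x => v x - u x := by
  rw [gagliardoPow_eq h.pos, gagliardoPow_eq h.pos, formK_eq h.two_le, ← integral_const_mul,
    ← integral_const_mul, ← integral_sub]
  · refine integral_mono (((integrable_abs_rpow h.pos (hv.memLp_quotient h.pos)).const_mul _).sub
      ((integrable_abs_rpow h.pos (hu.memLp_quotient h.pos)).const_mul _))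
      (h.integrable_formK hv (hv.sub h.pos hu)) fun z => ?_
    have : gagliardoQuotient s p (fun x => v x - u x) z
        = gagliardoQuotient s p v z - gagliardoQuotient s p u z := by
      unfold gagliardoQuotient; ring
    simp only [this]
    exact abs_rpow_div_sub_le h.two_le _ _
  · exact (integrable_abs_rpow h.pos (hv.memLp_quotient h.pos)).const_mul _
  · exact (integrable_abs_rpow h.pos (hu.memLp_quotient h.pos)).const_mul _

lemma integral_incPot_sub_le (hu : MemW0 Ω s p u) (hv : MemW0 Ω s p v) :
    (∫ x in Ω, incPot p (v x)) - (∫ x in Ω, incPot p (u x))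
      ≤ ∫ x in Ω, incPart p (v x) * (v x - u x) := by
  rw [← integral_sub (h.integrableOn_incPot hv) (h.integrableOn_incPot hu)]
  exact integral_mono ((h.integrableOn_incPot hv).sub (h.integrableOn_incPot hu))
    (h.integrableOn_incPart_mul hv (hv.sub h.pos hu)) fun x => incPot_sub_le h.two_le _ _

lemma integral_decPot_sub_le (hu : MemW0 Ω s p u) (hv : MemW0 Ω s p v) :
    (∫ x in Ω, decPot p (v x)) - (∫ x in Ω, decPot p (u x))
      ≤ ∫ x in Ω, decPart p (v x) * (v x - u x) := by
  rw [← integral_sub (h.integrableOn_decPot hv) (h.integrableOn_decPot hu)]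
  exact integral_mono ((h.integrableOn_decPot hv).sub (h.integrableOn_decPot hu))
    (h.integrableOn_decPart_mul hv (hv.sub h.pos hu)) fun x => decPot_sub_le h.two_le _ _

/-- The change of energy is controlled by the convex functional minimized in one time step. -/
lemma energy_sub_le_convexPart (hu : MemW0 Ω s p u) (hv : MemW0 Ω s p v) :
    energy Ω s p v - energy Ω s p u
      ≤ (1 / p * gagliardoPow s p v + (∫ x in Ω, incPot p (v x))
          - ∫ x in Ω, decPart p (u x) * v x)
        - (1 / p * gagliardoPow s p u + (∫ x in Ω, incPot p (u x))
          - ∫ x in Ω, decPart p (u x) * u x) := by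
  -- The tangent of the convex `decPot` is taken at u, the old value, so the concave part of the
  -- energy is bounded by its linearization there.
  have h1 := h.integral_decPot_sub_le hv hu
  simp_rw [mul_sub] at h1
  rw [integral_sub (h.integrableOn_decPart_mul hu hu) (h.integrableOn_decPart_mul hu hv)] at h1
  rw [h.energy_eq hu, h.energy_eq hv]
  linarith

/-- The convex functional lies above its tangents. -/
lemma convexPart_sub_le (hu : MemW0 Ω s p u) (hv : MemW0 Ω s p v) (hw : MemW0 Ω s p w) :
    (1 / p * gagliardoPow s p v + (∫ x in Ω, incPot p (v x))
          - ∫ x in Ω, decPart p (u x) * v x)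
        - (1 / p * gagliardoPow s p w + (∫ x in Ω, incPot p (w x))
          - ∫ x in Ω, decPart p (u x) * w x)
      ≤ splitForm Ω s p v u fun x => v x - w x := by
  have h1 := h.gagliardoPow_sub_le hw hv
  have h2 := h.integral_incPot_sub_le hw hv
  have h3 : ∫ x in Ω, decPart p (u x) * (v x - w x)
      = (∫ x in Ω, decPart p (u x) * v x) - ∫ x in Ω, decPart p (u x) * w x := by
    simp_rw [mul_sub]
    exact integral_sub (h.integrableOn_decPart_mul hu hv) (h.integrableOn_decPart_mul hu hw)
  unfold splitForm
  rw [h3]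
  linarith

/-- Combined with the Euler equation tested with v - u, this is the discrete energy inequality. -/
lemma energy_sub_le (hu : MemW0 Ω s p u) (hv : MemW0 Ω s p v) :
    energy Ω s p v - energy Ω s p u ≤ splitForm Ω s p v u fun x => v x - u x :=
  (h.energy_sub_le_convexPart hu hv).trans (h.convexPart_sub_le hu hv hu)

lemma continuousOn_splitForm_left {φ : Rn N → ℝ} (hφ : MemW0 Ω s p φ) (u : Rn N → ℝ) :
    ContinuousOn (fun f : L2 Ω => splitForm Ω s p (zeroExt Ω f) u φ) (bddSet Ω s p B) := by
  obtain ⟨C, h0, hC⟩ := exists_abs_incPart_le h.two_le h.lt_gainExp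
  exact ((continuousOn_formK h hφ).add (continuousOn_integral_comp_mul h hφ
    (continuous_incPart h.two_le) h0 hC)).sub continuousOn_const

lemma continuousOn_splitForm {φ : Rn N → ℝ} (hφ : MemW0 Ω s p φ) :
    ContinuousOn (fun f : L2 Ω × L2 Ω => splitForm Ω s p (zeroExt Ω f.1) (zeroExt Ω f.2) φ)
      (bddSet Ω s p B ×ˢ bddSet Ω s p B) := by
  obtain ⟨C, h0, hC⟩ := exists_abs_decPart_le h.two_le h.lt_gainExp
  -- As `decPart` vanishes at 0, the second argument 0 isolates the increasing part of the form.
  have h1 : ContinuousOn (fun f : L2 Ω × L2 Ω => splitForm Ω s p (zeroExt Ω f.1) 0 φ)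
      (bddSet Ω s p B ×ˢ bddSet Ω s p B) :=
    (h.continuousOn_splitForm_left hφ 0).comp continuousOn_fst fun x hx => hx.1
  have h2 := (continuousOn_integral_comp_mul h hφ (B := B)
    (continuous_decPart h.two_le) h0 hC).comp continuousOn_snd
      (fun x (hx : x ∈ bddSet Ω s p B ×ˢ bddSet Ω s p B) => hx.2)
  refine (h1.sub h2).congr fun x _ => ?_
  simp [splitForm, decPart_zero]

/-- Keeps a variation g + tφ in one bounded set, where the functionals are continuous. -/
lemma bddW_add_smul {f g : L2 Ω} (hf : MemW0 Ω s p (zeroExt Ω f))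
    (hg : MemW0 Ω s p (zeroExt Ω g)) : ∃ B, ∀ t ∈ Icc (0 : ℝ) 1, f + t • g ∈ bddSet Ω s p B := by
  have hp := h.pos
  refine ⟨max (2 ^ p * (gagliardoPow s p (zeroExt Ω f) + gagliardoPow s p (zeroExt Ω g)))
    (2 ^ p * (intPow Ω p (zeroExt Ω f) + intPow Ω p (zeroExt Ω g))), fun t ht => ?_⟩
  have hae : zeroExt Ω (f + t • g) =ᵐ[volume] fun x => zeroExt Ω f x + t * zeroExt Ω g x := by
    filter_upwards [zeroExt_add h.measurableSet f (t • g), zeroExt_smul h.measurableSet t g]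
      with x h1 h2
    rw [h1, h2]
  have hg' := hg.const_mul hp t
  have ht1 : |t| ^ p ≤ 1 := by
    rw [abs_of_nonneg ht.1]; exact Real.rpow_le_one ht.1 ht.2 hp.le
  refine ⟨(hf.add hp hg').congr_ae hp hae.symm, le_max_of_le_left ?_, le_max_of_le_right ?_⟩
  · rw [gagliardoPow_congr_ae hp hae]
    refine (gagliardoPow_add_le hp hf hg').trans ?_
    rw [gagliardoPow_const_mul hp]
    have := mul_le_of_le_one_left (gagliardoPow_nonneg (s := s) hp (zeroExt Ω g)) ht1
    gcongr
  · rw [intPow_congr_ae (ae_restrict_of_ae hae)]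
    refine (intPow_add_le hp hf hg').trans ?_
    rw [intPow_const_mul]
    have := mul_le_of_le_one_left (intPow_nonneg (Ω := Ω) (p := p) (zeroExt Ω g)) ht1
    gcongr

/-- The mirror image of `exists_comp_mul_le`: the small coefficient is on the power of `b`, for a
fixed `a` and a varying `b`. The parameter η is tuned to make (1/η)^(q-1) = ε / (2C + 1). -/
lemma exists_comp_mul_le_right {C : ℝ} (hC : 0 ≤ C) {ε : ℝ} (hε : 0 < ε) {f : ℝ → ℝ}
    (hf : ∀ r, |f r| ≤ C * (1 + |r| ^ (gainExp N s p - 1))) :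
    ∃ c, 0 ≤ c ∧ ∀ a b, |f a * b| ≤ ε * |b| ^ gainExp N s p + c * (1 + |a| ^ gainExp N s p) := by
  have hq : 1 < gainExp N s p := by have := h.lt_gainExp; have := h.two_le; linarith
  set q := gainExp N s p
  set η := ((2 * C + 1) / ε) ^ (1 / (q - 1)) with hη
  have hq1 : 0 < q - 1 := by linarith
  have hη0 : 0 < η := by positivity
  have hηq : (1 / η) ^ (q - 1) = ε / (2 * C + 1) := by
    rw [one_div, Real.inv_rpow hη0.le, hη, ← Real.rpow_mul (by positivity),
      one_div_mul_cancel hq1.ne', Real.rpow_one, inv_div]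
  refine ⟨2 * C * η * 2 ^ q, by positivity, fun a b => ?_⟩
  have ha := abs_nonneg a
  have h1 := rpow_sub_one_mul_le hq hη0 (by positivity : 0 ≤ 1 + |a|) (abs_nonneg b)
  rw [hηq] at h1
  have h2 : (1 + |a|) ^ q ≤ 2 ^ q * (1 + |a| ^ q) := by
    have := abs_add_rpow_le (r := q) (by linarith) 1 |a|
    rwa [abs_of_nonneg (by positivity : 0 ≤ 1 + |a|), abs_one, Real.one_rpow, abs_abs] at this
  have h3 : 1 + |a| ^ (q - 1) ≤ 2 * (1 + |a|) ^ (q - 1) := by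
    have h4 : (1 : ℝ) ≤ (1 + |a|) ^ (q - 1) := Real.one_le_rpow (by linarith) hq1.le
    have h5 : |a| ^ (q - 1) ≤ (1 + |a|) ^ (q - 1) :=
      Real.rpow_le_rpow ha (by linarith) hq1.le
    linarith
  have h6 : 2 * C * (ε / (2 * C + 1)) ≤ ε := by
    rw [mul_div_assoc', div_le_iff₀ (by positivity)]; nlinarith
  have h7 : 0 ≤ |b| ^ q := by positivity
  rw [abs_mul]
  calc |f a| * |b| ≤ C * (2 * (1 + |a|) ^ (q - 1)) * |b| := by
        have := (hf a).trans (mul_le_mul_of_nonneg_left h3 hC)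
        gcongr
    _ = 2 * C * ((1 + |a|) ^ (q - 1) * |b|) := by ring
    _ ≤ 2 * C * (η * (2 ^ q * (1 + |a| ^ q)) + ε / (2 * C + 1) * |b| ^ q) := by
        have := mul_le_mul_of_nonneg_left h2 hη0.le
        gcongr
        linarith
    _ = 2 * C * (ε / (2 * C + 1)) * |b| ^ q + 2 * C * η * 2 ^ q * (1 + |a| ^ q) := by ring
    _ ≤ _ := by gcongr

/-- Minimizers of the discretized problem satisfy the Euler-Lagrange inequality. -/
lemma splitForm_nonneg_of_isMin {f g φ : L2 Ω} {τ : ℝ}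
    (hf : MemW0 Ω s p (zeroExt Ω f)) (hg : MemW0 Ω s p (zeroExt Ω g))
    (hφ : MemW0 Ω s p (zeroExt Ω φ)) (hlt : intPow Ω p (zeroExt Ω g) < p ^ 2 * wellDepth Ω s p)
    (hmin : ∀ w : L2 Ω, MemW0 Ω s p (zeroExt Ω w) →
      intPow Ω p (zeroExt Ω w) ≤ p ^ 2 * wellDepth Ω s p →
      1 / p * gagliardoPow s p (zeroExt Ω g) + (∫ x in Ω, incPot p (zeroExt Ω g x))
          - (∫ x in Ω, decPart p (zeroExt Ω f x) * zeroExt Ω g x) + ‖g - f‖ ^ 2 / (2 * τ)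
        ≤ 1 / p * gagliardoPow s p (zeroExt Ω w) + (∫ x in Ω, incPot p (zeroExt Ω w x))
          - (∫ x in Ω, decPart p (zeroExt Ω f x) * zeroExt Ω w x) + ‖w - f‖ ^ 2 / (2 * τ)) :
    0 ≤ inner ℝ (g - f) φ / τ + splitForm Ω s p (zeroExt Ω g) (zeroExt Ω f) (zeroExt Ω φ) := by
  obtain ⟨B, hB⟩ := h.bddW_add_smul hg hφ
  have hmaps : MapsTo (fun t : ℝ => g + t • φ) (Icc 0 1) (bddSet Ω s p B) := hB
  have hcont : Continuous fun t : ℝ => g + t • φ := by fun_prop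
  have hg0 : g + (0 : ℝ) • φ = g := by simp
  have hle : 𝓝[>] (0 : ℝ) ≤ 𝓝[Icc 0 1] 0 := by
    rw [← nhdsWithin_Ioc_eq_nhdsGT zero_lt_one]
    exact nhdsWithin_mono _ Ioc_subset_Icc_self
  have h0 : (0 : ℝ) ∈ Icc (0 : ℝ) 1 := ⟨le_rfl, zero_le_one⟩
  have hpow : Tendsto (fun t : ℝ => intPow Ω p (zeroExt Ω (g + t • φ))) (𝓝[>] 0)
      (𝓝 (intPow Ω p (zeroExt Ω g))) := by
    have := ((continuousOn_intPow h).comp hcont.continuousOn hmaps 0 h0).tendsto.mono_left hle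
    simpa only [Function.comp_def, hg0] using this
  have hsf : Tendsto (fun t : ℝ => splitForm Ω s p (zeroExt Ω (g + t • φ)) (zeroExt Ω f)
      (zeroExt Ω φ)) (𝓝[>] 0) (𝓝 (splitForm Ω s p (zeroExt Ω g) (zeroExt Ω f) (zeroExt Ω φ))) := by
    have := ((h.continuousOn_splitForm_left hφ (zeroExt Ω f)).comp
      hcont.continuousOn hmaps 0 h0).tendsto.mono_left hle
    simpa only [Function.comp_def, hg0] using this
  have hquad : Tendsto (fun t : ℝ => inner ℝ (g - f) φ / τ + t * (‖φ‖ ^ 2 / (2 * τ))) (𝓝[>] 0)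
      (𝓝 (inner ℝ (g - f) φ / τ + 0 * (‖φ‖ ^ 2 / (2 * τ)))) :=
    (Continuous.tendsto (by fun_prop) 0).mono_left nhdsWithin_le_nhds
  have hlim := hquad.add hsf
  rw [zero_mul, add_zero] at hlim
  refine ge_of_tendsto hlim ?_
  have hIoc : Ioc (0 : ℝ) 1 ∈ 𝓝[>] (0 : ℝ) := Ioc_mem_nhdsGT zero_lt_one
  -- The strict inequality `hlt` persists for small t, so g + tφ is an admissible competitor.
  filter_upwards [hpow.eventually (gt_mem_nhds hlt), hIoc] with t ht htI
  have hw := (hB t ⟨htI.1.le, htI.2⟩).mem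
  have h1 := hmin _ hw ht.le
  -- With the tangent at g + tφ rather than at g, the increment is at most t times the form at g +
  -- tφ. Continuity of the form as t → 0 then replaces differentiation of the functional.
  have h2 := h.convexPart_sub_le hf hw hg
  have hae : (fun x => zeroExt Ω (g + t • φ) x - zeroExt Ω g x)
      =ᵐ[volume] fun x => t * zeroExt Ω φ x := by
    filter_upwards [zeroExt_add h.measurableSet g (t • φ), zeroExt_smul h.measurableSet t φ]
      with x h1 h2
    rw [h1, h2, add_sub_cancel_left]
  rw [splitForm_congr_ae h.two_le (ae_eq_refl _) (ae_eq_refl _) hae, splitForm_const_mul] at h2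
  have h3 : ‖g + t • φ - f‖ ^ 2 = ‖g - f‖ ^ 2 + 2 * t * inner ℝ (g - f) φ + t ^ 2 * ‖φ‖ ^ 2 := by
    rw [show g + t • φ - f = (g - f) + t • φ by abel, norm_add_sq_real, real_inner_smul_right,
      norm_smul, mul_pow, Real.norm_eq_abs, sq_abs]
    ring
  rw [h3] at h1
  have h4 : 0 ≤ t * (inner ℝ (g - f) φ / τ + t * (‖φ‖ ^ 2 / (2 * τ))
      + splitForm Ω s p (zeroExt Ω (g + t • φ)) (zeroExt Ω f) (zeroExt Ω φ)) := by
    have h5 : (‖g - f‖ ^ 2 + 2 * t * inner ℝ (g - f) φ + t ^ 2 * ‖φ‖ ^ 2) / (2 * τ)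
        = ‖g - f‖ ^ 2 / (2 * τ) + t * (inner ℝ (g - f) φ / τ + t * (‖φ‖ ^ 2 / (2 * τ))) := by
      rcases eq_or_ne τ 0 with rfl | hτ
      · simp
      · field_simp
        ring
    rw [h5] at h1
    linarith
  exact nonneg_of_mul_nonneg_right h4 htI.1

/-- One step of the convex splitting scheme. -/
theorem exists_step {e τ : ℝ} (hτ : 0 < τ) (he : e < wellDepth Ω s p) {f : L2 Ω}
    (hf : InWell Ω s p e (zeroExt Ω f)) :
    ∃ g : L2 Ω, InWell Ω s p e (zeroExt Ω g) ∧
      ‖g - f‖ ^ 2 / τ + energy Ω s p (zeroExt Ω g) ≤ energy Ω s p (zeroExt Ω f) ∧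
      ∀ φ : L2 Ω, MemW0 Ω s p (zeroExt Ω φ) → inner ℝ (g - f) φ / τ
        + splitForm Ω s p (zeroExt Ω g) (zeroExt Ω f) (zeroExt Ω φ) = 0 := by
  have hp := h.pos
  obtain ⟨B, hB⟩ := InWell.exists_bddW h e
  set Φ : L2 Ω → ℝ := fun w => 1 / p * gagliardoPow s p (zeroExt Ω w)
    + (∫ x in Ω, incPot p (zeroExt Ω w x))
    - (∫ x in Ω, decPart p (zeroExt Ω f x) * zeroExt Ω w x) + ‖w - f‖ ^ 2 / (2 * τ) with hΦ
  -- A competitor no worse than f has energy at most E(f), hence, under the mass constraint, lies in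
  -- the well and in the bounded set. Minimizing over the compact set `S` thus loses nothing, as
  -- `hmin` records.
  have hlevel : ∀ w : L2 Ω, MemW0 Ω s p (zeroExt Ω w) → Φ w ≤ Φ f →
      energy Ω s p (zeroExt Ω w) ≤ energy Ω s p (zeroExt Ω f) := by
    intro w hw hle
    have h1 := h.energy_sub_le_convexPart hf.mem hw
    have h2 : 0 ≤ ‖w - f‖ ^ 2 / (2 * τ) := by positivity
    simp only [hΦ, sub_self, norm_zero] at hle
    norm_num at hle h1
    linarith
  set S : Set (L2 Ω) := bddSet Ω s p B
    ∩ (fun w => intPow Ω p (zeroExt Ω w)) ⁻¹' Iic (p ^ 2 * wellDepth Ω s p) with hS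
  have hSc : IsCompact S := (isCompact_bddSet h).of_isClosed_subset
    ((continuousOn_intPow h).preimage_isClosed_of_isClosed (isClosed_bddSet h) isClosed_Iic)
    inter_subset_left
  have hlin : Continuous fun w : L2 Ω => ‖w - f‖ ^ 2 / (2 * τ) := by fun_prop
  have hdec : ContinuousOn (fun w : L2 Ω =>
      ∫ x in Ω, decPart p (zeroExt Ω f x) * zeroExt Ω w x) (bddSet Ω s p B) := by
    refine continuousOn_bddSet_of_ae h
      (Ψ := fun w => ∫ x in Ω, decPart p (zeroExt Ω f x) * w x) fun w w' hw hw' hlim => ?_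
    obtain ⟨C, hC0, hC⟩ := exists_abs_decPart_le h.two_le h.lt_gainExp
    obtain ⟨K, hK⟩ := h.exists_integral_gainExp_le B
    have hq : 1 < gainExp N s p := by have := h.lt_gainExp; have := h.two_le; linarith
    refine (tendsto_integral_of_ae_of_le_mul_add (B := K)
      (H := fun n x => |w n x| ^ gainExp N s p) ?_ ?_ ?_ ?_ ?_ ?_).2.2
    · exact fun n => (h.integrableOn_decPart_mul hf.mem (hw n).mem).1
    · exact ae_restrict_of_ae (hlim.mono fun x hx => hx.const_mul _)
    · exact fun n => (h.integrable_gainExp (hw n).mem).integrableOn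
    · exact fun n x => by positivity
    · exact fun n => hK _ (hw n)
    · intro ε hε
      obtain ⟨c, -, hc⟩ := h.exists_comp_mul_le_right hC0 hε hC
      exact ⟨_, ((h.integrableOn_fun_const 1).add
        (h.integrable_gainExp hf.mem).integrableOn).const_mul c,
        fun n => Eventually.of_forall fun x => hc _ _⟩
  have hlsc : LowerSemicontinuousOn Φ S := by
    have hgag : LowerSemicontinuousOn (fun w : L2 Ω => 1 / p * gagliardoPow s p (zeroExt Ω w))
        (bddSet Ω s p B) :=
      (continuous_const_mul (1 / p)).comp_lowerSemicontinuousOn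
        (lowerSemicontinuousOn_gagliardoPow h) (monotone_mul_left_of_nonneg (by positivity))
    have hrest := (((continuousOn_integral_incPot h (B := B)).sub hdec).add
      hlin.continuousOn).lowerSemicontinuousOn
    have hsum := (hgag.add hrest).mono (inter_subset_left : S ⊆ bddSet Ω s p B)
    have hΦ' : Φ = fun w => 1 / p * gagliardoPow s p (zeroExt Ω w)
        + ((∫ x in Ω, incPot p (zeroExt Ω w x))
          - (∫ x in Ω, decPart p (zeroExt Ω f x) * zeroExt Ω w x) + ‖w - f‖ ^ 2 / (2 * τ)) := by
      ext w
      simp only [hΦ]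
      ring
    rw [hΦ']
    exact hsum
  have hfB : f ∈ bddSet Ω s p B := hB _ hf
  have hne : S.Nonempty := ⟨f, hfB, hf.intPow_le⟩
  obtain ⟨g, hgS, hgmin⟩ := LowerSemicontinuousOn.exists_isMinOn hne hSc hlsc
  have hgf : Φ g ≤ Φ f := hgmin ⟨hfB, hf.intPow_le⟩
  have hgW : InWell Ω s p e (zeroExt Ω g) :=
    ⟨hgS.1.mem, hgS.2, (hlevel g hgS.1.mem hgf).trans hf.energy_le⟩
  have hmin : ∀ w : L2 Ω, MemW0 Ω s p (zeroExt Ω w) →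
      intPow Ω p (zeroExt Ω w) ≤ p ^ 2 * wellDepth Ω s p → Φ g ≤ Φ w := by
    intro w hw hwd
    rcases le_total (Φ w) (Φ f) with hle | hle
    · exact hgmin ⟨hB _ ⟨hw, hwd, (hlevel w hw hle).trans hf.energy_le⟩, hwd⟩
    · exact hgf.trans hle
  -- The mass constraint is inactive: the mass of g is at most p² e, and e < d.
  have hlt : intPow Ω p (zeroExt Ω g) < p ^ 2 * wellDepth Ω s p :=
    (hgW.intPow_le_level h).trans_lt (by gcongr)
  have hEL : ∀ φ : L2 Ω, MemW0 Ω s p (zeroExt Ω φ) → inner ℝ (g - f) φ / τ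
      + splitForm Ω s p (zeroExt Ω g) (zeroExt Ω f) (zeroExt Ω φ) = 0 := by
    intro φ hφ
    -- The reverse inequality is the variational inequality in the direction -φ.
    refine le_antisymm ?_ (h.splitForm_nonneg_of_isMin hf.mem hgW.mem hφ hlt hmin)
    have hae := zeroExt_smul h.measurableSet (-1) φ
    have h1 := h.splitForm_nonneg_of_isMin hf.mem hgW.mem
      ((hφ.const_mul hp (-1)).congr_ae hp hae.symm) hlt hmin
    rw [splitForm_congr_ae h.two_le (ae_eq_refl _) (ae_eq_refl _) hae, splitForm_const_mul,
      real_inner_smul_right] at h1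
    have h2 : -1 * inner ℝ (g - f) φ / τ = -(inner ℝ (g - f) φ / τ) := by ring
    rw [h2] at h1
    linarith
  refine ⟨g, hgW, ?_, hEL⟩
  have hae := zeroExt_sub h.measurableSet g f
  have h1 := hEL (g - f) ((hgW.mem.sub hp hf.mem).congr_ae hp hae.symm)
  rw [splitForm_congr_ae h.two_le (ae_eq_refl _) (ae_eq_refl _) hae,
    real_inner_self_eq_norm_sq] at h1
  -- Testing with g - f gives the full ‖g - f‖² / τ; comparing the minimum with the value at f would
  -- give only half of it.
  have h2 := h.energy_sub_le hf.mem hgW.mem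
  linarith

end Admissible

end Step

/-! ### Functions that are constant on the intervals of a time grid -/

section Grid

variable {E : Type*} [NormedAddCommGroup E] {τ : ℝ}

lemma natCeil_div_eq (hτ : 0 < τ) {t : ℝ} {k : ℕ} (ht : t ∈ Ioc (k * τ) ((k + 1) * τ)) :
    ⌈t / τ⌉₊ = k + 1 := by
  rw [Nat.ceil_eq_iff (by omega)]
  constructor
  · rw [Nat.add_sub_cancel, lt_div_iff₀ hτ]; exact ht.1
  · rw [div_le_iff₀ hτ]; push_cast; exact ht.2

lemma le_natCeil_div_mul (hτ : 0 < τ) (t : ℝ) : t ≤ ⌈t / τ⌉₊ * τ := by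
  rw [← div_le_iff₀ hτ]; exact Nat.le_ceil _

lemma natCeil_div_mul_lt (hτ : 0 < τ) {t : ℝ} (ht : 0 ≤ t) : ⌈t / τ⌉₊ * τ < t + τ := by
  have := Nat.ceil_lt_add_one (div_nonneg ht hτ.le)
  calc ⌈t / τ⌉₊ * τ < (t / τ + 1) * τ := by gcongr
    _ = t + τ := by field_simp

lemma stronglyMeasurable_comp_natCeil (g : ℕ → E) (τ : ℝ) :
    StronglyMeasurable fun t : ℝ => g ⌈t / τ⌉₊ :=
  StronglyMeasurable.of_discrete.comp_measurable
    (Nat.measurable_ceil.comp (measurable_id.div_const τ))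

lemma intervalIntegrable_comp_natCeil (g : ℕ → E) (hτ : 0 < τ) (a b : ℝ) :
    IntervalIntegrable (fun t : ℝ => g ⌈t / τ⌉₊) volume a b := by
  rw [intervalIntegrable_iff]
  refine Measure.integrableOn_of_bounded
    (M := ∑ j ∈ Finset.range (⌈max a b / τ⌉₊ + 1), ‖g j‖) (by simp [uIoc])
    (stronglyMeasurable_comp_natCeil g τ).aestronglyMeasurable ?_
  refine (ae_restrict_iff' measurableSet_uIoc).2 (Eventually.of_forall fun t ht => ?_)
  have h1 : ⌈t / τ⌉₊ ∈ Finset.range (⌈max a b / τ⌉₊ + 1) := by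
    rw [Finset.mem_range, Nat.lt_succ_iff]
    exact Nat.ceil_mono (div_le_div_of_nonneg_right ht.2 hτ.le)
  exact Finset.single_le_sum (f := fun j => ‖g j‖) (fun j _ => norm_nonneg _) h1

variable [NormedSpace ℝ E]

lemma integral_comp_natCeil [CompleteSpace E] (g : ℕ → E) (hτ : 0 < τ) (k : ℕ) :
    ∫ t in (0 : ℝ)..k * τ, g ⌈t / τ⌉₊ = ∑ j ∈ Finset.range k, τ • g (j + 1) := by
  induction k with
  | zero => simp
  | succ k ih =>
    rw [Finset.sum_range_succ, ← ih, ← intervalIntegral.integral_add_adjacent_intervals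
      (intervalIntegrable_comp_natCeil g hτ 0 (k * τ))
      (intervalIntegrable_comp_natCeil g hτ (k * τ) _)]
    congr 1
    have hle : (k : ℝ) * τ ≤ (k + 1) * τ := by gcongr; linarith
    rw [intervalIntegral.integral_of_le (by push_cast; exact hle)]
    have h1 : ∫ t in Ioc ((k : ℝ) * τ) ((k + 1 : ℕ) * τ), g ⌈t / τ⌉₊
        = ∫ _t in Ioc ((k : ℝ) * τ) ((k + 1 : ℕ) * τ), g (k + 1) := by
      refine setIntegral_congr_fun measurableSet_Ioc fun t ht => ?_
      rw [natCeil_div_eq hτ (by push_cast at ht; exact ht)]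
    rw [h1, setIntegral_const, Real.volume_real_Ioc_of_le (by push_cast; exact hle)]
    congr 1
    push_cast
    ring

/-- The difference quotients of a sequence, as a function on the time grid. -/
def gridVel (U : ℕ → E) (τ t : ℝ) : E := τ⁻¹ • (U ⌈t / τ⌉₊ - U (⌈t / τ⌉₊ - 1))

lemma gridVel_eq_comp (U : ℕ → E) (τ : ℝ) :
    gridVel U τ = fun t => (fun j => τ⁻¹ • (U j - U (j - 1))) ⌈t / τ⌉₊ := rfl

lemma stronglyMeasurable_gridVel (U : ℕ → E) (τ : ℝ) : StronglyMeasurable (gridVel U τ) :=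
  stronglyMeasurable_comp_natCeil (fun j => τ⁻¹ • (U j - U (j - 1))) τ

lemma intervalIntegrable_gridVel (U : ℕ → E) (hτ : 0 < τ) (a b : ℝ) :
    IntervalIntegrable (gridVel U τ) volume a b :=
  intervalIntegrable_comp_natCeil (fun j => τ⁻¹ • (U j - U (j - 1))) hτ a b

lemma intervalIntegrable_norm_gridVel_sq (U : ℕ → E) (hτ : 0 < τ) (a b : ℝ) :
    IntervalIntegrable (fun t => ‖gridVel U τ t‖ ^ 2) volume a b :=
  intervalIntegrable_comp_natCeil (fun j => ‖τ⁻¹ • (U j - U (j - 1))‖ ^ 2) hτ a b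

lemma integral_gridVel [CompleteSpace E] (U : ℕ → E) (hτ : 0 < τ) (k : ℕ) :
    ∫ t in (0 : ℝ)..k * τ, gridVel U τ t = U k - U 0 := by
  rw [gridVel_eq_comp, integral_comp_natCeil _ hτ, ← Finset.sum_range_sub]
  refine Finset.sum_congr rfl fun j _ => ?_
  rw [smul_inv_smul₀ hτ.ne', Nat.add_sub_cancel]

lemma integral_norm_gridVel_sq (U : ℕ → E) (hτ : 0 < τ) (k : ℕ) :
    ∫ t in (0 : ℝ)..k * τ, ‖gridVel U τ t‖ ^ 2
      = ∑ j ∈ Finset.range k, ‖U (j + 1) - U j‖ ^ 2 / τ := by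
  have := integral_comp_natCeil (fun j => ‖τ⁻¹ • (U j - U (j - 1))‖ ^ 2) hτ k
  unfold gridVel
  rw [this]
  refine Finset.sum_congr rfl fun j _ => ?_
  rw [Nat.add_sub_cancel, norm_smul, mul_pow, norm_inv, inv_pow, Real.norm_eq_abs, sq_abs,
    smul_eq_mul]
  field_simp

/-- The Cauchy-Schwarz inequality for vector-valued integrals over an interval. -/
lemma norm_intervalIntegral_sq_le {f : ℝ → E} {a b : ℝ} (hab : a ≤ b)
    (hf : IntervalIntegrable f volume a b)
    (hf2 : IntervalIntegrable (fun t => ‖f t‖ ^ 2) volume a b) :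
    ‖∫ t in a..b, f t‖ ^ 2 ≤ (b - a) * ∫ t in a..b, ‖f t‖ ^ 2 := by
  rcases hab.eq_or_lt with rfl | hlt
  · simp
  have hL : 0 < b - a := sub_pos.2 hlt
  set X := ∫ t in a..b, ‖f t‖ with hX
  have h1 : ‖∫ t in a..b, f t‖ ≤ X := intervalIntegral.norm_integral_le_integral_norm hab
  -- The variance of ‖f‖ about its mean is nonnegative; expanding the square gives the inequality.
  have h2 : 0 ≤ ∫ t in a..b, (‖f t‖ - X / (b - a)) ^ 2 :=
    intervalIntegral.integral_nonneg hab fun t _ => sq_nonneg _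
  have h3 : ∫ t in a..b, (‖f t‖ - X / (b - a)) ^ 2
      = (∫ t in a..b, ‖f t‖ ^ 2) - X ^ 2 / (b - a) := by
    have h4 : (fun t => (‖f t‖ - X / (b - a)) ^ 2)
        = fun t => ‖f t‖ ^ 2 - 2 * (X / (b - a)) * ‖f t‖ + (X / (b - a)) ^ 2 := by
      ext t; ring
    rw [h4, intervalIntegral.integral_add (hf2.sub (hf.norm.const_mul _))
      intervalIntegrable_const, intervalIntegral.integral_sub hf2 (hf.norm.const_mul _),
      intervalIntegral.integral_const_mul, intervalIntegral.integral_const, ← hX, smul_eq_mul]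
    field_simp
    ring
  rw [h3] at h2
  have h5 : ‖∫ t in a..b, f t‖ ^ 2 ≤ X ^ 2 := by gcongr
  have h6 : X ^ 2 / (b - a) ≤ ∫ t in a..b, ‖f t‖ ^ 2 := by linarith
  rw [div_le_iff₀ hL] at h6
  linarith

end Grid

/-! ### The discrete solutions -/

section Scheme

variable {N : ℕ} {Ω : Set (Rn N)} {s p e τ : ℝ} {f₀ : L2 Ω} {U : ℕ → L2 Ω}

/-- A solution of the time-discretized problem inside the potential well. -/
structure IsScheme (Ω : Set (Rn N)) (s p e τ : ℝ) (f₀ : L2 Ω) (U : ℕ → L2 Ω) : Prop where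
  zero : U 0 = f₀
  inWell : ∀ k, InWell Ω s p e (zeroExt Ω (U k))
  energy_step : ∀ k, ‖U (k + 1) - U k‖ ^ 2 / τ + energy Ω s p (zeroExt Ω (U (k + 1)))
    ≤ energy Ω s p (zeroExt Ω (U k))
  euler : ∀ (k : ℕ) (φ : L2 Ω), MemW0 Ω s p (zeroExt Ω φ) → inner ℝ (U (k + 1) - U k) φ / τ
    + splitForm Ω s p (zeroExt Ω (U (k + 1))) (zeroExt Ω (U k)) (zeroExt Ω φ) = 0

lemma Admissible.exists_isScheme (h : Admissible Ω s p) (hτ : 0 < τ)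
    (he : e < wellDepth Ω s p) (hf : InWell Ω s p e (zeroExt Ω f₀)) :
    ∃ U, IsScheme Ω s p e τ f₀ U := by
  choose! S hS using fun (f : L2 Ω) (hf : InWell Ω s p e (zeroExt Ω f)) =>
    h.exists_step hτ he hf
  have hW : ∀ k, InWell Ω s p e (zeroExt Ω (S^[k] f₀)) := by
    intro k
    induction k with
    | zero => exact hf
    | succ k ih => rw [Function.iterate_succ_apply']; exact (hS _ ih).1
  refine ⟨fun k => S^[k] f₀, rfl, hW, fun k => ?_, fun k φ hφ => ?_⟩
  · rw [Function.iterate_succ_apply']; exact (hS _ (hW k)).2.1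
  · rw [Function.iterate_succ_apply']; exact (hS _ (hW k)).2.2 φ hφ

namespace IsScheme

lemma sum_add_energy_le (hU : IsScheme Ω s p e τ f₀ U) (k : ℕ) :
    (∑ j ∈ Finset.range k, ‖U (j + 1) - U j‖ ^ 2 / τ) + energy Ω s p (zeroExt Ω (U k)) ≤ e := by
  induction k with
  | zero => simpa using (hU.inWell 0).energy_le
  | succ k ih =>
    rw [Finset.sum_range_succ]
    have := hU.energy_step k
    linarith

/-- The integral up to t is enlarged to the next grid point, where it is a sum of energy drops. -/
lemma integral_norm_gridVel_sq_add_energy_le (hU : IsScheme Ω s p e τ f₀ U) (hτ : 0 < τ)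
    (t : ℝ) (ht : 0 ≤ t) : (∫ r in (0 : ℝ)..t, ‖gridVel U τ r‖ ^ 2)
      + energy Ω s p (zeroExt Ω (U ⌈t / τ⌉₊)) ≤ e := by
  refine le_trans (add_le_add ?_ le_rfl) (hU.sum_add_energy_le ⌈t / τ⌉₊)
  rw [← integral_norm_gridVel_sq U hτ]
  exact intervalIntegral.integral_mono_interval le_rfl ht (le_natCeil_div_mul hτ t)
    (Eventually.of_forall fun r => by positivity) (intervalIntegrable_norm_gridVel_sq U hτ _ _)

variable (h : Admissible Ω s p)
include h

lemma integral_norm_gridVel_sq_le (hU : IsScheme Ω s p e τ f₀ U) (hτ : 0 < τ) {a b : ℝ}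
    (ha : 0 ≤ a) (hab : a ≤ b) : ∫ r in a..b, ‖gridVel U τ r‖ ^ 2 ≤ e := by
  have h1 := hU.integral_norm_gridVel_sq_add_energy_le hτ b (ha.trans hab)
  have h2 := (hU.inWell ⌈b / τ⌉₊).energy_nonneg h
  have h3 : ∫ r in a..b, ‖gridVel U τ r‖ ^ 2 ≤ ∫ r in (0 : ℝ)..b, ‖gridVel U τ r‖ ^ 2 :=
    intervalIntegral.integral_mono_interval ha hab le_rfl
      (Eventually.of_forall fun r => by positivity) (intervalIntegrable_norm_gridVel_sq U hτ _ _)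
  linarith

lemma integrableOn_norm_gridVel_sq (hU : IsScheme Ω s p e τ f₀ U) (hτ : 0 < τ) :
    IntegrableOn (fun t => ‖gridVel U τ t‖ ^ 2) (Ioi 0) volume ∧
      ∫ t in Ioi 0, ‖gridVel U τ t‖ ^ 2 ≤ e := by
  have h1 : IntegrableOn (fun t => ‖gridVel U τ t‖ ^ 2) (Ioi 0) volume := by
    refine integrableOn_Ioi_of_intervalIntegral_norm_bounded e 0 (l := atTop) (b := fun n : ℕ => n)
      (fun n => ?_) tendsto_natCast_atTop_atTop (Eventually.of_forall fun n => ?_)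
    · exact (intervalIntegrable_iff_integrableOn_Ioc_of_le n.cast_nonneg).1
        (intervalIntegrable_norm_gridVel_sq U hτ _ _)
    · simp only [norm_pow, norm_norm]
      exact hU.integral_norm_gridVel_sq_le h hτ le_rfl n.cast_nonneg
  refine ⟨h1, ?_⟩
  exact le_of_tendsto' (intervalIntegral_tendsto_integral_Ioi 0 h1
    (tendsto_natCast_atTop_atTop (R := ℝ)))
    fun n => hU.integral_norm_gridVel_sq_le h hτ le_rfl n.cast_nonneg

lemma memLp_gridVel (hU : IsScheme Ω s p e τ f₀ U) (hτ : 0 < τ) :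
    MemLp (gridVel U τ) 2 (volume.restrict (Ioi 0)) :=
  (memLp_two_iff_integrable_sq_norm
    (stronglyMeasurable_gridVel U τ).aestronglyMeasurable).2 (hU.integrableOn_norm_gridVel_sq h hτ).1

/-- The piecewise constant and the piecewise affine interpolants are close. -/
lemma norm_sub_integral_sq_le (hU : IsScheme Ω s p e τ f₀ U) (hτ : 0 < τ) {t : ℝ} (ht : 0 ≤ t) :
    ‖U ⌈t / τ⌉₊ - (f₀ + ∫ r in (0 : ℝ)..t, gridVel U τ r)‖ ^ 2 ≤ τ * e := by
  have h1 := integral_gridVel U hτ ⌈t / τ⌉₊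
  rw [hU.zero] at h1
  -- The affine interpolant reaches the new value at the right end of the cell, so the error is the
  -- integral of the velocity over the rest of the cell, of length at most τ.
  have h2 : U ⌈t / τ⌉₊ - (f₀ + ∫ r in (0 : ℝ)..t, gridVel U τ r)
      = ∫ r in t..⌈t / τ⌉₊ * τ, gridVel U τ r := by
    rw [← intervalIntegral.integral_interval_sub_left
      (intervalIntegrable_gridVel U hτ 0 _) (intervalIntegrable_gridVel U hτ 0 t), h1]
    abel
  have hle := le_natCeil_div_mul hτ t
  rw [h2]
  refine (norm_intervalIntegral_sq_le hle (intervalIntegrable_gridVel U hτ _ _)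
    (intervalIntegrable_norm_gridVel_sq U hτ _ _)).trans ?_
  have h3 := hU.integral_norm_gridVel_sq_le h hτ ht hle
  have h4 := natCeil_div_mul_lt hτ ht
  have h5 : 0 ≤ ∫ r in t..⌈t / τ⌉₊ * τ, ‖gridVel U τ r‖ ^ 2 :=
    intervalIntegral.integral_nonneg hle fun r _ => by positivity
  have h6 : 0 ≤ ⌈t / τ⌉₊ * τ - t := by linarith
  nlinarith

lemma norm_sub_pred_sq_le (hU : IsScheme Ω s p e τ f₀ U) (hτ : 0 < τ) (k : ℕ) :
    ‖U k - U (k - 1)‖ ^ 2 ≤ τ * e := by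
  have he : 0 ≤ e := ((hU.inWell 0).energy_nonneg h).trans (hU.inWell 0).energy_le
  -- For k = 0 the truncated subtraction makes the difference zero.
  rcases k.eq_zero_or_pos with rfl | hk
  · simpa using mul_nonneg hτ.le he
  · obtain ⟨k, rfl⟩ := Nat.exists_eq_succ_of_ne_zero hk.ne'
    have h1 := hU.energy_step k
    have h2 := (hU.inWell (k + 1)).energy_nonneg h
    have h3 := (hU.inWell k).energy_le
    rw [Nat.succ_eq_add_one, Nat.add_sub_cancel]
    have h4 : ‖U (k + 1) - U k‖ ^ 2 / τ ≤ e := by linarith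
    rw [div_le_iff₀ hτ] at h4
    linarith

omit h in
lemma inner_gridVel (hU : IsScheme Ω s p e τ f₀ U) (hτ : 0 < τ) {φ : L2 Ω}
    (hφ : MemW0 Ω s p (zeroExt Ω φ)) {t : ℝ} (ht : 0 < t) :
    inner ℝ (gridVel U τ t) φ = -splitForm Ω s p (zeroExt Ω (U ⌈t / τ⌉₊))
      (zeroExt Ω (U (⌈t / τ⌉₊ - 1))) (zeroExt Ω φ) := by
  have hk : 0 < ⌈t / τ⌉₊ := Nat.ceil_pos.2 (by positivity)
  obtain ⟨k, hk⟩ := Nat.exists_eq_succ_of_ne_zero hk.ne'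
  have h1 := hU.euler k φ hφ
  rw [gridVel, hk, Nat.succ_eq_add_one, Nat.add_sub_cancel, real_inner_smul_left]
  rw [div_eq_inv_mul] at h1
  linarith

end IsScheme

end Scheme

/-! ### Passage to the limit in the time discretization -/

section Bochner

variable {E : Type*} [NormedAddCommGroup E]

lemma intervalIntegrable_of_memLp_two {f : ℝ → E} (hf : MemLp f 2 (volume.restrict (Ioi 0)))
    {a b : ℝ} (ha : 0 ≤ a) (hb : 0 ≤ b) : IntervalIntegrable f volume a b := by
  have hsub : uIoc a b ⊆ Ioi (0 : ℝ) := fun x hx => (le_min ha hb).trans_lt hx.1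
  rw [intervalIntegrable_iff]
  have : IsFiniteMeasure (volume.restrict (uIoc a b)) :=
    ⟨by rw [Measure.restrict_apply_univ]; simp [uIoc]⟩
  exact (hf.mono_measure (Measure.restrict_mono hsub le_rfl)).integrable one_le_two

lemma intervalIntegrable_norm_sq_of_memLp_two {f : ℝ → E}
    (hf : MemLp f 2 (volume.restrict (Ioi 0))) {a b : ℝ} (ha : 0 ≤ a) (hb : 0 ≤ b) :
    IntervalIntegrable (fun t => ‖f t‖ ^ 2) volume a b := by
  have hsub : uIoc a b ⊆ Ioi (0 : ℝ) := fun x hx => (le_min ha hb).trans_lt hx.1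
  rw [intervalIntegrable_iff]
  exact IntegrableOn.mono_set ((memLp_two_iff_integrable_sq_norm hf.1).1 hf) hsub

variable [InnerProductSpace ℝ E]

/-- These test elements turn weak convergence of velocities in L²(0,∞) into weak convergence of
their primitives at each fixed time. -/
lemma inner_toLp_indicatorConstLp [CompleteSpace E] {g : ℝ → E} (hg : MemLp g 2 (volume.restrict (Ioi 0)))
    {t : ℝ} (ht : 0 ≤ t) (y : E) (hfin : (volume.restrict (Ioi (0 : ℝ))) (Ioc 0 t) ≠ ⊤) :
    inner ℝ (hg.toLp g) (indicatorConstLp 2 (measurableSet_Ioc (a := (0 : ℝ)) (b := t)) hfin y)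
      = inner ℝ (∫ r in (0 : ℝ)..t, g r) y := by
  rw [real_inner_comm, L2.inner_indicatorConstLp_eq_inner_setIntegral, real_inner_comm,
    intervalIntegral.integral_of_le ht, Measure.restrict_restrict measurableSet_Ioc,
    inter_eq_left.2 Ioc_subset_Ioi_self]
  congr 1
  refine integral_congr_ae ?_
  exact ae_restrict_of_ae_restrict_of_subset Ioc_subset_Ioi_self hg.coeFn_toLp

lemma inner_toLp_toLp {f g : ℝ → E} (hf : MemLp f 2 (volume.restrict (Ioi 0)))
    (hg : MemLp g 2 (volume.restrict (Ioi 0))) :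
    inner ℝ (hf.toLp f) (hg.toLp g) = ∫ r in Ioi 0, inner ℝ (f r) (g r) := by
  rw [L2.inner_def]
  refine integral_congr_ae ?_
  filter_upwards [hf.coeFn_toLp, hg.coeFn_toLp] with r h1 h2
  rw [h1, h2]

lemma norm_toLp_sq {f : ℝ → E} (hf : MemLp f 2 (volume.restrict (Ioi 0))) :
    ‖hf.toLp f‖ ^ 2 = ∫ r in Ioi 0, ‖f r‖ ^ 2 := by
  rw [← real_inner_self_eq_norm_sq, inner_toLp_toLp]
  simp_rw [real_inner_self_eq_norm_sq]

lemma inner_toLp_indicator {f g : ℝ → E} (hf : MemLp f 2 (volume.restrict (Ioi 0))) {t : ℝ} (ht : 0 ≤ t)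
    (hgt : MemLp ((Ioc 0 t).indicator g) 2 (volume.restrict (Ioi 0))) :
    inner ℝ (hf.toLp f) (hgt.toLp _) = ∫ r in (0 : ℝ)..t, inner ℝ (f r) (g r) := by
  have h1 : (fun r => (inner ℝ (f r) ((Ioc 0 t).indicator g r) : ℝ))
      = (Ioc 0 t).indicator fun r => inner ℝ (f r) (g r) := by
    ext r
    by_cases hr : r ∈ Ioc 0 t
    · simp only [indicator_of_mem hr]
    · simp only [indicator_of_notMem hr, inner_zero_right]
  rw [inner_toLp_toLp, h1, integral_indicator measurableSet_Ioc,
    Measure.restrict_restrict measurableSet_Ioc, inter_eq_left.2 Ioc_subset_Ioi_self,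
    intervalIntegral.integral_of_le ht]

lemma intervalIntegral_inner_right [CompleteSpace E] {f : ℝ → E} {a b : ℝ}
    (hf : IntervalIntegrable f volume a b) (y : E) :
    ∫ r in a..b, inner ℝ y (f r) = inner ℝ y (∫ r in a..b, f r) :=
  (innerSL ℝ y).intervalIntegral_comp_comm hf

/-- Weak lower semicontinuity of the norm of `L²(0,t)`, in linearized form. -/
lemma two_mul_inner_sub_le {f g : ℝ → E} (hf : MemLp f 2 (volume.restrict (Ioi 0)))
    (hg : MemLp g 2 (volume.restrict (Ioi 0))) {t : ℝ} (ht : 0 ≤ t)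
    (hgt : MemLp ((Ioc 0 t).indicator g) 2 (volume.restrict (Ioi 0))) :
    2 * inner ℝ (hf.toLp f) (hgt.toLp _) - ∫ r in (0 : ℝ)..t, ‖g r‖ ^ 2
      ≤ ∫ r in (0 : ℝ)..t, ‖f r‖ ^ 2 := by
  have h1 : inner ℝ (hf.toLp f) (hgt.toLp _) = ∫ r in (0 : ℝ)..t, inner ℝ (f r) (g r) :=
    inner_toLp_indicator hf ht hgt
  have hf2 := intervalIntegrable_norm_sq_of_memLp_two hf le_rfl ht
  have hg2 := intervalIntegrable_norm_sq_of_memLp_two hg le_rfl ht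
  have hfg : IntervalIntegrable (fun r => inner ℝ (f r) (g r)) volume 0 t := by
    refine IntervalIntegrable.mono_fun' (hf2.add hg2) ?_ (Eventually.of_forall fun r => ?_)
    · exact ((hf.1.inner hg.1).mono_measure (Measure.restrict_mono
        (by rw [uIoc_of_le ht]; exact Ioc_subset_Ioi_self) le_rfl))
    · have h1 := norm_inner_le_norm (𝕜 := ℝ) (f r) (g r)
      have h2 := sq_nonneg (‖f r‖ - ‖g r‖)
      nlinarith [sq_nonneg ‖f r‖, sq_nonneg ‖g r‖]
  rw [h1, sub_le_iff_le_add, ← intervalIntegral.integral_add hf2 hg2,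
    ← intervalIntegral.integral_const_mul]
  refine intervalIntegral.integral_mono_on ht (hfg.const_mul 2) (hf2.add hg2) fun r _ => ?_
  have := sq_nonneg ‖f r - g r‖
  have h2 := norm_sub_sq_real (f r) (g r)
  have h3 : 0 ≤ ‖f r - g r‖ ^ 2 := by positivity
  rw [h2] at h3
  linarith

end Bochner

/-! ### Convergence of the discrete solutions to the gradient flow -/

section Limit

variable {N : ℕ} {Ω : Set (Rn N)} {s p e B : ℝ} {f₀ : L2 Ω} {u ut : ℝ → L2 Ω}

/-- The gradient flow of the energy inside the potential well, in integrated form. -/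
structure IsFlow (Ω : Set (Rn N)) (s p e : ℝ) (f₀ : L2 Ω) (u ut : ℝ → L2 Ω) : Prop where
  memLp : MemLp ut 2 (volume.restrict (Ioi 0))
  eq_integral : ∀ t, 0 ≤ t → u t = f₀ + ∫ r in (0 : ℝ)..t, ut r
  inWell : ∀ t, 0 ≤ t → InWell Ω s p e (zeroExt Ω (u t))
  energy_le : ∀ t, 0 ≤ t →
    (∫ r in (0 : ℝ)..t, ‖ut r‖ ^ 2) + energy Ω s p (zeroExt Ω (u t)) ≤ e
  weak : ∀ φ : L2 Ω, MemW0 Ω s p (zeroExt Ω φ) → ∀ t, 0 ≤ t → inner ℝ (u t - f₀) φ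
    = -∫ r in (0 : ℝ)..t, splitForm Ω s p (zeroExt Ω (u r)) (zeroExt Ω (u r)) (zeroExt Ω φ)

lemma Admissible.gagliardoPow_le_of_tendsto (h : Admissible Ω s p) {v : ℕ → L2 Ω} {v' : L2 Ω}
    (hv : ∀ n, v n ∈ bddSet Ω s p B) (hlim : Tendsto v atTop (𝓝 v')) {c : ℕ → ℝ} {c' : ℝ}
    (hc : ∀ n, gagliardoPow s p (zeroExt Ω (v n)) ≤ c n) (hc' : Tendsto c atTop (𝓝 c')) :
    gagliardoPow s p (zeroExt Ω v') ≤ c' := by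
  obtain ⟨ms, hms, hae⟩ := exists_subseq_zeroExt_ae h.measurableSet hlim
  exact h.gagliardoPow_le_of_tendsto_ae (fun n => (hv (ms n)).mem) hae (fun n => hc (ms n))
    (hc'.comp hms.tendsto_atTop)

lemma tendsto_of_continuousOn_bddSet {v : ℕ → L2 Ω} {v' : L2 Ω} {Ψ : L2 Ω → ℝ}
    (hΨ : ContinuousOn Ψ (bddSet Ω s p B)) (hv : ∀ n, v n ∈ bddSet Ω s p B)
    (hv' : v' ∈ bddSet Ω s p B) (hlim : Tendsto v atTop (𝓝 v')) :
    Tendsto (fun n => Ψ (v n)) atTop (𝓝 (Ψ v')) :=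
  (hΨ v' hv').tendsto.comp
    (tendsto_nhdsWithin_iff.2 ⟨hlim, Eventually.of_forall hv⟩)

/-- The energy inequality passes to the limit. -/
lemma Admissible.add_energy_le_of_tendsto (h : Admissible Ω s p) {v : ℕ → L2 Ω} {v' : L2 Ω}
    (hv : ∀ n, v n ∈ bddSet Ω s p B) (hlim : Tendsto v atTop (𝓝 v')) {c : ℕ → ℝ} {c' : ℝ}
    (hc : ∀ n, c n + energy Ω s p (zeroExt Ω (v n)) ≤ e) (hc' : Tendsto c atTop (𝓝 c')) :
    c' + energy Ω s p (zeroExt Ω v') ≤ e := by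
  have hp := h.pos
  have hv' : v' ∈ bddSet Ω s p B :=
    (isClosed_bddSet h).mem_of_tendsto hlim (Eventually.of_forall hv)
  have h1 := tendsto_of_continuousOn_bddSet (continuousOn_intPow h) hv hv' hlim
  have h2 := tendsto_of_continuousOn_bddSet (continuousOn_intPowLog h) hv hv' hlim
  have hid : ∀ u : Rn N → ℝ, gagliardoPow s p u = p * energy Ω s p u
      - (intPow Ω p u - intPowLog Ω p u + 1 / p * intPow Ω p u) := by
    intro u
    unfold energy
    field_simp
    ring
  -- Only the seminorm is merely lower semicontinuous. The inequality is solved for it, so that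
  -- everything on the other side converges.
  have h3 := h.gagliardoPow_le_of_tendsto hv hlim
    (c := fun n => p * (e - c n) - (intPow Ω p (zeroExt Ω (v n)) - intPowLog Ω p (zeroExt Ω (v n))
      + 1 / p * intPow Ω p (zeroExt Ω (v n)))) (fun n => by
        rw [hid]
        have := mul_le_mul_of_nonneg_left (le_sub_iff_add_le'.2 (hc n)) hp.le
        linarith)
    (((hc'.const_sub e).const_mul p).sub ((h1.sub h2).add (h1.const_mul (1 / p))))
  rw [hid] at h3
  have h4 : p * energy Ω s p (zeroExt Ω v') ≤ p * (e - c') := by linarith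
  have := le_of_mul_le_mul_left h4 hp
  linarith

lemma InWell.of_tendsto (h : Admissible Ω s p) {v : ℕ → L2 Ω} {v' : L2 Ω}
    (hv : ∀ n, InWell Ω s p e (zeroExt Ω (v n))) (hlim : Tendsto v atTop (𝓝 v')) :
    InWell Ω s p e (zeroExt Ω v') := by
  obtain ⟨B, hB⟩ := InWell.exists_bddW h e
  have hvB : ∀ n, v n ∈ bddSet Ω s p B := fun n => hB _ (hv n)
  have hv' : v' ∈ bddSet Ω s p B :=
    (isClosed_bddSet h).mem_of_tendsto hlim (Eventually.of_forall hvB)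
  refine ⟨hv'.mem, le_of_tendsto' (tendsto_of_continuousOn_bddSet (continuousOn_intPow h) hvB hv'
    hlim) fun n => (hv n).intPow_le, ?_⟩
  have := h.add_energy_le_of_tendsto (e := e) hvB hlim (c := fun _ => 0)
    (fun n => by simpa using (hv n).energy_le) tendsto_const_nhds
  simpa using this

/-- Weakly convergent sequences in a bounded set of `W₀` converge strongly in `L²(Ω)`. -/
lemma tendsto_of_tendsto_inner (h : Admissible Ω s p) {v : ℕ → L2 Ω} {v' : L2 Ω}
    (hv : ∀ n, v n ∈ bddSet Ω s p B)
    (hw : ∀ y, Tendsto (fun n => inner ℝ (v n) y) atTop (𝓝 (inner ℝ v' y))) :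
    Tendsto v atTop (𝓝 v') := by
  refine tendsto_of_subseq_tendsto fun ns hns => ?_
  obtain ⟨b, -, ms, hms, hb⟩ := (isCompact_bddSet h).isSeqCompact fun n => hv (ns n)
  refine ⟨ms, ?_⟩
  have : b = v' := by
    refine ext_inner_right ℝ fun y => ?_
    have h1 : Tendsto (fun n => inner ℝ (v (ns (ms n))) y) atTop (𝓝 (inner ℝ b y)) :=
      hb.inner tendsto_const_nhds
    exact tendsto_nhds_unique h1 ((hw y).comp (hns.comp hms.tendsto_atTop))
  rw [← this]
  exact hb

lemma IsScheme.inner_integral_gridVel {τ : ℝ} {U : ℕ → L2 Ω} (hU : IsScheme Ω s p e τ f₀ U)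
    (hτ : 0 < τ) {φ : L2 Ω} (hφ : MemW0 Ω s p (zeroExt Ω φ)) {t : ℝ} (ht : 0 ≤ t) :
    inner ℝ (∫ r in (0 : ℝ)..t, gridVel U τ r) φ
      = -∫ r in (0 : ℝ)..t, splitForm Ω s p (zeroExt Ω (U ⌈r / τ⌉₊))
          (zeroExt Ω (U (⌈r / τ⌉₊ - 1))) (zeroExt Ω φ) := by
  have h1 := intervalIntegral_inner_right (intervalIntegrable_gridVel U hτ 0 t) φ
  rw [real_inner_comm, ← h1, ← intervalIntegral.integral_neg]
  refine intervalIntegral.integral_congr_ae (Eventually.of_forall fun r hr => ?_)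
  rw [uIoc_of_le ht] at hr
  rw [real_inner_comm]
  exact hU.inner_gridVel hτ hφ hr.1

/-- The form is continuous on a compact product of bounded sets, hence bounded there, and dominated
convergence in time applies. -/
lemma tendsto_integral_splitForm (h : Admissible Ω s p) {φ : Rn N → ℝ} (hφ : MemW0 Ω s p φ)
    {t : ℝ} (ht : 0 ≤ t) {τ : ℕ → ℝ} {U : ℕ → ℕ → L2 Ω} (hU : ∀ n k, U n k ∈ bddSet Ω s p B)
    (hu : ∀ r, 0 ≤ r → u r ∈ bddSet Ω s p B)
    (h1 : ∀ r, 0 ≤ r → Tendsto (fun n => U n ⌈r / τ n⌉₊) atTop (𝓝 (u r)))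
    (h2 : ∀ r, 0 ≤ r → Tendsto (fun n => U n (⌈r / τ n⌉₊ - 1)) atTop (𝓝 (u r))) :
    Tendsto (fun n => ∫ r in (0 : ℝ)..t, splitForm Ω s p (zeroExt Ω (U n ⌈r / τ n⌉₊))
        (zeroExt Ω (U n (⌈r / τ n⌉₊ - 1))) φ) atTop
      (𝓝 (∫ r in (0 : ℝ)..t, splitForm Ω s p (zeroExt Ω (u r)) (zeroExt Ω (u r)) φ)) := by
  set Ψ : L2 Ω → L2 Ω → ℝ := fun f g => splitForm Ω s p (zeroExt Ω f) (zeroExt Ω g) φ with hΨ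
  have hcont : ContinuousOn (fun f : L2 Ω × L2 Ω => Ψ f.1 f.2)
    (bddSet Ω s p B ×ˢ bddSet Ω s p B) := h.continuousOn_splitForm hφ
  change Tendsto (fun n => ∫ r in (0 : ℝ)..t, Ψ (U n ⌈r / τ n⌉₊) (U n (⌈r / τ n⌉₊ - 1))) atTop
      (𝓝 (∫ r in (0 : ℝ)..t, Ψ (u r) (u r)))
  clear_value Ψ
  obtain ⟨C, hC⟩ := ((isCompact_bddSet h).prod (isCompact_bddSet h)).exists_bound_of_continuousOn
    hcont
  have hC' : ∀ n k l, ‖Ψ (U n k) (U n l)‖ ≤ C :=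
    fun n k l => hC (U n k, U n l) ⟨hU n k, hU n l⟩
  have hlim : ∀ r, 0 ≤ r → Tendsto (fun n => Ψ (U n ⌈r / τ n⌉₊) (U n (⌈r / τ n⌉₊ - 1))) atTop
      (𝓝 (Ψ (u r) (u r))) := by
    intro r hr
    have h3 := (hcont (u r, u r) ⟨hu r hr, hu r hr⟩).tendsto
    have h4 : Tendsto (fun n => (U n ⌈r / τ n⌉₊, U n (⌈r / τ n⌉₊ - 1))) atTop
        (𝓝[bddSet Ω s p B ×ˢ bddSet Ω s p B] (u r, u r)) := tendsto_nhdsWithin_iff.2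
      ⟨(h1 r hr).prodMk_nhds (h2 r hr), Eventually.of_forall fun n => ⟨hU n _, hU n _⟩⟩
    exact h3.comp h4
  refine intervalIntegral.tendsto_integral_filter_of_dominated_convergence (fun _ => C)
    (Eventually.of_forall fun n => ?_) (Eventually.of_forall fun n => ?_)
    intervalIntegrable_const (Eventually.of_forall fun r hr => ?_)
  · exact (stronglyMeasurable_comp_natCeil (fun k => Ψ (U n k) (U n (k - 1))) (τ n)).aestronglyMeasurable
  · exact Eventually.of_forall fun r _ => hC' n _ _
  · rw [uIoc_of_le ht] at hr
    exact hlim r hr.1.le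

/-- The limit is defined as the primitive of the weak limit of the velocities. At each time the
discrete solutions converge to it weakly, their distance to the affine interpolants being at most
√(τ e), and therefore strongly by compactness. -/
lemma isFlow_of_tendsto (h : Admissible Ω s p) {τ : ℕ → ℝ} {U : ℕ → ℕ → L2 Ω}
    (hτ : ∀ n, 0 < τ n) (hτ0 : Tendsto τ atTop (𝓝 0))
    (hU : ∀ n, IsScheme Ω s p e (τ n) f₀ (U n)) (hut : MemLp ut 2 (volume.restrict (Ioi 0)))
    (hweak : ∀ y, Tendsto (fun n => inner ℝ (((hU n).memLp_gridVel h (hτ n)).toLp _) y) atTop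
      (𝓝 (inner ℝ (hut.toLp ut) y))) :
    IsFlow Ω s p e f₀ (fun t => f₀ + ∫ r in (0 : ℝ)..t, ut r) ut := by
  obtain ⟨B, hB⟩ := InWell.exists_bddW h e
  have hUB : ∀ n k, U n k ∈ bddSet Ω s p B := fun n k => hB _ ((hU n).inWell k)
  set u : ℝ → L2 Ω := fun t => f₀ + ∫ r in (0 : ℝ)..t, ut r with hu
  have hτe : Tendsto (fun n => τ n * e) atTop (𝓝 0) := by simpa using hτ0.mul_const e
  have hsmall : ∀ x : ℕ → L2 Ω, (∀ n, ‖x n‖ ^ 2 ≤ τ n * e) → Tendsto x atTop (𝓝 0) := by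
    intro x hx
    have h1 := (squeeze_zero (fun n => by positivity) hx hτe).sqrt
    simp only [Real.sqrt_sq (norm_nonneg _), Real.sqrt_zero] at h1
    exact tendsto_zero_iff_norm_tendsto_zero.2 h1
  have hstrong : ∀ t, 0 ≤ t → Tendsto (fun n => U n ⌈t / τ n⌉₊) atTop (𝓝 (u t)) := by
    intro t ht
    refine tendsto_of_tendsto_inner h (fun n => hUB n _) fun y => ?_
    have hfin : (volume.restrict (Ioi (0 : ℝ))) (Ioc 0 t) ≠ ⊤ :=
      ((Measure.restrict_apply_le _ _).trans_lt measure_Ioc_lt_top).ne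
    have h1 := hweak (indicatorConstLp 2 (measurableSet_Ioc (a := (0 : ℝ)) (b := t)) hfin y)
    simp_rw [inner_toLp_indicatorConstLp _ ht] at h1
    have h2 := Filter.Tendsto.inner (𝕜 := ℝ)
      (hsmall _ fun n => (hU n).norm_sub_integral_sq_le h (hτ n) ht) (tendsto_const_nhds (x := y))
    have h3 := (h1.const_add (inner ℝ f₀ y)).add h2
    rw [inner_zero_left, add_zero, ← inner_add_left] at h3
    refine h3.congr fun n => ?_
    rw [← inner_add_left, ← inner_add_left]
    congr 1
    abel
  have hinW : ∀ t, 0 ≤ t → InWell Ω s p e (zeroExt Ω (u t)) := fun t ht =>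
    InWell.of_tendsto h (fun n => (hU n).inWell _) (hstrong t ht)
  refine ⟨hut, fun t _ => rfl, hinW, fun t ht => ?_, fun φ hφ t ht => ?_⟩
  · have hgt : MemLp ((Ioc 0 t).indicator ut) 2 (volume.restrict (Ioi 0)) :=
      hut.indicator measurableSet_Ioc
    -- Lower semicontinuity of the dissipation by linearization: 2⟨f, g⟩ - ‖g‖² ≤ ‖f‖² with g the
    -- limit velocity has a left side that is linear in f, and its limit is ∫ ‖ut‖².
    have h1 := ((hweak (hgt.toLp _)).const_mul 2).sub_const (∫ r in (0 : ℝ)..t, ‖ut r‖ ^ 2)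
    have h2 := h.add_energy_le_of_tendsto (e := e) (fun n => hUB n _) (hstrong t ht)
      (fun n => (add_le_add (two_mul_inner_sub_le ((hU n).memLp_gridVel h (hτ n)) hut ht hgt)
        le_rfl).trans ((hU n).integral_norm_gridVel_sq_add_energy_le (hτ n) t ht)) h1
    have h3 : inner ℝ (hut.toLp ut) (hgt.toLp _) = ∫ r in (0 : ℝ)..t, ‖ut r‖ ^ 2 := by
      rw [inner_toLp_indicator hut ht hgt]
      simp_rw [real_inner_self_eq_norm_sq]
    rw [h3] at h2
    linarith
  -- Consecutive time levels differ by at most √(τ e), so the explicit argument of the form has the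
  -- same limit as the implicit one.
  · have hpred : ∀ r, 0 ≤ r → Tendsto (fun n => U n (⌈r / τ n⌉₊ - 1)) atTop (𝓝 (u r)) := by
      intro r hr
      have h1 := (hstrong r hr).sub (hsmall _ fun n =>
        (hU n).norm_sub_pred_sq_le h (hτ n) ⌈r / τ n⌉₊)
      simpa using h1
    have hdct : Tendsto (fun n => ∫ r in (0 : ℝ)..t, splitForm Ω s p (zeroExt Ω (U n ⌈r / τ n⌉₊))
          (zeroExt Ω (U n (⌈r / τ n⌉₊ - 1))) (zeroExt Ω φ)) atTop
        (𝓝 (∫ r in (0 : ℝ)..t, splitForm Ω s p (zeroExt Ω (u r)) (zeroExt Ω (u r))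
          (zeroExt Ω φ))) := by
      exact tendsto_integral_splitForm h hφ ht hUB (fun r hr => hB _ (hinW r hr)) hstrong hpred
    have hfin : (volume.restrict (Ioi (0 : ℝ))) (Ioc 0 t) ≠ ⊤ :=
      ((Measure.restrict_apply_le _ _).trans_lt measure_Ioc_lt_top).ne
    have h1 := hweak (indicatorConstLp 2 (measurableSet_Ioc (a := (0 : ℝ)) (b := t)) hfin φ)
    simp_rw [inner_toLp_indicatorConstLp _ ht] at h1
    have h2 : u t - f₀ = ∫ r in (0 : ℝ)..t, ut r := by simp [hu]
    rw [h2]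
    refine tendsto_nhds_unique h1 (hdct.neg.congr fun n => ?_)
    exact ((hU n).inner_integral_gridVel (hτ n) hφ ht).symm

/-- Existence of the flow by passage to the limit in the convex splitting scheme. -/
theorem exists_isFlow (h : Admissible Ω s p) (he : e < wellDepth Ω s p)
    (hf : InWell Ω s p e (zeroExt Ω f₀)) :
    ∃ ut, IsFlow Ω s p e f₀ (fun t => f₀ + ∫ r in (0 : ℝ)..t, ut r) ut := by
  have hτ : ∀ n : ℕ, (0 : ℝ) < 1 / (n + 1) := fun n => by positivity
  choose U hU using fun n : ℕ => h.exists_isScheme (hτ n) he hf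
  have hbd : ∀ n, ‖((hU n).memLp_gridVel h (hτ n)).toLp _‖ ≤ √e := by
    intro n
    refine Real.le_sqrt_of_sq_le ?_
    rw [norm_toLp_sq]
    exact ((hU n).integrableOn_norm_gridVel_sq h (hτ n)).2
  obtain ⟨W, ψ, hψ, hW⟩ := exists_subseq_tendsto_inner hbd
  refine ⟨W, isFlow_of_tendsto h (fun n => hτ (ψ n))
    (tendsto_one_div_add_atTop_nhds_zero_nat.comp hψ.tendsto_atTop) (fun n => hU (ψ n))
    (Lp.memLp W) ?_⟩
  rw [Lp.toLp_coeFn]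
  exact hW

end Limit

/-! ### The flow is a weak solution -/

/-- By second countability every open set is a countable union of closed balls. This proves
measurability of maps for which only lower semicontinuity of distances is at hand. -/
lemma measurable_of_measurableSet_preimage_closedBall {X Y : Type*} [MeasurableSpace X]
    [PseudoMetricSpace Y] [SecondCountableTopology Y] [MeasurableSpace Y] [BorelSpace Y] {f : X → Y}
    (hf : ∀ y r, 0 < r → MeasurableSet (f ⁻¹' Metric.closedBall y r)) : Measurable f := by
  refine measurable_of_isOpen fun V hV => ?_
  have h1 : ∀ y : V, ∃ r, 0 < r ∧ Metric.closedBall (y : Y) r ⊆ V := fun y =>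
    Metric.nhds_basis_closedBall.mem_iff.1 (hV.mem_nhds y.2)
  choose r hr0 hr using h1
  obtain ⟨T, hT, hTU⟩ := TopologicalSpace.isOpen_iUnion_countable
    (fun y : V => Metric.ball (y : Y) (r y)) fun _ => Metric.isOpen_ball
  have h2 : V = ⋃ y ∈ T, Metric.closedBall (y : Y) (r y) := by
    refine Subset.antisymm (fun y hy => ?_) (iUnion₂_subset fun y _ => hr y)
    have h3 : y ∈ ⋃ i ∈ T, Metric.ball (i : Y) (r i) := by
      rw [hTU]
      exact mem_iUnion.2 ⟨⟨y, hy⟩, Metric.mem_ball_self (hr0 _)⟩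
    exact iUnion₂_mono (fun i _ => Metric.ball_subset_closedBall) h3
  rw [h2, preimage_iUnion₂]
  exact MeasurableSet.biUnion hT fun y _ => hf _ _ (hr0 y)

/-! ### Measurability in time with values in the fractional Sobolev space -/

section Quotient

variable {N : ℕ} {Ω : Set (Rn N)} {s p B : ℝ}

/-- The image of `f` under the isometry `gagliardoQuotient`. -/
def quotientLp (s p : ℝ) (f : L2 Ω) :
    Lp ℝ (ENNReal.ofReal p) (volume : Measure (Rn N × Rn N)) :=
  open Classical in
  if h : MemLp (gagliardoQuotient s p (zeroExt Ω f)) (ENNReal.ofReal p) volume then h.toLp _ else 0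

lemma quotientLp_of_memLp {f : L2 Ω}
    (hf : MemLp (gagliardoQuotient s p (zeroExt Ω f)) (ENNReal.ofReal p) volume) :
    quotientLp s p f = hf.toLp _ := dif_pos hf

lemma coeFn_quotientLp (hp : 0 < p) {f : L2 Ω} (hf : MemW0 Ω s p (zeroExt Ω f)) :
    quotientLp s p f =ᵐ[volume] gagliardoQuotient s p (zeroExt Ω f) := by
  rw [quotientLp_of_memLp (hf.memLp_quotient hp)]
  exact MemLp.coeFn_toLp _

lemma norm_quotientLp_le (hp : 0 < p) {f : L2 Ω} (hf : f ∈ bddSet Ω s p B) :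
    ‖quotientLp s p f‖ ≤ B ^ p⁻¹ := by
  have hf' : BddW Ω s p B (zeroExt Ω f) := hf
  have hq := hf'.mem.memLp_quotient hp
  rw [quotientLp_of_memLp hq, Lp.norm_toLp, eLpNorm_eq_ofReal_integral_abs_rpow hp hq,
    ENNReal.toReal_ofReal (by positivity), ← gagliardoPow_eq hp]
  exact Real.rpow_le_rpow (gagliardoPow_nonneg hp _) hf'.gagliardo_le (by positivity)

/-- Fatou's lemma makes the distance to `y` lower semicontinuous along L²(Ω)-convergent sequences,
so its sublevel sets in time are closed. -/
lemma isClosed_setOf_quotientLp_mem_closedBall (h : Admissible Ω s p) {w : ℝ → L2 Ω}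
    (hw : Continuous w) (hwB : ∀ t, w t ∈ bddSet Ω s p B)
    (y : Lp ℝ (ENNReal.ofReal p) (volume : Measure (Rn N × Rn N))) {r : ℝ}
    (hr : 0 ≤ r) : IsClosed {t | ‖quotientLp s p (w t) - y‖ ≤ r} := by
  have hw' : ∀ t, BddW Ω s p B (zeroExt Ω (w t)) := hwB
  have hmem : ∀ t, ‖quotientLp s p (w t) - y‖ ≤ r
      ↔ eLpNorm (fun z => gagliardoQuotient s p (zeroExt Ω (w t)) z - y z) (ENNReal.ofReal p) volume
        ≤ ENNReal.ofReal r := by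
    intro t
    have h1 : (quotientLp s p (w t) - y : Lp ℝ (ENNReal.ofReal p) _)
        =ᵐ[volume] fun z => gagliardoQuotient s p (zeroExt Ω (w t)) z - y z := by
      filter_upwards [Lp.coeFn_sub (quotientLp s p (w t)) y,
        coeFn_quotientLp h.pos (hw' t).mem] with z h1 h2
      rw [h1, Pi.sub_apply, h2]
    rw [← eLpNorm_congr_ae h1, ENNReal.le_ofReal_iff_toReal_le (Lp.eLpNorm_ne_top _) hr,
      Lp.norm_def]
  refine IsSeqClosed.isClosed fun t t' ht hlim => ?_
  rw [mem_ofPred_eq, hmem]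
  obtain ⟨ms, -, hae⟩ := exists_subseq_zeroExt_ae h.measurableSet ((hw.tendsto t').comp hlim)
  have h1 := Lp.eLpNorm_lim_le_liminf_eLpNorm (μ := (volume : Measure (Rn N × Rn N)))
    (p := ENNReal.ofReal p)
    (f := fun n z => gagliardoQuotient s p (zeroExt Ω (w (t (ms n)))) z - y z)
    (fun n => ((hw' _).mem.memLp_quotient h.pos).1.sub (Lp.aestronglyMeasurable y))
    (fun z => gagliardoQuotient s p (zeroExt Ω (w t')) z - y z) (by
      filter_upwards [Admissible.tendsto_gagliardoQuotient hae] with z hz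
      exact hz.sub_const _)
  refine h1.trans (liminf_le_of_frequently_le' (Frequently.of_forall fun n => ?_))
  exact (hmem _).1 (ht (ms n))

end Quotient

/-! ### Regularity of the flow in time -/

namespace IsFlow

variable {N : ℕ} {Ω : Set (Rn N)} {s p e : ℝ} {f₀ : L2 Ω} {u ut : ℝ → L2 Ω}

lemma map_zero (hu : IsFlow Ω s p e f₀ u ut) : u 0 = f₀ := by
  simpa using hu.eq_integral 0 le_rfl

lemma sub_eq_integral (hu : IsFlow Ω s p e f₀ u ut) {a b : ℝ} (ha : 0 ≤ a) (hb : 0 ≤ b) :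
    u b - u a = ∫ r in a..b, ut r := by
  rw [hu.eq_integral a ha, hu.eq_integral b hb, add_sub_add_left_eq_sub]
  exact intervalIntegral.integral_interval_sub_left
    (intervalIntegrable_of_memLp_two hu.memLp le_rfl hb)
    (intervalIntegrable_of_memLp_two hu.memLp le_rfl ha)

lemma norm_sub_sq_le (hu : IsFlow Ω s p e f₀ u ut) {a b : ℝ} (ha : 0 ≤ a) (hab : a ≤ b) :
    ‖u b - u a‖ ^ 2 ≤ (b - a) * ∫ r in a..b, ‖ut r‖ ^ 2 := by
  rw [hu.sub_eq_integral ha (ha.trans hab)]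
  exact norm_intervalIntegral_sq_le hab (intervalIntegrable_of_memLp_two hu.memLp ha (ha.trans hab))
    (intervalIntegrable_norm_sq_of_memLp_two hu.memLp ha (ha.trans hab))

lemma memLp_indicator (hu : IsFlow Ω s p e f₀ u ut) : MemLp ((Ioi 0).indicator ut) 2 volume :=
  (memLp_indicator_iff_restrict measurableSet_Ioi).2 hu.memLp

lemma eq_integral_indicator (hu : IsFlow Ω s p e f₀ u ut) {t : ℝ} (ht : 0 ≤ t) :
    u t = f₀ + ∫ r in (0 : ℝ)..t, (Ioi 0).indicator ut r := by
  rw [hu.eq_integral t ht]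
  congr 1
  refine intervalIntegral.integral_congr_ae (Eventually.of_forall fun r hr => ?_)
  rw [uIoc_of_le ht] at hr
  exact (indicator_of_mem (s := Ioi (0 : ℝ)) hr.1 _).symm

/-- The flow is extended to negative times by its initial value, so that continuity and
measurability can be used on the whole line. -/
lemma continuous_max (hu : IsFlow Ω s p e f₀ u ut) : Continuous fun t => u (max t 0) := by
  have h1 : Continuous fun t => f₀ + ∫ r in (0 : ℝ)..t, (Ioi 0).indicator ut r :=
    continuous_const.add (intervalIntegral.continuous_primitive (fun a b => by
      rw [intervalIntegrable_iff]
      exact ((hu.memLp_indicator.locallyIntegrable one_le_two).integrableOn_isCompact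
        isCompact_uIcc).mono_set uIoc_subset_uIcc) 0)
  exact (h1.comp (continuous_id.max continuous_const)).congr fun t =>
    (hu.eq_integral_indicator (le_max_right _ _)).symm

lemma ae_hasDerivAt (hu : IsFlow Ω s p e f₀ u ut) :
    ∀ᵐ t ∂(volume.restrict (Ioi 0)), HasDerivAt u (ut t) t := by
  have h1 := LocallyIntegrable.ae_hasDerivAt_integral
    (hu.memLp_indicator.locallyIntegrable one_le_two)
  refine (ae_restrict_iff' measurableSet_Ioi).2 ?_
  filter_upwards [h1] with t ht ht0
  have h2 := (ht 0).const_add f₀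
  rw [indicator_of_mem ht0] at h2
  refine h2.congr_of_eventuallyEq ?_
  filter_upwards [Ioi_mem_nhds ht0] with r hr
  exact hu.eq_integral_indicator (le_of_lt hr)

/-- The spatial form is continuous along the flow, so the pairing with a fixed φ is differentiable
at every time, not just almost every one. `G` extends it to negative times to give a two-sided
derivative at 0. -/
lemma exists_hasDerivAt_inner (h : Admissible Ω s p) (hu : IsFlow Ω s p e f₀ u ut) {φ : L2 Ω}
    (hφ : MemW0 Ω s p (zeroExt Ω φ)) : ∃ G : ℝ → ℝ, (∀ t, 0 ≤ t → inner ℝ (u t) φ = G t) ∧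
      ∀ t, 0 ≤ t →
        HasDerivAt G (-splitForm Ω s p (zeroExt Ω (u t)) (zeroExt Ω (u t)) (zeroExt Ω φ)) t := by
  obtain ⟨B, hB⟩ := InWell.exists_bddW h e
  set S : L2 Ω → ℝ := fun f => splitForm Ω s p (zeroExt Ω f) (zeroExt Ω f) (zeroExt Ω φ) with hS
  have hcS : ContinuousOn S (bddSet Ω s p B) :=
    (h.continuousOn_splitForm (B := B) hφ).comp (f := fun f : L2 Ω => (f, f))
      (continuous_id.prodMk continuous_id).continuousOn fun f hf => ⟨hf, hf⟩
  have hw := hu.weak φ hφ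
  change ∀ t, 0 ≤ t → _ = -∫ r in (0 : ℝ)..t, S (u r) at hw
  change ∃ G : ℝ → ℝ, _ ∧ ∀ t, 0 ≤ t → HasDerivAt G (-S (u t)) t
  clear_value S
  have hc : Continuous fun t => S (u (max t 0)) :=
    hcS.comp_continuous hu.continuous_max fun t => hB _ (hu.inWell _ (le_max_right _ _))
  refine ⟨fun t => inner ℝ f₀ φ - ∫ r in (0 : ℝ)..t, S (u (max r 0)), fun t ht => ?_,
    fun t ht => ?_⟩
  · have h1 : ∫ r in (0 : ℝ)..t, S (u (max r 0)) = ∫ r in (0 : ℝ)..t, S (u r) := by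
      refine intervalIntegral.integral_congr fun r hr => ?_
      rw [uIcc_of_le ht] at hr
      simp only [max_eq_left hr.1]
    have h2 := hw t ht
    rw [inner_sub_left] at h2
    simp only [h1]
    linarith
  · have h1 := ((hc.integral_hasStrictDerivAt 0 t).hasDerivAt).const_sub (inner ℝ f₀ φ)
    rwa [max_eq_left ht] at h1

/-- The only condition on t > 0 is differentiability of u, so the exceptional null set does not
depend on φ. -/
lemma inner_deriv_eq (h : Admissible Ω s p) (hu : IsFlow Ω s p e f₀ u ut) {φ : L2 Ω}
    (hφ : MemW0 Ω s p (zeroExt Ω φ)) {t : ℝ} (ht : 0 < t) (hd : HasDerivAt u (ut t) t) :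
    inner ℝ (ut t) φ
      = -splitForm Ω s p (zeroExt Ω (u t)) (zeroExt Ω (u t)) (zeroExt Ω φ) := by
  obtain ⟨G, h1, h2⟩ := hu.exists_hasDerivAt_inner h hφ
  have h3 : HasDerivAt (fun r => inner ℝ (u r) φ) (inner ℝ (ut t) φ) t := by
    simpa using hd.inner ℝ (hasDerivAt_const t φ)
  refine h3.unique ((h2 t ht.le).congr_of_eventuallyEq ?_)
  filter_upwards [Ioi_mem_nhds ht] with r hr
  exact h1 r (le_of_lt hr)

end IsFlow

/-! ### The weak formulation -/

section Weak

variable {N : ℕ} {Ω : Set (Rn N)} {s p e : ℝ} {f₀ : L2 Ω} {u ut : ℝ → L2 Ω}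

lemma Admissible.integrableOn_rpow_sub_two_mul (h : Admissible Ω s p) {w v : Rn N → ℝ}
    (hw : MemW0 Ω s p w) (hv : MemW0 Ω s p v) :
    IntegrableOn (fun x => |w x| ^ (p - 2) * w x * v x) Ω volume := by
  refine h.integrableOn_comp_mul (continuous_abs_rpow_sub_two_mul_self h.two_le) zero_le_one
    (fun r => ?_) hw hv
  have := h.two_le
  have := h.lt_gainExp
  rw [abs_abs_rpow_sub_two_mul_self h.two_le, one_mul]
  exact rpow_le_one_add_rpow (abs_nonneg r) (by linarith) (by linarith)

lemma Admissible.splitForm_self_eq (h : Admissible Ω s p) {w v : Rn N → ℝ}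
    (hw : MemW0 Ω s p w) (hv : MemW0 Ω s p v) :
    splitForm Ω s p w w v = formK s p w v + (∫ x in Ω, |w x| ^ (p - 2) * w x * v x)
      - ∫ x in Ω, |w x| ^ (p - 2) * w x * Real.log |w x| * v x := by
  have h1 := h.integrableOn_incPart_mul hw hv
  have h2 := h.integrableOn_decPart_mul hw hv
  have h3 := h.integrableOn_rpow_sub_two_mul hw hv
  have h4 : (fun x => |w x| ^ (p - 2) * w x * Real.log |w x| * v x)
      = fun x => |w x| ^ (p - 2) * w x * v x - (incPart p (w x) * v x - decPart p (w x) * v x) := by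
    ext x
    rw [← sub_mul, incPart_sub_decPart]
    ring
  have h5 : IntegrableOn (fun x => incPart p (w x) * v x - decPart p (w x) * v x) Ω volume :=
    h1.sub h2
  rw [h4, integral_sub h3 h5, integral_sub h1 h2]
  unfold splitForm
  ring

lemma Admissible.splitForm_self_self (h : Admissible Ω s p) {w : Rn N → ℝ}
    (hw : MemW0 Ω s p w) : splitForm Ω s p w w w = nehari Ω s p w := by
  rw [h.splitForm_self_eq hw hw, formK_eq h.two_le]
  unfold nehari intPow intPowLog
  rw [gagliardoPow_eq h.pos]
  simp_rw [mul_right_comm _ (Real.log _), abs_rpow_sub_two_mul_self_mul_self h.two_le]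

lemma IsFlow.equation (h : Admissible Ω s p) (hu : IsFlow Ω s p e f₀ u ut) {t : ℝ} (ht : 0 < t)
    (hd : HasDerivAt u (ut t) t) {v : Rn N → ℝ} (hv : MemW0 Ω s p v) :
    (∫ x in Ω, ut t x * v x) + formK s p (zeroExt Ω (u t)) v
        + (∫ x in Ω, |u t x| ^ (p - 2) * u t x * v x)
      = ∫ x in Ω, |u t x| ^ (p - 2) * u t x * Real.log |u t x| * v x := by
  obtain ⟨φ, hφ⟩ := hv.exists_zeroExt h
  have h1 := hu.inner_deriv_eq h (hv.congr_ae h.pos hφ.symm) ht hd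
  have hut := (hu.inWell t ht.le).mem
  rw [splitForm_congr_ae h.two_le (ae_eq_refl _) (ae_eq_refl _) hφ, h.splitForm_self_eq hut hv,
    inner_eq_integral h.measurableSet] at h1
  have hΩ := h.measurableSet
  have e1 : ∫ x in Ω, zeroExt Ω (ut t) x * zeroExt Ω φ x = ∫ x in Ω, ut t x * v x := by
    refine integral_congr_ae ?_
    filter_upwards [zeroExt_ae_restrict hΩ (ut t), ae_restrict_of_ae hφ] with x h1 h2
    rw [h1, h2]
  have e2 : ∫ x in Ω, |zeroExt Ω (u t) x| ^ (p - 2) * zeroExt Ω (u t) x * v x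
      = ∫ x in Ω, |u t x| ^ (p - 2) * u t x * v x := by
    refine integral_congr_ae ?_
    filter_upwards [zeroExt_ae_restrict hΩ (u t)] with x h1
    rw [h1]
  have e3 : ∫ x in Ω, |zeroExt Ω (u t) x| ^ (p - 2) * zeroExt Ω (u t) x
        * Real.log |zeroExt Ω (u t) x| * v x
      = ∫ x in Ω, |u t x| ^ (p - 2) * u t x * Real.log |u t x| * v x := by
    refine integral_congr_ae ?_
    filter_upwards [zeroExt_ae_restrict hΩ (u t)] with x h1
    rw [h1]
  rw [e1, e2, e3] at h1
  linarith

lemma timeInterval_top : timeInterval ⊤ = Ioi 0 := by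
  ext t
  simp [timeInterval, EReal.coe_lt_top]

lemma IsFlow.memLinftyW0 [Fact (2 ≤ p)] (h : Admissible Ω s p) (hu : IsFlow Ω s p e f₀ u ut) :
    MemLinftyW0 Ω s p ⊤ u := by
  obtain ⟨B, hB⟩ := InWell.exists_bddW h e
  have hwB : ∀ t, u (max t 0) ∈ bddSet Ω s p B := fun t => hB _ (hu.inWell _ (le_max_right _ _))
  have : Fact (ENNReal.ofReal p ≠ ⊤) := ⟨ENNReal.ofReal_ne_top⟩
  have : IsSeparable (volume : Measure (Rn N × Rn N)) := isSeparable_of_sigmaFinite _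
  have hm : StronglyMeasurable fun t => quotientLp s p (u (max t 0)) := by
    borelize ↥(Lp ℝ (ENNReal.ofReal p) (volume : Measure (Rn N × Rn N)))
    refine (measurable_of_measurableSet_preimage_closedBall fun y r hr => ?_).stronglyMeasurable
    have := (isClosed_setOf_quotientLp_mem_closedBall h hu.continuous_max hwB y hr.le).measurableSet
    simpa only [preimage, mem_closedBall_iff_norm] using this
  refine ⟨fun t => quotientLp s p (u (max t 0)), ?_, ?_⟩
  · exact memLp_top_of_bound hm.aestronglyMeasurable (B ^ p⁻¹)
      (Eventually.of_forall fun t => norm_quotientLp_le h.pos (hwB t))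
  · rw [timeInterval_top]
    refine (ae_restrict_iff' measurableSet_Ioi).2 (Eventually.of_forall fun t ht => ?_)
    have ht0 : max t 0 = t := max_eq_left (le_of_lt ht)
    have hmem := (hu.inWell t (le_of_lt ht)).mem
    simp only [ht0]
    exact ⟨hmem, coeFn_quotientLp h.pos hmem⟩

theorem IsFlow.isWeakSolution [Fact (2 ≤ p)] (h : Admissible Ω s p)
    (hu : IsFlow Ω s p e f₀ u ut) {u₀ : Rn N → ℝ} (hf : zeroExt Ω f₀ =ᵐ[volume] u₀) :
    IsWeakSolution Ω s p u₀ ⊤ u ut where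
  memLinfty := hu.memLinftyW0 h
  deriv_memLp := by
    rw [timeInterval_top]
    exact hu.memLp
  deriv_eq t ht := by
    rw [timeInterval_top] at ht
    rw [hu.map_zero]
    exact hu.eq_integral t (le_of_lt ht)
  equation := by
    rw [timeInterval_top]
    filter_upwards [hu.ae_hasDerivAt, ae_restrict_mem measurableSet_Ioi] with t hd ht v hv
    exact hu.equation h ht hd hv
  initial := by
    rw [hu.map_zero]
    exact (zeroExt_ae_restrict h.measurableSet f₀).symm.trans (ae_restrict_of_ae hf)

end Weak

/-! ### Decay of the flow -/

/-- The bound is b D^(-β), the exact solution of y' = -2κ y^(p/2) times (p/2)^β. At a contact point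
the comparison ODE has slope p/2 times that of the bound; as p/2 > 1 and both are negative, y falls
strictly faster and cannot cross. -/
lemma le_of_hasDerivWithinAt_superlinear {y n : ℝ → ℝ} {κ p : ℝ} (hp : 2 < p) (hκ : 0 < κ)
    (hy : ContinuousOn y (Ici 0)) (hd : ∀ x, 0 ≤ x → HasDerivWithinAt y (-2 * n x) (Ici x) x)
    (hn : ∀ x, 0 ≤ x → κ * y x ^ (p / 2) ≤ n x) (h0 : 0 < y 0) {t : ℝ} (ht : 0 ≤ t) :
    y t ≤ y 0 * (p / (2 * (1 + κ * (p - 2) * y 0 ^ ((p - 2) / 2) * t))) ^ (2 / (p - 2)) := by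
  have hp2 : 0 < p - 2 := by linarith
  set β := 2 / (p - 2) with hβ
  set a := y 0 ^ ((p - 2) / 2) with ha
  have ha0 : 0 < a := Real.rpow_pos_of_pos h0 _
  set D : ℝ → ℝ := fun x => 1 + κ * (p - 2) * a * x with hD
  have hD0 : ∀ x, 0 ≤ x → 0 < D x := fun x hx => by
    have : 0 ≤ κ * (p - 2) * a * x := by positivity
    simp only [hD]; linarith
  set b : ℝ := y 0 * (p / 2) ^ β with hb
  have hb0 : 0 < b := by positivity
  have hDd : ∀ x, HasDerivAt D (κ * (p - 2) * a) x := fun x => by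
    simpa only [id_eq, mul_one] using ((hasDerivAt_id x).const_mul (κ * (p - 2) * a)).const_add 1
  have hBd : ∀ x, 0 ≤ x → HasDerivAt (fun x => b * D x ^ (-β))
      (b * (κ * (p - 2) * a * (-β) * D x ^ (-β - 1))) x := fun x hx =>
    ((hDd x).rpow_const (Or.inl (hD0 x hx).ne')).const_mul b
  have hβp : β * (p / 2) = β + 1 := by rw [hβ]; field_simp; ring
  have hpow : ∀ x, 0 ≤ x →
      (b * D x ^ (-β)) ^ (p / 2) = p / 2 * (b * a * D x ^ (-β - 1)) := by
    intro x hx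
    have hDx := hD0 x hx
    have e1 : y 0 ^ (p / 2) = y 0 * a := by
      rw [ha, ← Real.rpow_one_add' h0.le (by positivity)]
      congr 1; ring
    rw [Real.mul_rpow hb0.le (by positivity), hb, Real.mul_rpow h0.le (by positivity),
      ← Real.rpow_mul (by positivity), ← Real.rpow_mul hDx.le, hβp, neg_mul, hβp, e1,
      Real.rpow_add_one (by positivity), neg_add']
    ring
  have hmain := image_le_of_deriv_right_lt_deriv_boundary' (a := 0) (b := t)
    (hy.mono Icc_subset_Ici_self) (fun x hx => hd x hx.1) (B := fun x => b * D x ^ (-β))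
    (B' := fun x => b * (κ * (p - 2) * a * (-β) * D x ^ (-β - 1))) ?_
    (fun x hx => (hBd x hx.1).continuousAt.continuousWithinAt)
    (fun x hx => (hBd x hx.1).hasDerivWithinAt) ?_ (right_mem_Icc.2 ht)
  · refine hmain.trans_eq ?_
    have hDt := hD0 t ht
    rw [hb, mul_assoc, show 1 + κ * (p - 2) * a * t = D t from rfl,
      show p / (2 * D t) = p / 2 * (D t)⁻¹ by field_simp,
      Real.mul_rpow (by positivity) (by positivity), Real.inv_rpow hDt.le, Real.rpow_neg hDt.le]
  · have h1 : (1 : ℝ) ≤ (p / 2) ^ β := Real.one_le_rpow (by linarith) (by positivity)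
    have h2 : D 0 = 1 := by simp [hD]
    simp only [h2, Real.one_rpow, mul_one, hb]
    exact le_mul_of_one_le_right h0.le h1
  · intro x hx hxe
    have h1 := hn x hx.1
    rw [hxe, hpow x hx.1] at h1
    have h2 : 0 < κ * (b * a * D x ^ (-β - 1)) := by
      have := hD0 x hx.1
      positivity
    have h3 : b * (κ * (p - 2) * a * (-β) * D x ^ (-β - 1))
        = -2 * (κ * (b * a * D x ^ (-β - 1))) := by
      rw [hβ]; field_simp
    rw [h3]
    nlinarith

/-- Here strictness comes from a rate slightly below κ, chosen in terms of the final time t. The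
loss is exp(t / (t + 1)) ≤ e. -/
lemma le_of_hasDerivWithinAt_linear {y n : ℝ → ℝ} {κ : ℝ} (hy : ContinuousOn y (Ici 0))
    (hd : ∀ x, 0 ≤ x → HasDerivWithinAt y (-2 * n x) (Ici x) x)
    (hn : ∀ x, 0 ≤ x → κ * y x ≤ n x) (h0 : 0 < y 0) {t : ℝ} (ht : 0 ≤ t) :
    y t ≤ y 0 * Real.exp (1 - 2 * κ * t) := by
  set c := κ - 1 / (2 * (t + 1)) with hc
  have hcκ : c < κ := by
    have : 0 < 1 / (2 * (t + 1)) := by positivity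
    linarith
  have hBd : ∀ x, HasDerivAt (fun x => y 0 * Real.exp (-2 * c * x))
      (y 0 * (Real.exp (-2 * c * x) * (-2 * c))) x := fun x => by
    simpa using (((hasDerivAt_id x).const_mul (-2 * c)).exp).const_mul (y 0)
  have hmain := image_le_of_deriv_right_lt_deriv_boundary (a := 0) (b := t)
    (hy.mono Icc_subset_Ici_self) (fun x hx => hd x hx.1) (by simp) hBd ?_ (right_mem_Icc.2 ht)
  · refine hmain.trans (mul_le_mul_of_nonneg_left (Real.exp_le_exp.2 ?_) h0.le)
    have h1 : -2 * c * t = t / (t + 1) - 2 * κ * t := by rw [hc]; field_simp; ring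
    have h2 : t / (t + 1) ≤ 1 := (div_le_one (by positivity)).2 (by linarith)
    linarith
  · intro x hx hxe
    have h1 := hn x hx.1
    rw [hxe] at h1
    have h2 : 0 < y 0 * Real.exp (-2 * c * x) := by positivity
    nlinarith

section Decay

variable {N : ℕ} {Ω : Set (Rn N)} {s p e γ C : ℝ} {f₀ : L2 Ω} {u ut : ℝ → L2 Ω}

lemma IsFlow.continuousOn (hu : IsFlow Ω s p e f₀ u ut) : ContinuousOn u (Ici 0) :=
  hu.continuous_max.continuousOn.congr fun t ht => by simp only [max_eq_left (mem_Ici.1 ht)]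

/-- Write ‖u t‖² = 2⟨u t, u x⟩ - ‖u x‖² + ‖u t - u x‖². The pairing with the frozen u x is
differentiable at x by `exists_hasDerivAt_inner`, and the last term is o(t - x), being at most (t -
x) times the integral of ‖ut‖² over (x, t). -/
lemma IsFlow.hasDerivWithinAt_norm_sq (h : Admissible Ω s p) (hu : IsFlow Ω s p e f₀ u ut) {x : ℝ}
    (hx : 0 ≤ x) : HasDerivWithinAt (fun t => ‖u t‖ ^ 2) (-2 * nehari Ω s p (zeroExt Ω (u x)))
      (Ici x) x := by
  have hux := (hu.inWell x hx).mem
  obtain ⟨G, hG, hGd⟩ := hu.exists_hasDerivAt_inner h hux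
  have h1 := hGd x hx
  rw [h.splitForm_self_self hux] at h1
  have h2 : HasDerivWithinAt (fun t => ‖u t - u x‖ ^ 2) 0 (Ici x) x := by
    rw [hasDerivWithinAt_iff_isLittleO]
    simp only [sub_self, norm_zero, smul_zero, sub_zero]
    have hJ : Tendsto (fun z => ∫ r in x..z, ‖ut r‖ ^ 2) (𝓝[Ici x] x) (𝓝 0) := by
      have h3 := intervalIntegral.continuousOn_primitive_interval' (a := x) (b₁ := x) (b₂ := x + 1)
        (intervalIntegrable_norm_sq_of_memLp_two hu.memLp hx (by linarith)) left_mem_uIcc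
      have h4 := (h3 x left_mem_uIcc).tendsto
      rw [intervalIntegral.integral_same, uIcc_of_le (by linarith)] at h4
      rwa [nhdsWithin_Icc_eq_nhdsGE (by linarith)] at h4
    refine Asymptotics.IsLittleO.of_bound fun c hc => ?_
    filter_upwards [hJ.eventually (ge_mem_nhds hc), self_mem_nhdsWithin] with z hz hxz
    have h5 := hu.norm_sub_sq_le hx hxz
    have h6 : 0 ≤ z - x := sub_nonneg.2 hxz
    rw [zero_pow two_ne_zero, sub_zero, Real.norm_of_nonneg (by positivity),
      Real.norm_of_nonneg h6]
    nlinarith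
  have h3 := ((h1.hasDerivWithinAt (s := Ici x)).const_mul 2 |>.sub_const (‖u x‖ ^ 2)).add h2
  refine (h3.congr_of_mem (fun z hz => ?_) self_mem_Ici).congr_deriv (by ring)
  have h4 := hG z (hx.trans hz)
  have h5 := norm_sub_sq_real (u z) (u x)
  simp only [Pi.add_apply]
  linarith

/-- Hölder's inequality on the set Ω of finite measure, raised to the power p. -/
lemma Admissible.rpow_norm_le (h : Admissible Ω s p) (hΩ : 0 < (volume : Measure (Rn N)).real Ω)
    {f : L2 Ω} (hf : MemW0 Ω s p (zeroExt Ω f)) :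
    (volume : Measure (Rn N)).real Ω ^ ((2 - p) / 2) * ‖f‖ ^ p ≤ intPow Ω p (zeroExt Ω f) := by
  have hp := h.pos
  have hae := zeroExt_ae_restrict h.measurableSet f
  have hmem : MemLp f (ENNReal.ofReal p) (volume.restrict Ω) :=
    (hf.memLp.mono_measure Measure.restrict_le_self).ae_eq hae
  have h1 := eLpNorm_le_eLpNorm_mul_rpow_measure_univ (p := 2) (q := ENNReal.ofReal p)
    (μ := volume.restrict Ω) (f := f) (by
      rw [← ENNReal.ofReal_ofNat]; exact ENNReal.ofReal_le_ofReal h.two_le)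
    (Lp.aestronglyMeasurable f)
  set V := (volume : Measure (Rn N)).real Ω with hV
  have hP : ∫ x in Ω, |f x| ^ p = intPow Ω p (zeroExt Ω f) := by
    unfold intPow
    refine integral_congr_ae ?_
    filter_upwards [hae] with x hx
    rw [hx]
  set P := intPow Ω p (zeroExt Ω f) with hPdef
  have hP0 : 0 ≤ P := intPow_nonneg _
  rw [eLpNorm_eq_ofReal_integral_abs_rpow hp hmem, hP, Measure.restrict_apply_univ,
    ENNReal.toReal_ofReal hp.le, ← ENNReal.ofReal_toReal h.finite,
    ← measureReal_def, ← hV, ENNReal.ofReal_rpow_of_pos hΩ, ← ENNReal.ofReal_mul (by positivity)] at h1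
  have h2 : ‖f‖ ≤ P ^ p⁻¹ * V ^ (1 / 2 - 1 / p) := by
    rw [Lp.norm_def]
    exact ENNReal.toReal_le_of_le_ofReal (by positivity) (by simpa using h1)
  have h3 : ‖f‖ ^ p ≤ P * V ^ ((p - 2) / 2) := by
    refine (Real.rpow_le_rpow (norm_nonneg _) h2 hp.le).trans_eq ?_
    rw [Real.mul_rpow (by positivity) (by positivity), ← Real.rpow_mul hP0, inv_mul_cancel₀ hp.ne',
      Real.rpow_one, ← Real.rpow_mul hΩ.le]
    congr 2
    field_simp
  calc V ^ ((2 - p) / 2) * ‖f‖ ^ p ≤ V ^ ((2 - p) / 2) * (P * V ^ ((p - 2) / 2)) := by gcongr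
    _ = P * (V ^ ((2 - p) / 2) * V ^ ((p - 2) / 2)) := by ring
    _ = P := by rw [← Real.rpow_add hΩ, show (2 - p) / 2 + (p - 2) / 2 = 0 by ring, Real.rpow_zero,
        mul_one]

/-- Since R^p = C^(-1/(γ-1)), the condition e < M says p² e < C^(-1/(γ-1)). -/
lemma one_sub_pos_of_lt_boundM (hp : 0 < p) (hγ : 1 < γ) (hC : 0 < C) (he0 : 0 ≤ e)
    (he : e < boundM p γ C) : 0 < 1 - C * (p ^ 2 * e) ^ (γ - 1) := by
  have hγ1 : 0 < γ - 1 := by linarith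
  have h1 : p ^ 2 * e < (1 / C) ^ (1 / (γ - 1)) := by
    unfold boundM radiusR at he
    rwa [lt_div_iff₀ (by positivity), ← Real.rpow_mul (by positivity), mul_comm e,
      show 1 / (p * (γ - 1)) * p = 1 / (γ - 1) by field_simp] at he
  have h2 : (p ^ 2 * e) ^ (γ - 1) < 1 / C := by
    refine (Real.rpow_lt_rpow (by positivity) h1 hγ1).trans_eq ?_
    rw [← Real.rpow_mul (by positivity), one_div_mul_cancel hγ1.ne', Real.rpow_one]
  rw [lt_div_iff₀ hC] at h2
  linarith

/-- Half of the seminorm absorbs the logarithm and the other half is dropped, leaving P - C P^γ for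
the mass P ≤ p² e. One factor P is kept and P^(γ-1) is bounded by (p² e)^(γ-1). -/
lemma InWell.le_nehari (h : Admissible Ω s p) (hΩ : 0 < (volume : Measure (Rn N)).real Ω)
    (hγ : 1 < γ) (hC : IsLogConstant Ω s p γ C) (hκ : 0 < 1 - C * (p ^ 2 * e) ^ (γ - 1))
    {f : L2 Ω} (hf : InWell Ω s p e (zeroExt Ω f)) :
    (volume : Measure (Rn N)).real Ω ^ ((2 - p) / 2) * (1 - C * (p ^ 2 * e) ^ (γ - 1)) * ‖f‖ ^ p
      ≤ nehari Ω s p (zeroExt Ω f) := by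
  have h1 := hC.2 _ hf.mem
  have h2 := hf.intPow_le_level h
  have h3 := h.rpow_norm_le hΩ hf.mem
  have h4 := gagliardoPow_nonneg (s := s) h.pos (zeroExt Ω f)
  have hP0 := intPow_nonneg (Ω := Ω) (p := p) (zeroExt Ω f)
  unfold nehari
  set P := intPow Ω p (zeroExt Ω f)
  have h5 : P ^ γ ≤ P * (p ^ 2 * e) ^ (γ - 1) := by
    have h6 : P ^ γ = P * P ^ (γ - 1) := by
      rw [← Real.rpow_one_add' hP0 (by linarith)]
      congr 1; ring
    rw [h6]
    exact mul_le_mul_of_nonneg_left (Real.rpow_le_rpow hP0 h2 (by linarith)) hP0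
  have h6 := mul_le_mul_of_nonneg_left h5 hC.1.le
  have h7 := mul_le_mul_of_nonneg_right h3 hκ.le
  linarith

section

variable (h : Admissible Ω s p) (hΩ : 0 < (volume : Measure (Rn N)).real Ω) (hγ : 1 < γ)
  (hC : IsLogConstant Ω s p γ C) (he : 0 < 1 - C * (p ^ 2 * e) ^ (γ - 1))
  (hu : IsFlow Ω s p e f₀ u ut) (hf : f₀ ≠ 0)
include h hΩ hγ hC he hu hf

lemma IsFlow.norm_le_rpow (hp : 2 < p) {t : ℝ} (ht : 0 ≤ t) : ‖u t‖ ≤ ‖f₀‖ *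
    (p / (2 * (1 + (volume : Measure (Rn N)).real Ω ^ ((2 - p) / 2)
      * (1 - C * (p ^ 2 * e) ^ (γ - 1)) * (p - 2) * ‖f₀‖ ^ (p - 2) * t))) ^ (1 / (p - 2)) := by
  have hf0 : 0 < ‖f₀‖ := norm_pos_iff.2 hf
  set κ := (volume : Measure (Rn N)).real Ω ^ ((2 - p) / 2) * (1 - C * (p ^ 2 * e) ^ (γ - 1))
    with hκ
  have hκ0 : 0 < κ := by positivity
  have hp2 : 0 < p - 2 := by linarith
  have hpow : ∀ (w : L2 Ω) (r : ℝ), (‖w‖ ^ 2) ^ (r / 2) = ‖w‖ ^ r := fun w r => by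
    rw [← Real.rpow_natCast_mul (norm_nonneg _)]
    congr 1
    push_cast
    ring
  have h1 := le_of_hasDerivWithinAt_superlinear (y := fun t => ‖u t‖ ^ 2) hp hκ0
    (hu.continuousOn.norm.pow 2)
    (fun x hx => hu.hasDerivWithinAt_norm_sq h hx)
    (fun x hx => by
      simp only [hpow]
      exact (hu.inWell x hx).le_nehari h hΩ hγ hC he)
    (by simp only [hu.map_zero]; positivity) ht
  simp only [hu.map_zero, hpow] at h1
  set X := p / (2 * (1 + κ * (p - 2) * ‖f₀‖ ^ (p - 2) * t)) with hX
  have hX0 : 0 ≤ X := by positivity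
  refine (sq_le_sq₀ (norm_nonneg _) (by positivity)).1 (h1.trans_eq ?_)
  rw [mul_pow, ← Real.rpow_mul_natCast hX0]
  congr 2
  push_cast
  ring

lemma IsFlow.norm_le_exp (hp : p = 2) {t : ℝ} (ht : 0 ≤ t) : ‖u t‖ ≤ ‖f₀‖ *
    Real.exp (1 / 2 - (volume : Measure (Rn N)).real Ω ^ ((2 - p) / 2)
      * (1 - C * (p ^ 2 * e) ^ (γ - 1)) * t) := by
  have hf0 : 0 < ‖f₀‖ := norm_pos_iff.2 hf
  set κ := (volume : Measure (Rn N)).real Ω ^ ((2 - p) / 2) * (1 - C * (p ^ 2 * e) ^ (γ - 1))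
    with hκ
  have h1 := le_of_hasDerivWithinAt_linear (y := fun t => ‖u t‖ ^ 2) (κ := κ)
    (hu.continuousOn.norm.pow 2)
    (fun x hx => hu.hasDerivWithinAt_norm_sq h hx)
    (fun x hx => by
      have h2 := (hu.inWell x hx).le_nehari h hΩ hγ hC he
      rwa [show ‖u x‖ ^ p = ‖u x‖ ^ 2 by rw [hp]; exact Real.rpow_two _] at h2)
    (by simp only [hu.map_zero]; positivity) ht
  simp only [hu.map_zero] at h1
  refine (sq_le_sq₀ (norm_nonneg _) (by positivity)).1 (h1.trans_eq ?_)
  rw [mul_pow, ← Real.exp_nat_mul]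
  congr 2
  push_cast
  ring

end

end Decay

end FracLogHeat

end

/-! ### Assembly -/

theorem theorem1p2 {N : ℕ} (Ω : Set (FracLogHeat.Rn N))
    (hΩ_open : IsOpen Ω) (hΩ_conn : IsConnected Ω) (hΩ_bdd : Bornology.IsBounded Ω)
    (hΩ_lip : FracLogHeat.HasLipschitzBoundary Ω)
    (s p : ℝ) [Fact (2 ≤ p)] (hs0 : 0 < s) (hs1 : s < 1) (hN : s * p < (N : ℝ)) :
    (∀ γ : ℝ, 1 < γ → ∃ C : ℝ, FracLogHeat.IsLogConstant Ω s p γ C) ∧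
    ∀ u₀ : FracLogHeat.Rn N → ℝ, u₀ ∈ FracLogHeat.potentialWell Ω s p →
      ∃ u ut : ℝ → FracLogHeat.L2 Ω,
        FracLogHeat.IsWeakSolution Ω s p u₀ ⊤ u ut ∧
        (∀ t : ℝ, 0 ≤ t →
          FracLogHeat.MemW0 Ω s p (FracLogHeat.zeroExt Ω (u t)) ∧
          (∫ τ in (0 : ℝ)..t, ‖ut τ‖ ^ 2)
              + FracLogHeat.energy Ω s p (FracLogHeat.zeroExt Ω (u t))
            ≤ FracLogHeat.energy Ω s p u₀) ∧
        ∀ γ C : ℝ, 1 < γ → FracLogHeat.IsLogConstant Ω s p γ C →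
          FracLogHeat.energy Ω s p u₀ < FracLogHeat.boundM p γ C →
            0 < FracLogHeat.kappa Ω s p γ C u₀ ∧
            (2 < p → ∀ t : ℝ, 0 ≤ t →
              ‖u t‖ ≤ FracLogHeat.normL2 Ω u₀ *
                (p / (2 * (1 + FracLogHeat.kappa Ω s p γ C u₀ * (p - 2)
                    * FracLogHeat.normL2 Ω u₀ ^ (p - 2) * t))) ^ (1 / (p - 2))) ∧
            (p = 2 → ∀ t : ℝ, 0 ≤ t →
              ‖u t‖ ≤ FracLogHeat.normL2 Ω u₀ *
                Real.exp (1 / 2 - FracLogHeat.kappa Ω s p γ C u₀ * t)) := by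
  have hp : 2 ≤ p := Fact.out
  have hN0 : 0 < N := by
    rw [← Nat.cast_pos (α := ℝ)]
    have : 0 < s * p := by positivity
    linarith
  have h : FracLogHeat.Admissible Ω s p :=
    ⟨hs0, hp, hN0, hΩ_open.measurableSet, hΩ_bdd.measure_lt_top.ne⟩
  have hp0 := h.pos
  refine ⟨fun γ hγ => FracLogHeat.exists_isLogConstant hs0 hp hN0 h.measurableSet h.finite hγ,
    fun u₀ ⟨⟨hu₀, hne⟩, hlt, hI⟩ => ?_⟩
  obtain ⟨f₀, hf₀⟩ := hu₀.exists_zeroExt h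
  have hmem := hu₀.congr_ae hp0 hf₀.symm
  have hE : FracLogHeat.energy Ω s p (FracLogHeat.zeroExt Ω f₀) = FracLogHeat.energy Ω s p u₀ :=
    FracLogHeat.energy_congr_ae hp0 hf₀
  -- Positivity of the Nehari functional at u₀ enters here: the mass is at most p² E(u₀) < p² d,
  -- which starts the scheme inside the well.
  have hP : FracLogHeat.intPow Ω p (FracLogHeat.zeroExt Ω f₀)
      ≤ p ^ 2 * FracLogHeat.energy Ω s p u₀ := by
    rw [FracLogHeat.intPow_congr_ae (ae_restrict_of_ae hf₀)]
    exact FracLogHeat.intPow_le_of_nehari_nonneg hp0 hI.le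
  have hwell : FracLogHeat.InWell Ω s p (FracLogHeat.energy Ω s p u₀)
      (FracLogHeat.zeroExt Ω f₀) :=
    ⟨hmem, hP.trans (mul_le_mul_of_nonneg_left hlt.le (by positivity)), hE.le⟩
  have hnorm : FracLogHeat.normL2 Ω u₀ = ‖f₀‖ := by
    have hae : u₀ =ᵐ[volume.restrict Ω] f₀ :=
      (EventuallyEq.symm (ae_restrict_of_ae hf₀)).trans
        (FracLogHeat.zeroExt_ae_restrict h.measurableSet f₀)
    rw [FracLogHeat.normL2, Lp.norm_def, eLpNorm_congr_ae hae]
  have hf₀0 : f₀ ≠ 0 := by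
    rintro rfl
    refine hne (hf₀.symm.trans ?_)
    refine FracLogHeat.ae_of_ae_restrict h.measurableSet
      (P := fun x => FracLogHeat.zeroExt Ω 0 x = 0) ?_
      fun x hx => FracLogHeat.zeroExt_of_notMem _ hx
    filter_upwards [FracLogHeat.zeroExt_ae_restrict h.measurableSet (0 : FracLogHeat.L2 Ω),
      Lp.coeFn_zero ℝ 2 (volume.restrict Ω)] with x h1 h2
    rw [h1, h2, Pi.zero_apply]
  obtain ⟨ut, hu⟩ := FracLogHeat.exists_isFlow h hlt hwell
  refine ⟨_, ut, hu.isWeakSolution h hf₀, fun t ht => ⟨(hu.inWell t ht).mem, hu.energy_le t ht⟩,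
    fun γ C hγ hC hM => ?_⟩
  have hV : 0 < (volume : Measure (FracLogHeat.Rn N)).real Ω :=
    ENNReal.toReal_pos (hΩ_open.measure_pos volume hΩ_conn.nonempty).ne' h.finite
  have hpos := FracLogHeat.one_sub_pos_of_lt_boundM hp0 hγ hC.1 (hE ▸ hwell.energy_nonneg h) hM
  rw [hnorm]
  exact ⟨mul_pos (Real.rpow_pos_of_pos hV _) hpos,
    fun hp2 t ht => hu.norm_le_rpow h hV hγ hC hpos hf₀0 hp2 ht,
    fun hp2 t ht => hu.norm_le_exp h hV hγ hC hpos hf₀0 hp2 ht⟩
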